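/- **Setting.** On $\mathbb{CP}^2$ with homogeneous coordinates $[Z_1:Z_2:Z_3]$ put $z^i=Z_i/Z_3=|z^i|e^{i\theta_i}$ ($i=1,2$) and $y^k=|Z_k|^2/(|Z_1|^2+|Z_2|^2+|Z_3|^2)$ ($k=1,2,3$). Let $I_-$ be the standard complex structure, $\sigma=i\,z^1z^2\,\partial_{z^1}\wedge\partial_{z^2}$, $Q=4\,\mathrm{Im}\,\sigma$, $h=-\tfrac14\log(y^1y^2y^3)$, and let $\phi_t$ be the flow of $V=Q^\#dh$, where $\langle\alpha,Q^\#\beta\rangle=Q(\alpha,\beta)$. (Away from the divisor $D=\{Z_1Z_2Z_3=0\}$, where $h$ is defined, this flow exists for all times.) Hitchin's generalised Kähler structure with flow time $\Delta t$ has the two complex structures $I_-$ and $I_+=(\phi_{\Delta t\,*})^{-1}I_-\,\phi_{\Delta t\,*}$. For $c_3\in(0,1/27)$ let $\omega_1\in\mathbb R_{>0}$, $\omega_2\in i\mathbb R_{>0}$ be the (unique) numbers such that the Weierstrass function $\wp$ with period lattice $2\omega_1\mathbb Z+2\omega_2\mathbb Z$ has the invariants $g_2=\frac1{12}-2c_3$,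 $g_3=\frac{c_3}6-\frac1{216}-c_3^2$. Let $\zeta$ be the Weierstrass zeta function of this lattice, $\eta_i=\zeta(\omega_i)$, $\tilde\eta_1=\eta_1+\omega_1(\frac1{12}-3c_3)$, and for $s\in\mathbb R$ $$\varsigma(s)=\zeta\Big(\omega_2+\frac{s\omega_1}{\pi}\Big)-\eta_2-\frac s\pi\eta_1,\qquad y^k(c_3,s)=\frac{c_3}{\frac1{12}-\wp\big(\omega_2+\frac{\omega_1}{\pi}(s+\frac{2\pi k}{3})\big)} .$$ Both are real, as is $\eta_1$. Setting $y^k=y^k(c_3,s)$ and $z^i=(y^i/y^3)^{1/2}e^{i\theta_i}$ gives a surjective parametrization, with everywhere invertible derivative, of $\{p\notin D: y^1y^2y^3<1/27\}$ by $(c_3,s,\theta_1,\theta_2)\in(0,1/27)\times\mathbb R^3$; so $(c_3,s,\theta_1,\theta_2)$ are local coordinates there. For an endomorphism $A$ of the tangent bundle write $A^a{}_b=\langle dx^a,A\,\partial_b\rangle$ for its components in these coordinates. Let $J(c_3,s)$ be the matrix whose entries, with $y^k=y^k(c_3,s)$, are $$J^{\theta_1}{}_s=\tfrac{\omega_1}{2\pi}(3y^2-1),\qquad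 J^{\theta_2}{}_s=\tfrac{\omega_1}{2\pi}(1-3y^1),$$ $$J^{\theta_1}{}_{c_3}=\frac{1+3y^2-18y^1y^2-6\varsigma(s)(1-3y^2)}{4c_3(1-27c_3)},\qquad J^{\theta_2}{}_{c_3}=\frac{1+3y^1-18y^1y^2+6\varsigma(s)(1-3y^1)}{4c_3(1-27c_3)},$$ $$(J^{c_3}{}_{\theta_1},J^{c_3}{}_{\theta_2})=\tfrac{4\pi c_3}{\omega_1}(-J^{\theta_2}{}_s,\,J^{\theta_1}{}_s),\qquad (J^{s}{}_{\theta_1},J^{s}{}_{\theta_2})=\tfrac{4\pi c_3}{\omega_1}(J^{\theta_2}{}_{c_3},\,-J^{\theta_1}{}_{c_3}),$$ all other entries being $0$. **Statement.** For every $\Delta t\in\mathbb R$, at every point with coordinates $(c_3,s,\theta_1,\theta_2)$, $c_3\in(0,1/27)$, the components of $I_-$ are those of $J(c_3,s)$, the flow $\phi_{\Delta t}$ is differentiable there with invertible derivative, and with $$s'=s+\frac{\pi\Delta t}{\omega_1},\qquad \kappa=\frac{3\tilde\eta_1\pi\Delta t}{\omega_1^2c_3(1-27c_3)}$$ the components of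 $I_+$ are, for $i=1,2$, $$(I_+)^{\theta_i}{}_s=J^{\theta_i}{}_s(c_3,s'),\qquad (I_+)^{\theta_i}{}_{c_3}=J^{\theta_i}{}_{c_3}(c_3,s')+\kappa\,J^{\theta_i}{}_s(c_3,s'),$$ $$(I_+)^{s}{}_{\theta_i}=J^{s}{}_{\theta_i}(c_3,s')-\kappa\,J^{c_3}{}_{\theta_i}(c_3,s'),\qquad (I_+)^{c_3}{}_{\theta_i}=J^{c_3}{}_{\theta_i}(c_3,s'),$$ all other components of $I_+$ being $0$. Moreover $\kappa=\partial_{c_3}\big(s+\pi\Delta t/\omega_1(c_3)\big)$, so the extra terms come from the $c_3$-dependence of the shift. -/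

import Mathlib

open scoped Manifold ContDiff LinearAlgebra.Projectivization

noncomputable section

/-! ### The complex projective plane -/

/-- `ℂP²`, the space of lines in `ℂ³`. The homogeneous coordinates are `Z 0, Z 1, Z 2`. -/
def CP2 : Type := ℙ ℂ (Fin 3 → ℂ)

namespace CP2

/-- The point `[Z]` with homogeneous coordinates `Z ≠ 0`. -/
def mk (Z : {Z : Fin 3 → ℂ // Z ≠ 0}) : CP2 := Projectivization.mk' ℂ Z

/-- A choice of homogeneous coordinates of a point. -/
def rep (p : CP2) : Fin 3 → ℂ := Projectivization.rep p

/-- The quotient topology. -/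
instance : TopologicalSpace CP2 := TopologicalSpace.coinduced mk inferInstance

lemma rep_ne_zero (p : CP2) : p.rep ≠ 0 := Projectivization.rep_nonzero p

lemma mk_rep (p : CP2) : mk ⟨p.rep, p.rep_ne_zero⟩ = p := Projectivization.mk_rep p

lemma exists_rep_mk (Z : {Z : Fin 3 → ℂ // Z ≠ 0}) :
    ∃ a : ℂ, a ≠ 0 ∧ (mk Z).rep = a • (Z : Fin 3 → ℂ) := by
  obtain ⟨a, ha⟩ := Projectivization.exists_smul_eq_mk_rep ℂ (Z : Fin 3 → ℂ) Z.2
  exact ⟨a, a.ne_zero, ha.symm⟩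

lemma mk_eq_of_smul (Z W : {Z : Fin 3 → ℂ // Z ≠ 0}) (a : ℂ)
    (h : (Z : Fin 3 → ℂ) = a • (W : Fin 3 → ℂ)) : mk Z = mk W :=
  (Projectivization.mk_eq_mk_iff' ℂ _ _ Z.2 W.2).2 ⟨a, h.symm⟩

lemma isQuotientMap_mk : Topology.IsQuotientMap mk :=
  ⟨⟨rfl⟩, fun p => ⟨_, mk_rep p⟩⟩

/-- The point with `Z k = 1`, `Z (k+1) = w.1`, `Z (k+2) = w.2` (indices mod 3). -/
def ofAffine (k : Fin 3) (w : ℂ × ℂ) : CP2 :=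
  mk ⟨fun j => if j = k then 1 else if j = k + 1 then w.1 else w.2,
    fun h => by simpa using congrFun h k⟩

/-- The affine coordinates `(Z (k+1) / Z k, Z (k+2) / Z k)` (indices mod 3). -/
def toAffine (k : Fin 3) (p : CP2) : ℂ × ℂ :=
  (p.rep (k + 1) / p.rep k, p.rep (k + 2) / p.rep k)

lemma toAffine_mk (k : Fin 3) (Z : {Z : Fin 3 → ℂ // Z ≠ 0}) :
    toAffine k (mk Z) = (Z.1 (k + 1) / Z.1 k, Z.1 (k + 2) / Z.1 k) := by
  obtain ⟨a, ha, h⟩ := exists_rep_mk Z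
  simp [toAffine, h, mul_div_mul_left _ _ ha]

lemma rep_mk_ne_zero (k : Fin 3) (Z : {Z : Fin 3 → ℂ // Z ≠ 0}) :
    (mk Z).rep k ≠ 0 ↔ Z.1 k ≠ 0 := by
  obtain ⟨a, ha, h⟩ := exists_rep_mk Z
  simp [h, ha]

lemma isOpen_rep_ne_zero (k : Fin 3) : IsOpen {p : CP2 | p.rep k ≠ 0} := by
  rw [← isQuotientMap_mk.isOpen_preimage]
  have : mk ⁻¹' {p : CP2 | p.rep k ≠ 0} = {Z | Z.1 k ≠ 0} := by
    ext Z; exact rep_mk_ne_zero k Z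
  rw [this]
  exact isOpen_ne_fun ((continuous_apply k).comp continuous_subtype_val) continuous_const

lemma toAffine_ofAffine (k : Fin 3) (w : ℂ × ℂ) : toAffine k (ofAffine k w) = w := by
  rw [ofAffine, toAffine_mk]
  fin_cases k <;> simp

lemma ofAffine_toAffine (k : Fin 3) (p : CP2) (hp : p.rep k ≠ 0) :
    ofAffine k (toAffine k p) = p := by
  conv_rhs => rw [← mk_rep p]
  refine mk_eq_of_smul _ _ (p.rep k)⁻¹ ?_
  funext j
  fin_cases k <;> fin_cases j <;> simp_all [toAffine, div_eq_inv_mul]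

lemma continuousOn_toAffine (k : Fin 3) : ContinuousOn (toAffine k) {p : CP2 | p.rep k ≠ 0} := by
  rw [isQuotientMap_mk.continuousOn_isOpen_iff (isOpen_rep_ne_zero k)]
  have h : toAffine k ∘ mk = fun Z => (Z.1 (k + 1) / Z.1 k, Z.1 (k + 2) / Z.1 k) :=
    funext (toAffine_mk k)
  rw [h]
  have hk : ∀ j : Fin 3, Continuous fun Z : {Z : Fin 3 → ℂ // Z ≠ 0} => Z.1 j :=
    fun j => (continuous_apply j).comp continuous_subtype_val
  have h0 : ∀ Z ∈ mk ⁻¹' {p : CP2 | p.rep k ≠ 0}, Z.1 k ≠ 0 :=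
    fun Z hZ => (rep_mk_ne_zero k Z).1 hZ
  exact ((hk _).continuousOn.div (hk _).continuousOn h0).prodMk
    ((hk _).continuousOn.div (hk _).continuousOn h0)

lemma continuous_ofAffine (k : Fin 3) : Continuous (ofAffine k) := by
  refine isQuotientMap_mk.continuous.comp (Continuous.subtype_mk ?_ _)
  refine continuous_pi fun j => ?_
  by_cases h1 : j = k
  · simpa [h1] using continuous_const
  · by_cases h2 : j = k + 1
    · simpa [h1, h2] using continuous_fst
    · simpa [h1, h2] using continuous_snd

/-- The affine chart on `Z k ≠ 0`. -/
def affineChart (k : Fin 3) : OpenPartialHomeomorph CP2 (ℂ × ℂ) where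
  toFun := toAffine k
  invFun := ofAffine k
  source := {p | p.rep k ≠ 0}
  target := Set.univ
  map_source' _ _ := trivial
  map_target' w _ := (rep_mk_ne_zero k _).2 (by simp)
  left_inv' p hp := ofAffine_toAffine k p hp
  right_inv' w _ := toAffine_ofAffine k w
  open_source := isOpen_rep_ne_zero k
  open_target := isOpen_univ
  continuousOn_toFun := continuousOn_toAffine k
  continuousOn_invFun := (continuous_ofAffine k).continuousOn

open Classical in
/-- The affine chart preferred at `p`: the standard one wherever `Z 2 ≠ 0`. -/
def chartIndex (p : CP2) : Fin 3 :=
  if p.rep 2 ≠ 0 then 2 else if p.rep 0 ≠ 0 then 0 else 1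

lemma rep_chartIndex (p : CP2) : p.rep p.chartIndex ≠ 0 := by
  unfold chartIndex
  split_ifs with h2 h0
  · exact h2
  · exact h0
  · intro h1
    refine p.rep_ne_zero (funext fun j => ?_)
    fin_cases j <;> simp_all

instance : ChartedSpace (ℂ × ℂ) CP2 where
  atlas := Set.range affineChart
  chartAt p := affineChart p.chartIndex
  mem_chart_source := rep_chartIndex
  chart_mem_atlas _ := ⟨_, rfl⟩

lemma contDiffOn_transition (k l : Fin 3) :
    ContDiffOn ℂ ω ((affineChart k).symm ≫ₕ affineChart l)
      ((affineChart k).symm ≫ₕ affineChart l).source := by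
  have hs : ∀ j, ContDiff ℂ ω fun w : ℂ × ℂ =>
      (if j = k then 1 else if j = k + 1 then w.1 else w.2 : ℂ) := by
    intro j
    by_cases h1 : j = k
    · simpa [h1] using contDiff_const
    · by_cases h2 : j = k + 1
      · simpa [h1, h2] using contDiff_fst
      · simpa [h1, h2] using contDiff_snd
  refine ContDiffOn.congr (f := fun w : ℂ × ℂ =>
    ((if l + 1 = k then 1 else if l + 1 = k + 1 then w.1 else w.2) /
        (if l = k then 1 else if l = k + 1 then w.1 else w.2),
      (if l + 2 = k then 1 else if l + 2 = k + 1 then w.1 else w.2) /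
        (if l = k then 1 else if l = k + 1 then w.1 else w.2))) ?_ ?_
  · refine ContDiffOn.prodMk ?_ ?_ <;>
    · refine ContDiffOn.div (hs _).contDiffOn (hs _).contDiffOn ?_
      rintro w ⟨-, hw⟩
      exact (rep_mk_ne_zero l _).1 hw
  · rintro w -
    exact toAffine_mk l _

/-- `ℂP²` is a complex manifold. -/
instance : IsManifold 𝓘(ℂ, ℂ × ℂ) ω CP2 := by
  refine isManifold_of_contDiffOn _ _ _ ?_
  rintro _ _ ⟨k, rfl⟩ ⟨l, rfl⟩
  simpa using contDiffOn_transition k l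

/-- The underlying real manifold of `ℂP²`. -/
instance : IsManifold 𝓘(ℝ, ℂ × ℂ) ω CP2 := by
  refine isManifold_of_contDiffOn _ _ _ ?_
  rintro _ _ ⟨k, rfl⟩ ⟨l, rfl⟩
  simpa using (contDiffOn_transition k l).restrict_scalars ℝ

end CP2

/-! ### Hitchin's construction -/

/-- The real tangent space of `ℂP²` at `p`. Its elements are the pairs `(dz₁, dz₂)`, where
`(z₁, z₂)` are the affine coordinates of the preferred chart at `p`. -/
abbrev TCP2 (p : CP2) : Type := TangentSpace 𝓘(ℝ, ℂ × ℂ) p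

/-- Multiplication by `i` on `ℂ²`, as a real-linear map. -/
def mulI : (ℂ × ℂ) →L[ℝ] (ℂ × ℂ) := Complex.I • ContinuousLinearMap.id ℝ (ℂ × ℂ)

/-- The standard complex structure `I₋` of `ℂP²`. -/
def Iminus (p : CP2) : TCP2 p →L[ℝ] TCP2 p := mulI

/-- The value of a real covector `α` (extended complex-linearly) on the `(1,0)`-part
`(v - i I₋ v) / 2` of a tangent vector `v`. -/
def evalHol (α : (ℂ × ℂ) →L[ℝ] ℝ) (v : ℂ × ℂ) : ℂ :=
  ((α v : ℂ) - Complex.I * (α (mulI v) : ℂ)) / 2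

/-- The torus invariant holomorphic Poisson tensor `σ = i z₁ z₂ ∂/∂z₁ ∧ ∂/∂z₂`, in the affine
coordinates `(z₁, z₂)` of the preferred chart. -/
def sigmaCP2 (p : CP2) (α β : TCP2 p →L[ℝ] ℝ) : ℂ :=
  Complex.I * (chartAt (ℂ × ℂ) p p).1 * (chartAt (ℂ × ℂ) p p).2 *
    (evalHol α (1, 0) * evalHol β (0, 1) - evalHol α (0, 1) * evalHol β (1, 0))

/-- The Hitchin Poisson tensor `Q = 4 Im σ`. -/
def hitchinQ (p : CP2) (α β : TCP2 p →L[ℝ] ℝ) : ℝ := 4 * (sigmaCP2 p α β).im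

/-- The covector `dx₁`, for `z₁ = x₁ + i y₁`. -/
def reFst : (ℂ × ℂ) →L[ℝ] ℝ := Complex.reCLM ∘L ContinuousLinearMap.fst ℝ ℂ ℂ
/-- The covector `dy₁`, for `z₁ = x₁ + i y₁`. -/
def imFst : (ℂ × ℂ) →L[ℝ] ℝ := Complex.imCLM ∘L ContinuousLinearMap.fst ℝ ℂ ℂ
/-- The covector `dx₂`, for `z₂ = x₂ + i y₂`. -/
def reSnd : (ℂ × ℂ) →L[ℝ] ℝ := Complex.reCLM ∘L ContinuousLinearMap.snd ℝ ℂ ℂ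
/-- The covector `dy₂`, for `z₂ = x₂ + i y₂`. -/
def imSnd : (ℂ × ℂ) →L[ℝ] ℝ := Complex.imCLM ∘L ContinuousLinearMap.snd ℝ ℂ ℂ

/-- The tangent vector `Q^♯ β`, that is, `α (Q^♯ β) = Q(α, β)` for all covectors `α`. -/
def hitchinSharp (p : CP2) (β : TCP2 p →L[ℝ] ℝ) : TCP2 p :=
  ((⟨hitchinQ p reFst β, hitchinQ p imFst β⟩, ⟨hitchinQ p reSnd β, hitchinQ p imSnd β⟩) : ℂ × ℂ)

lemma covector_apply (α : (ℂ × ℂ) →L[ℝ] ℝ) (a b c d : ℝ) :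
    α (⟨a, b⟩, ⟨c, d⟩) =
      a * α (1, 0) + b * α (Complex.I, 0) + c * α (0, 1) + d * α (0, Complex.I) := by
  have h : ((⟨a, b⟩, ⟨c, d⟩) : ℂ × ℂ) =
      a • ((1, 0) : ℂ × ℂ) + b • ((Complex.I, 0) : ℂ × ℂ) + c • ((0, 1) : ℂ × ℂ) +
        d • ((0, Complex.I) : ℂ × ℂ) := by
    ext <;> simp [Complex.mk_eq_add_mul_I]
  rw [h]
  simp only [map_add, map_smul, smul_eq_mul]

lemma apply_hitchinSharp (p : CP2) (α β : TCP2 p →L[ℝ] ℝ) :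
    α (hitchinSharp p β) = hitchinQ p α β := by
  refine (covector_apply α _ _ _ _).trans ?_
  unfold hitchinQ sigmaCP2 evalHol
  generalize chartAt (ℂ × ℂ) p p = z
  simp [mulI, reFst, imFst, reSnd, imSnd]
  ring

/-- The functions `y¹, y², y³` on `ℂP²`: `y^{k+1} = |Z k|² / (|Z 0|² + |Z 1|² + |Z 2|²)`. -/
def moment (k : Fin 3) (p : CP2) : ℝ := ‖p.rep k‖ ^ 2 / ∑ j, ‖p.rep j‖ ^ 2

/-- The divisor `Z 0 * Z 1 * Z 2 = 0`, where `σ` vanishes. -/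
def sigmaDivisor : Set CP2 := {p | ∃ k, p.rep k = 0}

/-- The Hamiltonian `h = -(1/4) log (y¹ y² y³)`. -/
def hitchinH (p : CP2) : ℝ := -(1 / 4) * Real.log (∏ k, moment k p)

/-- The vector field `V = Q^♯ dh` (off the divisor, where `h` is defined). -/
def hitchinV (p : CP2) : TCP2 p := hitchinSharp p (mfderiv 𝓘(ℝ, ℂ × ℂ) 𝓘(ℝ, ℝ) hitchinH p)

/-- `φ` is the flow of `V`. Only the complement of the divisor, where `V = Q^♯ dh` makes sense,
is involved; it is preserved by the flow and dense. -/
structure IsHitchinFlow (φ : ℝ → CP2 → CP2) : Prop where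
  zero : ∀ p ∉ sigmaDivisor, φ 0 p = p
  mapsTo : ∀ t, ∀ p ∉ sigmaDivisor, φ t p ∉ sigmaDivisor
  integralCurve : ∀ p ∉ sigmaDivisor, IsMIntegralCurve (I := 𝓘(ℝ, ℂ × ℂ)) (fun t => φ t p) hitchinV

/-- The second complex structure `I₊ = (φ_*)⁻¹ I₋ φ_*` of Hitchin's construction, for the
diffeomorphism `φ` (the flow at a fixed time). -/
def Iplus (φ : CP2 → CP2) (p : CP2) : TCP2 p →L[ℝ] TCP2 p :=
  (mfderiv 𝓘(ℝ, ℂ × ℂ) 𝓘(ℝ, ℂ × ℂ) φ p).inverse ∘L Iminus (φ p) ∘L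
    mfderiv 𝓘(ℝ, ℂ × ℂ) 𝓘(ℝ, ℂ × ℂ) φ p

/-! ### Weierstrass functions -/

/-- The Weierstrass zeta function of a lattice. -/
def weierstrassZeta (L : PeriodPair) (z : ℂ) : ℂ :=
  1 / z + ∑' l : L.lattice, if l = 0 then 0 else (1 / (z - l) + 1 / l + z / l ^ 2 : ℂ)

/-- The pair of full periods `(2ω₁, 2ω₂)`, with `ω₁ > 0` and `ω₂ ∈ i ℝ_{>0}`, whose `℘`-function has
the invariants `g₂ = 1/12 - 2 c₃` and `g₃ = c₃/6 - 1/216 - c₃²`. -/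
structure IsPeriodPairOf (c : ℝ) (L : PeriodPair) : Prop where
  im_one : L.ω₁.im = 0
  re_one : 0 < L.ω₁.re
  re_two : L.ω₂.re = 0
  im_two : 0 < L.ω₂.im
  g₂_eq : L.g₂ = 1 / 12 - 2 * c
  g₃_eq : L.g₃ = c / 6 - 1 / 216 - c ^ 2

instance : Nonempty PeriodPair :=
  ⟨⟨1, Complex.I, by simpa using Complex.basisOneI.linearIndependent⟩⟩

/-- The period pair attached to `c₃ ∈ (0, 1/27)`. -/
def periodsOf (c : ℝ) : PeriodPair := Classical.epsilon (IsPeriodPairOf c)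

/-- The half period `ω₁ > 0`. -/
def omega1 (c : ℝ) : ℝ := (periodsOf c).ω₁.re / 2
/-- The half period `ω₂ ∈ i ℝ_{>0}`. -/
def omega2 (c : ℝ) : ℂ := (periodsOf c).ω₂ / 2

/-- `η₁ = ζ(ω₁)`, which is real. -/
def eta1 (c : ℝ) : ℝ := (weierstrassZeta (periodsOf c) (omega1 c)).re
/-- `η₂ = ζ(ω₂)`. -/
def eta2 (c : ℝ) : ℂ := weierstrassZeta (periodsOf c) (omega2 c)
/-- `η̃₁ = η₁ + ω₁ (1/12 - 3 c₃)`. -/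
def etaTilde1 (c : ℝ) : ℝ := eta1 c + omega1 c * (1 / 12 - 3 * c)

/-- `ς(s) = ζ(ω₂ + s ω₁/π) - η₂ - s η₁/π`. -/
def varsigma (c s : ℝ) : ℂ :=
  weierstrassZeta (periodsOf c) (omega2 c + s * omega1 c / Real.pi) - eta2 c - s / Real.pi * eta1 c

/-- `y^{k+1}(c₃, s) = c₃ / (1/12 - ℘(ω₂ + (ω₁/π) (s + 2π(k+1)/3)))` for `k = 0, 1, 2`. -/
def yCurve (k : Fin 3) (c s : ℝ) : ℂ :=
  c / (1 / 12 - (periodsOf c).weierstrassP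
    (omega2 c + omega1 c / Real.pi * (s + 2 * Real.pi * ((k : ℕ) + 1) / 3)))

/-! ### The coordinates `(c₃, s, θ₁, θ₂)` -/

/-- Names of the coordinates: `inl 0` is `c₃`, `inl 1` is `s`, and `inr i` is `θ_{i+1}`. -/
abbrev Coord : Type := Fin 2 ⊕ Fin 2

/-- The tuple of coordinates `(c₃, s, θ₁, θ₂)`. -/
def coords (c s : ℝ) (θ : Fin 2 → ℝ) : Coord → ℝ := Sum.elim ![c, s] θ

/-- The point with coordinates `(c₃, s, θ₁, θ₂)`: its inhomogeneous coordinates are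
`zⁱ = (yⁱ/y³)^{1/2} e^{i θᵢ}`, where `yᵏ = yᵏ(c₃, s)` (which are real and positive). -/
def coordPoint (x : Coord → ℝ) : CP2 :=
  let y := fun k => (yCurve k (x (.inl 0)) (x (.inl 1))).re
  CP2.ofAffine 2
    (Real.sqrt (y 0 / y 2) * Complex.exp (Complex.I * x (.inr 0)),
      Real.sqrt (y 1 / y 2) * Complex.exp (Complex.I * x (.inr 1)))

/-- The derivative of the parametrization; it sends the standard basis to `∂_{c₃}, ∂_s, ∂_{θ₁},
∂_{θ₂}`. -/
def coordFrame (x : Coord → ℝ) : (Coord → ℝ) →L[ℝ] TCP2 (coordPoint x) :=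
  mfderiv 𝓘(ℝ, Coord → ℝ) 𝓘(ℝ, ℂ × ℂ) coordPoint x

/-- The component `A^a_b = ⟨dx^a, A ∂_b⟩` of a field of endomorphisms of the tangent bundle, at the
point with coordinates `x`. -/
def component (A : ∀ p : CP2, TCP2 p →L[ℝ] TCP2 p) (x : Coord → ℝ) (a b : Coord) : ℝ :=
  (coordFrame x).inverse (A (coordPoint x) (coordFrame x (Pi.single b 1))) a

/-- The matrix with the columns `J^{θ}_{c₃}`, `J^{θ}_s`. -/
def Jangle (c s : ℝ) : Matrix (Fin 2) (Fin 2) ℝ :=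
  let y1 := (yCurve 0 c s).re
  let y2 := (yCurve 1 c s).re
  let v := (varsigma c s).re
  !![(1 + 3 * y2 - 18 * y1 * y2 - 6 * v * (1 - 3 * y2)) / (4 * c * (1 - 27 * c)),
      omega1 c / (2 * Real.pi) * (3 * y2 - 1);
    (1 + 3 * y1 - 18 * y1 * y2 + 6 * v * (1 - 3 * y1)) / (4 * c * (1 - 27 * c)),
      omega1 c / (2 * Real.pi) * (1 - 3 * y1)]

/-- The matrix with the rows `J^{c₃}_θ`, `J^s_θ`. -/
def Jradial (c s : ℝ) : Matrix (Fin 2) (Fin 2) ℝ :=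
  (4 * c * Real.pi / omega1 c) •
    !![-Jangle c s 1 1, Jangle c s 0 1;
      Jangle c s 1 0, -Jangle c s 0 0]

/-- The explicit matrix `J(c₃, s)` of the standard complex structure, with entries `J^a_b`. -/
def Jmatrix (c s : ℝ) : Matrix Coord Coord ℝ :=
  Matrix.fromBlocks 0 (Jradial c s) (Jangle c s) 0

end

/-! ### The Weierstrass functions: derivatives and quasi-periodicity -/

namespace PeriodPair
open Filter Topology

variable (L : PeriodPair)

/-! Off the divisor write log zⁱ = rᵢ + iθᵢ. There I₋ is multiplication by i, so for radial
coordinates (c₃, s) with Jacobian M = ∂(r₁, r₂)/∂(c₃, s) its only nonzero blocks are M (radial to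
angular) and -M⁻¹ (angular to radial). The claim about I₋ is thus that `Jangle` is this Jacobian
(`hasFDerivAt_logRadius`) and that `Jradial` is minus its inverse (`Jangle_mul_Jradial`).

Since h depends on the moduli alone, V multiplies each zⁱ by a real factor (`hitchinV_ofAffine`).
The flow therefore fixes the angles, and the yᵏ obey yᵏ' = yᵏ(yᵏ⁺¹ - yᵏ⁺²), which conserves their
sum and their product c₃. For u = y¹y² this gives u'² = (u - c₃)² - 4u³, solved by u = 1/12 - ℘ on
the line through the half period ω₂ (`IsPeriodPairOf.isVolterra_solution`), with time t = ω₁s/π. So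
the flow is the translation s ↦ s + πt/ω₁(c₃) (`IsHitchinFlow.apply_coordPoint`), its differential
is a shear by κ, and I₊ is the conjugate of J(c₃, s') by that shear
(`IsHitchinFlow.mfderiv_and_component`).

The hard point is the c₃-derivative, obtained without differentiating ℘ in its lattice. The explicit
field `IsVolterra.variation` solves the linearized system, its secular term being the primitive
`levelZeta` of y¹y² - 3c₃; it has the right value at t = 0, and a Gronwall estimate makes it the
derivative (`IsVolterra.hasFDerivAt_family`). Raising the primitive by z adds 3z/(c₃(1 - 27c₃))
times the velocity. Differentiating the periodicity in time 2ω₁ therefore gives ω₁' = -3η̃₁/(c₃(1 -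
27c₃)) (`hasDerivAt_omega1`), which yields κ and, at fixed s, turns the primitive into ς.

Three supporting facts are needed. The rectangular lattice exists because E₆/E₄^{3/2} takes all
values in (-1, 1) on the imaginary axis, and it is unique by an indicial argument for ℘ at 0. The
symmetries of the quadratic system identify ω₁/3 with the first time at which y² = y³, which gives
the shifts by 2πk/3 and the continuity of ω₁. Finally, each orbit fills its level set, which gives
surjectivity of the parametrization. -/

theorem isConnected_compl_lattice : IsConnected (L.lattice : Set ℂ)ᶜ :=
  Set.Countable.isConnected_compl_of_one_lt_rank (by simp)
    (countable_of_Lindelof_of_discrete (X := L.lattice))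

theorem isOpen_compl_lattice : IsOpen (L.lattice : Set ℂ)ᶜ := L.isClosed_lattice.isOpen_compl

theorem hasDerivAt_weierstrassP {z : ℂ} (hz : z ∉ L.lattice) :
    HasDerivAt L.weierstrassP (L.derivWeierstrassP z) z := by
  rw [← L.deriv_weierstrassP]
  exact (L.differentiableOn_weierstrassP.differentiableAt
    (L.isOpen_compl_lattice.mem_nhds hz)).hasDerivAt

/-- The three terms combine to s²/((s - l)l²), so the summand decays like ‖l‖⁻³, which is summable
over a planar lattice. -/
theorem zeta_summand_bound (r : ℝ) (s : ℂ) (hs : ‖s‖ < r) (l : ℂ) (hr : 0 < r)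
    (h : 2 * r ≤ ‖l‖) :
    ‖1 / (s - l) + 1 / l + s / l ^ 2‖ ≤ 2 * r ^ 2 * ‖l‖ ^ (-3 : ℝ) := by
  have h1 : s - l ≠ 0 := by
    intro h; rw [sub_eq_zero] at h; subst h; linarith
  have h2 : 0 < ‖l‖ := by linarith
  have h3 : l ≠ 0 := norm_pos_iff.1 h2
  have e : 1 / (s - l) + 1 / l + s / l ^ 2 = s ^ 2 / ((s - l) * l ^ 2) := by
    field_simp; ring
  have h4 : ‖l‖ / 2 ≤ ‖s - l‖ := by
    rw [norm_sub_rev]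
    exact .trans (by linarith) (norm_sub_norm_le l s)
  rw [e, norm_div, norm_mul, norm_pow, norm_pow]
  calc ‖s‖ ^ 2 / (‖s - l‖ * ‖l‖ ^ 2) ≤ r ^ 2 / (‖l‖ / 2 * ‖l‖ ^ 2) := by gcongr
    _ = 2 * r ^ 2 * (‖l‖ ^ 3)⁻¹ := by field_simp
    _ = _ := by norm_cast

theorem hasSumLocallyUniformly_zeta :
    HasSumLocallyUniformly
      (fun (l : L.lattice) (z : ℂ) ↦
        if l = 0 then 0 else (1 / (z - l) + 1 / l + z / l ^ 2 : ℂ))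
      (fun z ↦ ∑' l : L.lattice, if l = 0 then 0 else (1 / (z - l) + 1 / l + z / l ^ 2 : ℂ)) := by
  refine L.hasSumLocallyUniformly_aux _ (fun r l => 2 * r ^ 2 * ‖l‖ ^ (-3 : ℝ))
    (fun _ _ ↦ (ZLattice.summable_norm_rpow _ _ (by simp; norm_num)).mul_left _) fun r hr ↦
    Filter.eventually_atTop.mpr ⟨2 * r, ?_⟩
  rintro _ h s hs l rfl
  split_ifs
  · simp; positivity
  · exact zeta_summand_bound r s hs l hr h

/-- Locally uniform convergence of functions holomorphic off the lattice allows termwise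
differentiation. The sum over l ≠ 0 gives `-weierstrassPExcept 0`, and the isolated 1/z supplies the
missing double pole. -/
theorem hasDerivAt_weierstrassZeta {z : ℂ} (hz : z ∉ L.lattice) :
    HasDerivAt (weierstrassZeta L) (-L.weierstrassP z) z := by
  have hz0 : z ≠ 0 := by rintro rfl; exact hz (zero_mem _)
  have hd : ∀ l : L.lattice, l ≠ 0 → ∀ w ∈ (L.lattice : Set ℂ)ᶜ,
      HasDerivAt (fun z : ℂ => (1 / (z - l) + 1 / l + z / l ^ 2 : ℂ))
        (-(1 / (w - l) ^ 2 - 1 / l ^ 2)) w := by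
    intro l hl w hw
    have h1 : w - l ≠ 0 := fun h => hw (by rw [sub_eq_zero.1 h]; exact l.2)
    have h2 : (l : ℂ) ≠ 0 := by simpa using hl
    have := ((((hasDerivAt_id w).sub_const (l : ℂ)).inv h1).add_const (1 / (l : ℂ))).add
      ((hasDerivAt_id w).div_const ((l : ℂ) ^ 2))
    convert! this using 1
    · ext z; simp
    · simp; ring
  have hder := (L.hasSumLocallyUniformly_zeta.tendstoLocallyUniformlyOn (s := (L.lattice : Set ℂ)ᶜ)).deriv
    (.of_forall fun s ↦ .fun_sum fun l hl w hw ↦ by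
      by_cases h0 : l = 0
      · simpa [h0] using differentiableWithinAt_const _
      · simpa only [h0, if_false] using (hd l h0 w hw).differentiableAt.differentiableWithinAt)
    L.isOpen_compl_lattice
  have hdiff := (L.hasSumLocallyUniformly_zeta.tendstoLocallyUniformlyOn
    (s := (L.lattice : Set ℂ)ᶜ)).differentiableOn
    (.of_forall fun s ↦ .fun_sum fun l hl w hw ↦ by
      by_cases h0 : l = 0
      · simpa [h0] using differentiableWithinAt_const _
      · simpa only [h0, if_false] using (hd l h0 w hw).differentiableAt.differentiableWithinAt)
    L.isOpen_compl_lattice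
  have key : deriv (fun z ↦ ∑' l : L.lattice,
      if l = 0 then 0 else (1 / (z - l) + 1 / l + z / l ^ 2 : ℂ)) z =
      -L.weierstrassPExcept 0 z := by
    refine tendsto_nhds_unique (hder.tendsto_at hz) ?_
    have := (L.hasSum_weierstrassPExcept 0 z).neg
    refine this.congr fun s => ?_
    simp only [Function.comp_apply]
    rw [deriv_fun_sum]
    · refine Finset.sum_congr rfl fun l _ => ?_
      by_cases h0 : l = 0
      · simp [h0]
      · have h2 : (l : ℂ) ≠ 0 := by simpa using h0
        simp only [h0, h2, if_false]
        exact (hd l h0 z hz).deriv.symm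
    · intro l _
      by_cases h0 : l = 0
      · simp [h0]
      · simpa only [h0, if_false] using (hd l h0 z hz).differentiableAt
  have h1 := (hdiff.differentiableAt (L.isOpen_compl_lattice.mem_nhds hz)).hasDerivAt
  rw [key] at h1
  have h2 := (hasDerivAt_inv hz0).add h1
  have h3 := L.weierstrassPExcept_add 0 z
  convert! h2 using 1
  · ext w; simp [weierstrassZeta]
  · rw [← h3]; simp

theorem weierstrassZeta_neg (z : ℂ) : weierstrassZeta L (-z) = -weierstrassZeta L z := by
  simp only [weierstrassZeta]
  rw [← (Equiv.neg L.lattice).tsum_eq, neg_add, ← tsum_neg]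
  congr 1
  · simp [div_neg]
  · congr with l
    by_cases h : l = 0
    · simp [h]
    · have h2 : (l : ℂ) ≠ 0 := by simpa using h
      by_cases h1 : z - l = 0
      · have h1' : (-z + l : ℂ) = 0 := by linear_combination -h1
        simp [h, h1, h1']; ring
      · have h1' : (-z + l : ℂ) ≠ 0 := fun h => h1 (by linear_combination -h)
        simp [h]
        field_simp; ring

/-- Quasi-periodicity of the zeta function; the quasi-period is found at `-l / 2`. -/
theorem weierstrassZeta_add (l : L.lattice) (hl : (l : ℂ) / 2 ∉ L.lattice) {z : ℂ}
    (hz : z ∉ L.lattice) :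
    weierstrassZeta L (z + l) = weierstrassZeta L z + 2 * weierstrassZeta L (l / 2) := by
  have hadd : ∀ w ∈ (L.lattice : Set ℂ)ᶜ, w + l ∉ L.lattice := fun w hw h =>
    hw (by simpa using sub_mem h l.2)
  have h1 : ∀ w ∈ (L.lattice : Set ℂ)ᶜ, HasDerivAt (fun w => weierstrassZeta L (w + l))
      (-L.weierstrassP w) w := by
    intro w hw
    have := (L.hasDerivAt_weierstrassZeta (hadd w hw)).comp_add_const w (l : ℂ)
    simpa using this
  have h2 : Set.EqOn (fun w => weierstrassZeta L (w + l))
      (fun w => weierstrassZeta L w + 2 * weierstrassZeta L (l / 2)) (L.lattice : Set ℂ)ᶜ := by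
    apply IsOpen.eqOn_of_deriv_eq (𝕜 := ℂ) L.isOpen_compl_lattice
      L.isConnected_compl_lattice.isPreconnected (x := -(l / 2 : ℂ))
    · exact fun w hw => (h1 w hw).differentiableAt.differentiableWithinAt
    · exact fun w hw => ((L.hasDerivAt_weierstrassZeta hw).add_const
        _).differentiableAt.differentiableWithinAt
    · intro w hw
      exact (h1 w hw).deriv.trans ((L.hasDerivAt_weierstrassZeta hw).add_const _).deriv.symm
    · simpa using hl
    · simp only [weierstrassZeta_neg]
      rw [show (-(l / 2 : ℂ) + l) = l / 2 by ring]; ring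
  exact h2 hz

theorem tendsto_sq_mul_weierstrassP :
    Tendsto (fun z => z ^ 2 * L.weierstrassP z) (𝓝[≠] 0) (𝓝 1) := by
  have h : ContinuousAt (fun z => z ^ 2 * L.weierstrassPExcept 0 z + 1) 0 := by
    have := (L.analyticAt_weierstrassPExcept 0).continuousAt
    fun_prop
  have h2 := h.tendsto.mono_left (nhdsWithin_le_nhds (s := {0}ᶜ))
  simp only [ne_eq, OfNat.ofNat_ne_zero, not_false_eq_true, zero_pow, zero_mul, zero_add] at h2
  refine h2.congr' ?_
  filter_upwards [self_mem_nhdsWithin] with z hz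
  have hz' : z ≠ 0 := hz
  rw [← L.weierstrassPExcept_add 0 z]
  simp; field_simp

theorem tendsto_norm_weierstrassP {l : ℂ} (hl : l ∈ L.lattice) :
    Tendsto (fun z => ‖L.weierstrassP z‖) (𝓝[≠] l) atTop := by
  have h0 : Tendsto (fun z => ‖L.weierstrassP z‖) (𝓝[≠] 0) atTop := by
    have h1 : Tendsto (fun z : ℂ => ‖z ^ 2‖⁻¹) (𝓝[≠] 0) atTop := by
      have : Tendsto (fun z : ℂ => ‖z ^ 2‖) (𝓝[≠] 0) (𝓝[>] 0) := by
        refine tendsto_nhdsWithin_iff.2 ⟨?_, ?_⟩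
        · have : Continuous fun z : ℂ => ‖z ^ 2‖ := by fun_prop
          simpa using (this.tendsto 0).mono_left (nhdsWithin_le_nhds (s := {0}ᶜ))
        · filter_upwards [self_mem_nhdsWithin] with z hz
          have hz' : z ≠ 0 := hz
          simp [hz']
      exact this.inv_tendsto_nhdsGT_zero
    have h2 := h1.atTop_mul_pos one_pos (by simpa using L.tendsto_sq_mul_weierstrassP.norm)
    refine h2.congr' ?_
    filter_upwards [self_mem_nhdsWithin] with z hz
    have hz' : z ≠ 0 := hz
    rw [norm_pow, inv_mul_cancel_left₀ (by simpa using hz')]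
  have h3 : Tendsto (fun z : ℂ => z - l) (𝓝[≠] l) (𝓝[≠] 0) := by
    refine tendsto_nhdsWithin_iff.2 ⟨?_, ?_⟩
    · have : Continuous fun z : ℂ => z - l := by fun_prop
      simpa using (this.tendsto l).mono_left (nhdsWithin_le_nhds (s := {l}ᶜ))
    · filter_upwards [self_mem_nhdsWithin] with z hz
      simpa [sub_eq_zero] using hz
  refine (h0.comp h3).congr fun z => ?_
  simp only [Function.comp_apply]
  rw [L.weierstrassP_sub_coe z ⟨l, hl⟩]

/-- Differentiating ℘'² = 4℘³ - g₂℘ - g₃ gives ℘'·(℘'' - 6℘² + g₂/2) = 0. On the connected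
complement of the lattice one factor vanishes identically, and it is not ℘', since a constant ℘
would have no pole at 0. -/
theorem hasDerivAt_derivWeierstrassP {z : ℂ} (hz : z ∉ L.lattice) :
    HasDerivAt L.derivWeierstrassP (6 * L.weierstrassP z ^ 2 - L.g₂ / 2) z := by
  have hU := L.isOpen_compl_lattice
  have hd : ∀ w ∈ (L.lattice : Set ℂ)ᶜ,
      HasDerivAt L.derivWeierstrassP (deriv L.derivWeierstrassP w) w := fun w hw =>
    (L.differentiableOn_derivWeierstrassP.differentiableAt (hU.mem_nhds hw)).hasDerivAt
  have hA := L.analyticOnNhd_derivWeierstrassP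
  have hB : AnalyticOnNhd ℂ
      (fun w => deriv L.derivWeierstrassP w - (6 * L.weierstrassP w ^ 2 - L.g₂ / 2))
      (L.lattice : Set ℂ)ᶜ := by
    intro w hw
    have h1 := hA.deriv w hw
    have h2 := L.analyticOnNhd_weierstrassP w hw
    fun_prop
  have hprod : ∀ w ∈ (L.lattice : Set ℂ)ᶜ, L.derivWeierstrassP w *
      (deriv L.derivWeierstrassP w - (6 * L.weierstrassP w ^ 2 - L.g₂ / 2)) = 0 := by
    intro w hw
    have e1 := (hd w hw).pow 2
    have e2 := ((((L.hasDerivAt_weierstrassP hw).pow 3).const_mul 4).sub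
      ((L.hasDerivAt_weierstrassP hw).const_mul L.g₂)).sub_const L.g₃
    have e3 := e1.unique (e2.congr_of_eventuallyEq (by
      filter_upwards [hU.mem_nhds hw] with x hx
      simpa using L.derivWeierstrassP_sq x hx))
    simp at e3
    linear_combination e3 / 2
  rcases AnalyticOnNhd.eq_zero_or_eq_zero_of_mul_eq_zero hA hB hprod
    L.isConnected_compl_lattice.isPreconnected with h | h
  · exfalso
    have hconst : Set.EqOn L.weierstrassP (fun _ => L.weierstrassP z) (L.lattice : Set ℂ)ᶜ := by
      apply IsOpen.eqOn_of_deriv_eq (𝕜 := ℂ) hU L.isConnected_compl_lattice.isPreconnected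
        (x := z) L.differentiableOn_weierstrassP (differentiableOn_const _) _ hz rfl
      intro w hw
      simpa using h w hw
    have h1 := L.tendsto_norm_weierstrassP (zero_mem _)
    have h2 := (h1.eventually_gt_atTop ‖L.weierstrassP z‖).and
      (mem_nhdsWithin_of_mem_nhds (L.compl_lattice_sdiff_singleton_mem_nhds 0))
    obtain ⟨w, ⟨hw, hw'⟩, hw0⟩ := (h2.and self_mem_nhdsWithin).exists
    have hw0' : w ≠ 0 := hw0
    have : w ∈ (L.lattice : Set ℂ)ᶜ := fun hm => hw' ⟨hm, hw0'⟩
    rw [hconst this] at hw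
    exact lt_irrefl _ hw
  · have := h z hz
    rw [sub_eq_zero] at this
    rw [← this]
    exact hd z hz

end PeriodPair

/-! ### The lattice is determined by its invariants -/

open Filter Topology in
-- The Euler operator z·d/dz preserves the form zⁿ·(analytic), so it can be iterated to reach z²d''.
theorem eventually_mul_deriv_pow_mul {d h : ℂ → ℂ} {n : ℕ} (hh : AnalyticAt ℂ h 0)
    (hd : ∀ᶠ z in 𝓝 0, d z = z ^ n * h z) :
    ∀ᶠ z in 𝓝 0, z * deriv d z = z ^ n * (n * h z + z * deriv h z) := by
  filter_upwards [hd.eventually_nhds, hh.eventually_analyticAt] with z hz hhz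
  have h1 := ((hasDerivAt_pow n z).mul hhz.differentiableAt.hasDerivAt)
  have h2 := h1.congr_of_eventuallyEq (f₁ := d) (by filter_upwards [hz] with w hw; simpa using hw)
  rw [h2.deriv]
  rcases n with _ | n
  · simp
  · simp; ring

open Filter Topology in
/-- The indicial exponents of `z² d'' = (12 + o(1)) d` are `4` and `-3`. -/
theorem eventually_eq_zero_of_indicial {d k : ℂ → ℂ} (hd : AnalyticAt ℂ d 0)
    (hk : ContinuousAt k 0) (hk0 : k 0 = 12)
    (hode : ∀ᶠ z in 𝓝[≠] 0, z ^ 2 * deriv (deriv d) z = k z * d z)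
    (h4 : iteratedDeriv 4 d 0 = 0) : ∀ᶠ z in 𝓝 0, d z = 0 := by
  by_contra hne
  obtain ⟨n, h, hh, hh0, hdh⟩ := hd.exists_eventuallyEq_pow_smul_nonzero_iff.2 hne
  simp only [sub_zero, smul_eq_mul] at hdh
  have e1 := eventually_mul_deriv_pow_mul hh hdh
  have hg : AnalyticAt ℂ (fun z => n * h z + z * deriv h z) 0 := by
    have := hh.deriv
    fun_prop
  have e2 := eventually_mul_deriv_pow_mul hg e1
  -- With θ = z·d/dz one has z²d'' = θ²d - θd. After cancelling zⁿ, the limit at 0 is n² - n = 12.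
  have e3 : ∀ᶠ z in 𝓝[≠] (0 : ℂ), n * (n * h z + z * deriv h z) +
      z * deriv (fun z => n * h z + z * deriv h z) z - (n * h z + z * deriv h z) = k z * h z := by
    filter_upwards [hode, mem_nhdsWithin_of_mem_nhds e1, mem_nhdsWithin_of_mem_nhds e2,
      mem_nhdsWithin_of_mem_nhds hdh, mem_nhdsWithin_of_mem_nhds hd.deriv.eventually_analyticAt,
      self_mem_nhdsWithin] with z hz h1 h2 h3 h5 h6
    have h6' : z ≠ 0 := h6
    have : deriv (fun z => z * deriv d z) z = deriv d z + z * deriv (deriv d) z := by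
      have := ((hasDerivAt_id z).mul h5.differentiableAt.hasDerivAt).deriv
      simpa using! this
    rw [this] at h2
    apply mul_left_cancel₀ (pow_ne_zero n h6')
    rw [h3] at hz
    linear_combination hz - h2 + h1
  have hl : Tendsto (fun z => n * (n * h z + z * deriv h z) +
      z * deriv (fun z => n * h z + z * deriv h z) z - (n * h z + z * deriv h z)) (𝓝[≠] 0)
      (𝓝 (n * (n * h 0) - n * h 0)) := by
    have c1 := hh.continuousAt
    have c2 := hh.deriv.continuousAt
    have c3 := hg.deriv.continuousAt
    have : ContinuousAt (fun z => n * (n * h z + z * deriv h z) +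
      z * deriv (fun z => n * h z + z * deriv h z) z - (n * h z + z * deriv h z)) 0 := by
      fun_prop
    simpa using this.tendsto.mono_left (nhdsWithin_le_nhds (s := {0}ᶜ))
  have hr : Tendsto (fun z => k z * h z) (𝓝[≠] 0) (𝓝 (12 * h 0)) := by
    have := (hk.mul hh.continuousAt).tendsto.mono_left (nhdsWithin_le_nhds (s := {0}ᶜ))
    rw [Pi.mul_apply, hk0] at this
    exact this
  have e4 := tendsto_nhds_unique (hl.congr' e3) hr
  have e5 : (n : ℂ) * n - n = 12 := mul_right_cancel₀ hh0 (by linear_combination e4)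
  have e6 : (n : ℤ) * n - n = 12 := by exact_mod_cast e5
  have e7 : n = 4 := by
    have : (n : ℤ) ≤ 4 := by nlinarith
    have : n ≤ 4 := by exact_mod_cast this
    interval_cases n <;> simp_all
  subst e7
  have h8 : analyticOrderAt d 0 = (4 : ℕ) :=
    hd.analyticOrderAt_eq_natCast.2 ⟨h, hh, hh0, by simpa using hdh⟩
  exact (((analyticOrderAt_eq_nat_iff_iteratedDeriv_eq_zero hd).1 h8).2) h4

namespace PeriodPair
open Filter Topology ComplexConjugate

theorem eventually_notMem_lattice (L : PeriodPair) (x : ℂ) : ∀ᶠ z in 𝓝[≠] x, z ∉ L.lattice := by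
  filter_upwards [self_mem_nhdsWithin,
    mem_nhdsWithin_of_mem_nhds (L.compl_lattice_sdiff_singleton_mem_nhds x)] with z h1 h2 h3
  exact h2 ⟨h3, h1⟩

/-- The double poles cancel, so the difference d is analytic at 0. Equality of g₂ gives z²d'' =
6z²(℘ + ℘̃)d with coefficient tending to 12, so a nonzero d would vanish to order exactly 4; but its
fourth derivative is governed by G₆, that is, by g₃. -/
theorem eventually_weierstrassP_eq {L L' : PeriodPair} (h2 : L.g₂ = L'.g₂) (h3 : L.g₃ = L'.g₃) :
    ∀ᶠ z in 𝓝[≠] (0 : ℂ), L.weierstrassP z = L'.weierstrassP z := by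
  set d : ℂ → ℂ := fun z => L.weierstrassPExcept 0 z - L'.weierstrassPExcept 0 z with hd
  have hL := L.analyticAt_weierstrassPExcept 0
  have hL' := L'.analyticAt_weierstrassPExcept 0
  have hda : AnalyticAt ℂ d 0 := hL.sub hL'
  have hev : ∀ z, d z = L.weierstrassP z - L'.weierstrassP z := by
    intro z
    rw [← L.weierstrassPExcept_add 0 z, ← L'.weierstrassPExcept_add 0 z]
    simp [d]
  have hfun : d = fun z => L.weierstrassP z - L'.weierstrassP z := funext hev
  have h4 : iteratedDeriv 4 d 0 = 0 := by
    have := iteratedDeriv_fun_sub (n := 4) (hL.contDiffAt (n := 4)) (hL'.contDiffAt (n := 4))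
    rw [hd, this, L.iteratedDeriv_weierstrassPExcept_self, L'.iteratedDeriv_weierstrassPExcept_self]
    have : L.G 6 = L'.G 6 := by simpa [g₃] using h3
    simp [this]
  have key := eventually_eq_zero_of_indicial (d := d) hda
    (k := fun z => 12 + 6 * z ^ 2 * (L.weierstrassPExcept 0 z + L'.weierstrassPExcept 0 z))
    (by have := hL.continuousAt; have := hL'.continuousAt; fun_prop) (by simp) ?_ h4
  · filter_upwards [mem_nhdsWithin_of_mem_nhds key] with z hz
    rw [hev, sub_eq_zero] at hz
    exact hz
  · filter_upwards [(L.eventually_notMem_lattice 0), (L'.eventually_notMem_lattice 0),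
      self_mem_nhdsWithin] with z hz hz' h0
    have h0 : z ≠ 0 := h0
    have e1 : deriv d =ᶠ[𝓝 z] fun z => L.derivWeierstrassP z - L'.derivWeierstrassP z := by
      filter_upwards [L.isOpen_compl_lattice.mem_nhds hz, L'.isOpen_compl_lattice.mem_nhds hz']
        with w hw hw'
      rw [hfun]
      exact ((L.hasDerivAt_weierstrassP hw).sub (L'.hasDerivAt_weierstrassP hw')).deriv
    have e2 := ((L.hasDerivAt_derivWeierstrassP hz).sub (L'.hasDerivAt_derivWeierstrassP hz')).deriv
    rw [e1.deriv_eq]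
    erw [e2]
    rw [hev, h2]
    have p1 := L.weierstrassPExcept_add 0 z
    have p2 := L'.weierstrassPExcept_add 0 z
    simp only [ZeroMemClass.coe_zero, sub_zero, ne_eq, OfNat.ofNat_ne_zero, not_false_eq_true,
      zero_pow, div_zero] at p1 p2
    rw [← p1, ← p2]
    field_simp
    ring

/-- The identity theorem spreads the equality over the complement of both lattices. A point of the
first lattice outside the second would be a pole of one function and a point of continuity of the
other. -/
theorem lattice_le_of_eventuallyEq {L L' : PeriodPair}
    (h : ∀ᶠ z in 𝓝[≠] (0 : ℂ), L.weierstrassP z = L'.weierstrassP z) :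
    L.lattice ≤ L'.lattice := by
  have c1 : Countable L.lattice := countable_of_Lindelof_of_discrete
  have c2 : Countable L'.lattice := countable_of_Lindelof_of_discrete
  have hconn : IsPreconnected ((L.lattice : Set ℂ) ∪ L'.lattice)ᶜ :=
    (Set.Countable.isConnected_compl_of_one_lt_rank (by simp)
      (c1.to_set.union c2.to_set)).isPreconnected
  have hA : AnalyticOnNhd ℂ L.weierstrassP ((L.lattice : Set ℂ) ∪ L'.lattice)ᶜ :=
    L.analyticOnNhd_weierstrassP.mono (by simp)
  have hA' : AnalyticOnNhd ℂ L'.weierstrassP ((L.lattice : Set ℂ) ∪ L'.lattice)ᶜ :=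
    L'.analyticOnNhd_weierstrassP.mono (by simp)
  have h1 := ((L.eventually_notMem_lattice 0).and (L'.eventually_notMem_lattice 0))
  obtain ⟨w, ⟨hw, hw'⟩, hev⟩ :=
    (h1.and (eventually_eventually_nhdsWithin.2 h)).exists
  have hw0 : w ≠ 0 := by rintro rfl; exact hw (zero_mem _)
  have hev' : L.weierstrassP =ᶠ[𝓝 w] L'.weierstrassP := by
    rw [nhdsWithin_eq_nhds.2 (isOpen_compl_singleton.mem_nhds hw0)] at hev
    exact hev
  have heq := hA.eqOn_of_preconnected_of_eventuallyEq hA' hconn (z₀ := w) (by simp [hw, hw']) hev'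
  intro l hl
  by_contra hl'
  have hc : ContinuousAt L'.weierstrassP l := (L'.analyticOnNhd_weierstrassP l hl').continuousAt
  have t1 : Tendsto (fun z => ‖L'.weierstrassP z‖) (𝓝[≠] l) (𝓝 ‖L'.weierstrassP l‖) :=
    hc.norm.tendsto.mono_left nhdsWithin_le_nhds
  refine not_tendsto_nhds_of_tendsto_atTop ((L.tendsto_norm_weierstrassP hl).congr' ?_) _ t1
  filter_upwards [L.eventually_notMem_lattice l, L'.eventually_notMem_lattice l] with z h1 h2
  rw [heq (by simp [h1, h2])]

theorem lattice_eq_of_invariants_eq {L L' : PeriodPair} (h2 : L.g₂ = L'.g₂) (h3 : L.g₃ = L'.g₃) :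
    L.lattice = L'.lattice :=
  le_antisymm (lattice_le_of_eventuallyEq (eventually_weierstrassP_eq h2 h3))
    (lattice_le_of_eventuallyEq (eventually_weierstrassP_eq h2.symm h3.symm))

/-- A rectangular pair of periods: `ω₁ > 0` and `ω₂ ∈ i ℝ_{>0}`. -/
structure IsRectangular (L : PeriodPair) : Prop where
  im_one : L.ω₁.im = 0
  re_one : 0 < L.ω₁.re
  re_two : L.ω₂.re = 0
  im_two : 0 < L.ω₂.im

theorem IsRectangular.mem_iff {L : PeriodPair} (h : L.IsRectangular) (z : ℂ) :
    z ∈ L.lattice ↔ ∃ m n : ℤ, z.re = m * L.ω₁.re ∧ z.im = n * L.ω₂.im := by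
  rw [mem_lattice]
  refine exists_congr fun m => exists_congr fun n => ?_
  rw [Complex.ext_iff]
  simp [h.im_one, h.re_two, eq_comm]

theorem IsRectangular.conj_mem {L : PeriodPair} (h : L.IsRectangular) {z : ℂ}
    (hz : z ∈ L.lattice) : conj z ∈ L.lattice := by
  rw [h.mem_iff] at hz ⊢
  obtain ⟨m, n, h1, h2⟩ := hz
  exact ⟨m, -n, by simpa using h1, by simp [h2]⟩

theorem exists_nat_mul_of_int_mul {a b : ℝ} (ha : 0 < a) (hb : 0 < b) {m : ℤ} (h : a = m * b) :
    b ≤ a := by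
  have : (0 : ℝ) < m := by
    by_contra hm
    push Not at hm
    nlinarith
  have : (1 : ℝ) ≤ m := by exact_mod_cast this
  nlinarith

/-- The lattice is a product grid, so ω₁ and ω₂ are recovered as its smallest positive real and
imaginary steps. -/
theorem IsRectangular.eq_of_lattice_eq {L L' : PeriodPair} (h : L.IsRectangular)
    (h' : L'.IsRectangular) (he : L.lattice = L'.lattice) : L = L' := by
  have aux : ∀ {M N : PeriodPair}, M.IsRectangular → N.IsRectangular → M.lattice = N.lattice →
      N.ω₁.re ≤ M.ω₁.re ∧ N.ω₂.im ≤ M.ω₂.im := by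
    intro M N hM hN he
    obtain ⟨m, n, h1, -⟩ := (hN.mem_iff _).1 (he ▸ M.ω₁_mem_lattice)
    obtain ⟨m', n', -, h2⟩ := (hN.mem_iff _).1 (he ▸ M.ω₂_mem_lattice)
    exact ⟨exists_nat_mul_of_int_mul hM.re_one hN.re_one h1,
      exists_nat_mul_of_int_mul hM.im_two hN.im_two h2⟩
  obtain ⟨a, b⟩ := aux h h' he
  obtain ⟨a', b'⟩ := aux h' h he.symm
  have e1 : L.ω₁ = L'.ω₁ := Complex.ext (le_antisymm a' a) (by rw [h.im_one, h'.im_one])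
  have e2 : L.ω₂ = L'.ω₂ := Complex.ext (by rw [h.re_two, h'.re_two]) (le_antisymm b' b)
  cases L; cases L'; simp_all

/-- Complex conjugation on a rectangular lattice. -/
def IsRectangular.conjEquiv {L : PeriodPair} (h : L.IsRectangular) : L.lattice ≃ L.lattice where
  toFun l := ⟨conj (l : ℂ), h.conj_mem l.2⟩
  invFun l := ⟨conj (l : ℂ), h.conj_mem l.2⟩
  left_inv l := by ext; simp
  right_inv l := by ext; simp

theorem IsRectangular.weierstrassP_conj {L : PeriodPair} (h : L.IsRectangular) (z : ℂ) :
    L.weierstrassP (conj z) = conj (L.weierstrassP z) := by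
  rw [weierstrassP, weierstrassP, Complex.conj_tsum, ← h.conjEquiv.tsum_eq]
  simp [conjEquiv]

theorem IsRectangular.weierstrassZeta_conj {L : PeriodPair} (h : L.IsRectangular) (z : ℂ) :
    weierstrassZeta L (conj z) = conj (weierstrassZeta L z) := by
  rw [weierstrassZeta, weierstrassZeta, map_add, Complex.conj_tsum, ← h.conjEquiv.tsum_eq]
  congr 1
  · simp
  · congr with l
    by_cases h0 : l = 0
    · simp [h0, conjEquiv]
    · have : h.conjEquiv l ≠ 0 := fun h1 => h0 (h.conjEquiv.injective (by
        rw [h1]; ext; simp [conjEquiv]))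
      simp only [h0, this, if_false]
      simp [conjEquiv]

end PeriodPair

/-! ### Eisenstein series on the imaginary axis and existence of the rectangular lattice -/

open Filter Topology in
/-- The power series `∑ σ_k(n) qⁿ`. -/
noncomputable def sigmaSeries (k : ℕ) (q : ℝ) : ℝ := ∑' n : ℕ, (ArithmeticFunction.sigma k n : ℝ) * q ^ n

section SigmaSeries
open Filter Topology

theorem summable_sigmaSeries (k : ℕ) {q : ℝ} (h0 : 0 ≤ q) (h1 : q < 1) :
    Summable fun n : ℕ => (ArithmeticFunction.sigma k n : ℝ) * q ^ n := by
  refine Summable.of_nonneg_of_le (fun n => by positivity) (fun n => ?_)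
    (summable_pow_mul_geometric_of_norm_lt_one (k + 1) (r := q) (by rwa [Real.norm_of_nonneg h0]))
  gcongr
  exact_mod_cast ArithmeticFunction.sigma_le_pow_succ k n

theorem sigmaSeries_nonneg (k : ℕ) {q : ℝ} (h0 : 0 ≤ q) : 0 ≤ sigmaSeries k q :=
  tsum_nonneg fun n => by positivity

theorem sigmaSeries_zero (k : ℕ) : sigmaSeries k 0 = 0 := by
  rw [sigmaSeries]
  convert tsum_zero with n
  rcases n with _ | n <;> simp

/-- The endpoint q = 0 is included because it is the limit t → ∞ of q = e^{-2πt}. -/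
theorem continuousOn_sigmaSeries (k : ℕ) : ContinuousOn (sigmaSeries k) (Set.Ico 0 1) := by
  intro q hq
  obtain ⟨r, hr, hr1⟩ := exists_between hq.2
  have h : ContinuousOn (sigmaSeries k) (Set.Icc 0 r) := by
    refine continuousOn_tsum (fun n => by fun_prop)
      (summable_sigmaSeries k (hq.1.trans hr.le) hr1) fun n x hx => ?_
    rw [Real.norm_of_nonneg (mul_nonneg (by positivity) (pow_nonneg hx.1 _))]
    gcongr
    exacts [hx.1, hx.2]
  refine (h q ⟨hq.1, hr.le⟩).mono_of_mem_nhdsWithin ?_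
  filter_upwards [self_mem_nhdsWithin, mem_nhdsWithin_of_mem_nhds (Iio_mem_nhds hr)] with x hx hx'
  exact ⟨hx.1, le_of_lt hx'⟩

theorem tendsto_exp_neg_two_pi : Tendsto (fun t : ℝ => Real.exp (-(2 * Real.pi * t))) atTop (𝓝 0) :=
  Real.tendsto_exp_neg_atTop_nhds_zero.comp
    (tendsto_id.const_mul_atTop (by positivity : 0 < 2 * Real.pi))

theorem exp_neg_two_pi_mem {t : ℝ} (ht : 0 < t) :
    Real.exp (-(2 * Real.pi * t)) ∈ Set.Ico (0 : ℝ) 1 :=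
  ⟨(Real.exp_pos _).le, by rw [Real.exp_lt_one_iff, neg_lt_zero]; positivity⟩

theorem continuousOn_sigmaSeries_exp (k : ℕ) :
    ContinuousOn (fun t : ℝ => sigmaSeries k (Real.exp (-(2 * Real.pi * t)))) (Set.Ioi 0) :=
  (continuousOn_sigmaSeries k).comp (by fun_prop) fun _ ht => exp_neg_two_pi_mem ht

theorem tendsto_sigmaSeries_exp (k : ℕ) :
    Tendsto (fun t : ℝ => sigmaSeries k (Real.exp (-(2 * Real.pi * t)))) atTop (𝓝 0) := by
  have h1 := (continuousOn_sigmaSeries k 0 (by simp)).tendsto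
  rw [sigmaSeries_zero] at h1
  refine h1.comp (tendsto_nhdsWithin_iff.2 ⟨tendsto_exp_neg_two_pi, ?_⟩)
  filter_upwards [eventually_gt_atTop 0] with t ht using exp_neg_two_pi_mem ht

end SigmaSeries

namespace PeriodPair
open Filter Topology

theorem linearIndependent_of_rect {a b : ℝ} (ha : 0 < a) (hb : 0 < b) :
    LinearIndependent ℝ ![(a : ℂ), (b : ℂ) * Complex.I] := by
  rw [LinearIndependent.pair_iff]
  intro s t h
  have h1 := congrArg Complex.re h
  have h2 := congrArg Complex.im h
  simp at h1 h2
  exact ⟨h1.resolve_right ha.ne', h2.resolve_right hb.ne'⟩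

/-- The rectangular pair of periods `(a, i b)`. -/
noncomputable def rect {a b : ℝ} (ha : 0 < a) (hb : 0 < b) : PeriodPair :=
  ⟨a, b * Complex.I, linearIndependent_of_rect ha hb⟩

theorem isRectangular_rect {a b : ℝ} (ha : 0 < a) (hb : 0 < b) : (rect ha hb).IsRectangular := by
  constructor <;> simp [rect, ha, hb]

theorem G_eq_of_mul {L L' : PeriodPair} {a : ℂ} (ha : a ≠ 0)
    (h : ∀ z, z ∈ L.lattice ↔ a * z ∈ L'.lattice) (k : ℕ) : L'.G k = (a ^ k)⁻¹ * L.G k := by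
  let e : L.lattice ≃ L'.lattice :=
    { toFun := fun z => ⟨a * z, (h z).1 z.2⟩
      invFun := fun w => ⟨a⁻¹ * w, (h _).2 (by rw [mul_inv_cancel_left₀ ha]; exact w.2)⟩
      left_inv := fun z => by ext; simp [ha]
      right_inv := fun z => by ext; simp [ha] }
  rw [G, G, ← e.tsum_eq, ← tsum_mul_left]
  congr with z
  simp [e, mul_pow, mul_comm]

theorem G_rect_scale {t : ℝ} (ht : 0 < t) {a : ℝ} (ha : 0 < a) (k : ℕ) :
    (rect ha (mul_pos ha ht)).G k = ((a : ℂ) ^ k)⁻¹ * (rect one_pos ht).G k := by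
  refine G_eq_of_mul (by exact_mod_cast ha.ne') (fun z => ?_) k
  rw [mem_lattice, mem_lattice]
  refine exists_congr fun m => exists_congr fun n => ?_
  have : (a : ℂ) ≠ 0 := by exact_mod_cast ha.ne'
  rw [← mul_right_inj' this]
  simp only [rect]
  push_cast
  rw [show (a : ℂ) * (m * 1 + n * (t * Complex.I)) = m * a + n * (a * t * Complex.I) by ring]

/-- Multiplication by i/t carries ℤ + itℤ onto ℤ + it⁻¹ℤ; this is the modular inversion on the
imaginary axis. -/
theorem G_rect_inv {t : ℝ} (ht : 0 < t) (k : ℕ) :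
    (rect one_pos (inv_pos.2 ht)).G k = ((Complex.I / t) ^ k)⁻¹ * (rect one_pos ht).G k := by
  have ht' : (t : ℂ) ≠ 0 := by exact_mod_cast ht.ne'
  refine G_eq_of_mul (div_ne_zero Complex.I_ne_zero ht') (fun z => ?_) k
  rw [mem_lattice, mem_lattice]
  have key : ∀ m n : ℤ, (m * (rect one_pos ht).ω₁ + n * (rect one_pos ht).ω₂ = z ↔
      ((-n : ℤ) : ℂ) * (rect one_pos (inv_pos.2 ht)).ω₁ + m * (rect one_pos (inv_pos.2 ht)).ω₂ =
        Complex.I / t * z) := by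
    intro m n
    rw [← mul_right_inj' (div_ne_zero Complex.I_ne_zero ht')]
    simp only [rect]
    have : Complex.I / t * (m * ((1 : ℝ) : ℂ) + n * (t * Complex.I)) =
      ((-n : ℤ) : ℂ) * ((1 : ℝ) : ℂ) + m * ((t⁻¹ : ℝ) * Complex.I) := by
      push_cast
      field_simp
      linear_combination (n * t : ℂ) * Complex.I_sq
    rw [this]
  constructor
  · rintro ⟨m, n, h⟩
    exact ⟨-n, m, (key m n).1 h⟩
  · rintro ⟨m, n, h⟩
    exact ⟨n, -m, (key n (-m)).2 (by simpa using h)⟩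

theorem G_rect {t : ℝ} (ht : 0 < t) {k : ℕ} (hk : 3 ≤ k) (hk2 : Even k) :
    (rect one_pos ht).G k = 2 * riemannZeta k +
      2 * ((-2 * Real.pi * Complex.I) ^ k / (k - 1).factorial) *
        (sigmaSeries (k - 1) (Real.exp (-(2 * Real.pi * t))) : ℝ) := by
  have h := tsum_eisSummand_eq_tsum_sigma_mul_cexp_pow hk hk2
    ⟨t * Complex.I, by simpa using ht⟩
  have e1 : (rect one_pos ht).G k = ∑' v, EisensteinSeries.eisSummand k v
      ⟨t * Complex.I, by simpa using ht⟩ := by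
    have he : ∀ x : ℤ × ℤ, (((rect one_pos ht).latticeEquivProd.symm.toEquiv x :
        (rect one_pos ht).lattice) : ℂ) = x.1 * ((1 : ℝ) : ℂ) + x.2 * (t * Complex.I) :=
      (rect one_pos ht).latticeEquiv_symm_apply
    -- The swap is needed because `eisSummand` puts the coefficient of τ first, while the lattice
    -- puts it second.
    rw [← (finTwoArrowEquiv ℤ).symm.tsum_eq, G,
      ← (rect one_pos ht).latticeEquivProd.symm.toEquiv.tsum_eq,
      ← (Equiv.prodComm ℤ ℤ).tsum_eq]
    congr with v
    rw [he]
    simp [finTwoArrowEquiv, EisensteinSeries.eisSummand, add_comm]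
  rw [e1, h]
  congr 2
  rw [sigmaSeries, Complex.ofReal_tsum, ← tsum_zero_pnat_eq_tsum_nat]
  · simp only [ArithmeticFunction.map_zero, Nat.cast_zero, zero_mul, Complex.ofReal_zero, zero_add]
    congr with n
    push_cast
    congr 2
    congr 1
    linear_combination (2 * Real.pi * t : ℂ) * Complex.I_sq
  · exact_mod_cast (Complex.hasSum_ofReal.2 (summable_sigmaSeries (k - 1)
      (exp_neg_two_pi_mem ht).1 (exp_neg_two_pi_mem ht).2).hasSum).summable

end PeriodPair

theorem riemannZeta_six : riemannZeta 6 = (Real.pi : ℂ) ^ 6 / 945 := by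
  have h := riemannZeta_two_mul_nat (k := 3) (by norm_num)
  have hb : bernoulli 6 = 1 / 42 := by
    have h5 : bernoulli' 5 = 0 := by
      rw [bernoulli'_def]
      norm_num [Finset.sum_range_succ, Finset.sum_range_succ, Nat.choose]
    rw [bernoulli_eq_bernoulli'_of_ne_one (by norm_num), bernoulli'_def]
    norm_num [Finset.sum_range_succ, h5, Nat.choose]
  norm_num [hb, Nat.factorial] at h
  rw [h]
  ring

namespace PeriodPair
open Filter Topology

/-- The normalized Eisenstein series `E₄(it)`. -/
noncomputable def eis4 (t : ℝ) : ℝ := 1 + 240 * sigmaSeries 3 (Real.exp (-(2 * Real.pi * t)))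
/-- The normalized Eisenstein series `E₆(it)`. -/
noncomputable def eis6 (t : ℝ) : ℝ := 1 - 504 * sigmaSeries 5 (Real.exp (-(2 * Real.pi * t)))

theorem eis4_pos (t : ℝ) : 0 < eis4 t := by
  have := sigmaSeries_nonneg 3 (Real.exp_pos (-(2 * Real.pi * t))).le
  unfold eis4; positivity

theorem G_four_rect {t : ℝ} (ht : 0 < t) :
    (rect one_pos ht).G 4 = (Real.pi ^ 4 / 45 * eis4 t : ℝ) := by
  have h := G_rect ht (k := 4) (by norm_num) (by decide)
  have h2 : (-2 * Real.pi * Complex.I) ^ 4 = 16 * (Real.pi : ℂ) ^ 4 := by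
    rw [mul_pow, Complex.I_pow_four]; ring
  rw [h2] at h
  norm_num [riemannZeta_four, Nat.factorial] at h
  rw [h, eis4]
  push_cast
  ring

theorem G_six_rect {t : ℝ} (ht : 0 < t) :
    (rect one_pos ht).G 6 = (2 * Real.pi ^ 6 / 945 * eis6 t : ℝ) := by
  have h := G_rect ht (k := 6) (by norm_num) (by decide)
  have h2 : (-2 * Real.pi * Complex.I) ^ 6 = -64 * (Real.pi : ℂ) ^ 6 := by
    rw [mul_pow, show Complex.I ^ 6 = Complex.I ^ 4 * Complex.I ^ 2 by ring, Complex.I_pow_four,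
      Complex.I_sq]; ring
  rw [h2] at h
  norm_num [riemannZeta_six, Nat.factorial] at h
  rw [h, eis6]
  push_cast
  ring

theorem eis4_inv {t : ℝ} (ht : 0 < t) : eis4 t⁻¹ = t ^ 4 * eis4 t := by
  have h := G_rect_inv ht 4
  rw [G_four_rect, G_four_rect, div_pow, Complex.I_pow_four, inv_div, div_one] at h
  have h' : Real.pi ^ 4 / 45 * eis4 t⁻¹ = t ^ 4 * (Real.pi ^ 4 / 45 * eis4 t) := by exact_mod_cast h
  have : Real.pi ^ 4 / 45 ≠ 0 := by positivity
  exact mul_left_cancel₀ this (by linear_combination h')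

theorem eis6_inv {t : ℝ} (ht : 0 < t) : eis6 t⁻¹ = -(t ^ 6 * eis6 t) := by
  have h := G_rect_inv ht 6
  rw [G_six_rect, G_six_rect, div_pow, show Complex.I ^ 6 = Complex.I ^ 4 * Complex.I ^ 2 by ring,
    Complex.I_pow_four, Complex.I_sq, one_mul, inv_div, div_neg, div_one] at h
  have h' : 2 * Real.pi ^ 6 / 945 * eis6 t⁻¹ = -t ^ 6 * (2 * Real.pi ^ 6 / 945 * eis6 t) := by
    exact_mod_cast h
  have : 2 * Real.pi ^ 6 / 945 ≠ 0 := by positivity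
  exact mul_left_cancel₀ this (by linear_combination h')

/-- The quotient E₆/E₄^{3/2} tends to 1 as t → ∞, and t ↦ 1/t reverses its sign, so it tends to -1
as t → 0. Every value b/a^{3/2} in (-1, 1) is then attained by continuity. -/
theorem exists_eis6_eq {a b : ℝ} (hab : |b| < a * √a) :
    ∃ t, 0 < t ∧ eis6 t * (a * √a) = b * (eis4 t * √(eis4 t)) := by
  have t4 : Tendsto eis4 atTop (𝓝 1) := by
    simpa [eis4] using! ((tendsto_sigmaSeries_exp 3).const_mul 240).const_add 1
  have t6 : Tendsto eis6 atTop (𝓝 1) := by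
    simpa [eis6] using! ((tendsto_sigmaSeries_exp 5).const_mul 504).const_sub 1
  have t5 : Tendsto (fun t => eis4 t * √(eis4 t)) atTop (𝓝 1) := by
    simpa using t4.mul t4.sqrt
  have l1 := (t6.mul_const (a * √a)).sub (t5.const_mul b)
  have l2 := (t6.mul_const (a * √a)).add (t5.const_mul b)
  obtain ⟨hb1, hb2⟩ := abs_lt.1 hab
  have p1 := l1.eventually_const_lt (show 0 < 1 * (a * √a) - b * 1 by linarith)
  have p2 := l2.eventually_const_lt (show 0 < 1 * (a * √a) + b * 1 by linarith)
  obtain ⟨T, ⟨h1, h2⟩, hT⟩ := ((p1.and p2).and (eventually_ge_atTop 1)).exists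
  have hT0 : 0 < T := by linarith
  have hc : ContinuousOn (fun t => eis6 t * (a * √a) - b * (eis4 t * √(eis4 t)))
      (Set.Icc T⁻¹ T) := by
    have hs : Set.Icc T⁻¹ T ⊆ Set.Ioi 0 := fun x hx => (inv_pos.2 hT0).trans_le hx.1
    have c4 : ContinuousOn eis4 (Set.Icc T⁻¹ T) :=
      (((continuousOn_sigmaSeries_exp 3).mono hs).const_mul 240).const_add 1
    have c6 : ContinuousOn eis6 (Set.Icc T⁻¹ T) :=
      continuousOn_const.sub (((continuousOn_sigmaSeries_exp 5).mono hs).const_mul 504)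
    fun_prop
  have hle : T⁻¹ ≤ T := (inv_le_one_of_one_le₀ hT).trans hT
  have hneg : eis6 T⁻¹ * (a * √a) - b * (eis4 T⁻¹ * √(eis4 T⁻¹)) ≤ 0 := by
    rw [eis4_inv hT0, eis6_inv hT0, Real.sqrt_mul (by positivity),
      show T ^ 4 = (T ^ 2) ^ 2 by ring, Real.sqrt_sq (by positivity)]
    have : 0 < T ^ 6 * (eis6 T * (a * √a) + b * (eis4 T * √(eis4 T))) := by positivity
    linarith
  obtain ⟨t, ht, h⟩ := intermediate_value_Icc hle hc ⟨hneg, h1.le⟩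
  exact ⟨t, (inv_pos.2 hT0).trans_le ht.1, by linarith [h]⟩

/-- Positive discriminant says that the scale-free ratio of g₃ to g₂^{3/2} lies in the range covered
by `exists_eis6_eq`. That fixes the shape t; the scale r then follows from the homogeneity of g₂ in
degree -4. -/
theorem exists_isRectangular_invariants {A B : ℝ} (hA : 0 < A) (hAB : 27 * B ^ 2 < A ^ 3) :
    ∃ L : PeriodPair, L.IsRectangular ∧ L.g₂ = A ∧ L.g₃ = B := by
  have hpi := Real.pi_pos
  -- The divisors are the limits of g₂ and g₃ for periods (1, it) as t → ∞, so a and b are to be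
  -- matched with E₄ and E₆ up to scale.
  set a : ℝ := A / (4 * Real.pi ^ 4 / 3) with ha
  set b : ℝ := B / (8 * Real.pi ^ 6 / 27) with hb
  have ha0 : 0 < a := by positivity
  have hab : |b| < a * √a := by
    refine abs_lt_of_sq_lt_sq ?_ (by positivity)
    have e : a ^ 2 * a - b ^ 2 = 27 / (64 * Real.pi ^ 12) * (A ^ 3 - 27 * B ^ 2) := by
      rw [ha, hb]
      field_simp
      ring
    rw [mul_pow, Real.sq_sqrt ha0.le, ← sub_pos, e]
    exact mul_pos (by positivity) (by linarith)
  obtain ⟨t, ht, h⟩ := exists_eis6_eq hab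
  have he := eis4_pos t
  set r : ℝ := √(√(eis4 t / a)) with hr
  have hr0 : 0 < r := by positivity
  have hr2 : r ^ 2 = √(eis4 t / a) := Real.sq_sqrt (by positivity)
  have hr4 : r ^ 4 = eis4 t / a := by
    rw [show r ^ 4 = (r ^ 2) ^ 2 by ring, hr2, Real.sq_sqrt (by positivity)]
  refine ⟨rect hr0 (mul_pos hr0 ht), isRectangular_rect _ _, ?_, ?_⟩
  · rw [g₂, G_rect_scale ht, G_four_rect ht]
    have : 60 * ((r ^ 4)⁻¹ * (Real.pi ^ 4 / 45 * eis4 t)) = A := by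
      rw [hr4, ha]; field_simp; norm_num
    exact_mod_cast this
  · rw [g₃, G_rect_scale ht, G_six_rect ht]
    have h6 : r ^ 6 * b = eis6 t := by
      rw [show r ^ 6 = r ^ 4 * r ^ 2 by ring, hr4, hr2, Real.sqrt_div he.le]
      have : √a ≠ 0 := by positivity
      field_simp
      linear_combination -h
    have : 140 * ((r ^ 6)⁻¹ * (2 * Real.pi ^ 6 / 945 * eis6 t)) = B := by
      rw [← h6, hb]; field_simp; ring
    exact_mod_cast this

end PeriodPair

theorem existsUnique_isPeriodPairOf {c : ℝ} (hc : c ∈ Set.Ioo (0 : ℝ) (1 / 27)) :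
    ∃! L : PeriodPair, IsPeriodPairOf c L := by
  obtain ⟨h0, h1⟩ := hc
  obtain ⟨L, hL, h2, h3⟩ := PeriodPair.exists_isRectangular_invariants
    (A := 1 / 12 - 2 * c) (B := c / 6 - 1 / 216 - c ^ 2) (by linarith) (by
      -- This is the value of g₂³ - 27g₃² for the given invariants.
      have : 0 < c ^ 3 * (1 - 27 * c) := by
        have : 0 < 1 - 27 * c := by linarith
        positivity
      nlinarith)
  refine ⟨L, ⟨hL.1, hL.2, hL.3, hL.4, by rw [h2]; push_cast; rfl, by rw [h3]; push_cast; rfl⟩,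
    fun M hM => ?_⟩
  refine PeriodPair.IsRectangular.eq_of_lattice_eq ⟨hM.1, hM.2, hM.3, hM.4⟩ hL
    (PeriodPair.lattice_eq_of_invariants_eq ?_ ?_)
  · rw [hM.g₂_eq, h2]; push_cast; rfl
  · rw [hM.g₃_eq, h3]; push_cast; rfl

theorem isPeriodPairOf_periodsOf {c : ℝ} (hc : c ∈ Set.Ioo (0 : ℝ) (1 / 27)) :
    IsPeriodPairOf c (periodsOf c) :=
  Classical.epsilon_spec (existsUnique_isPeriodPairOf hc).exists

/-! ### Gronwall estimates and the quadratic system, with its variation in the level -/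

open Filter Topology ComplexConjugate

section Gronwall

theorem norm_le_gronwallBound_abs {E : Type*} [NormedAddCommGroup E] [NormedSpace ℝ E]
    {f f' : ℝ → E} {δ K ε T : ℝ} (hf : ∀ t, HasDerivAt f (f' t) t) (h0 : ‖f 0‖ ≤ δ)
    (hb : ∀ t, |t| ≤ T → ‖f' t‖ ≤ K * ‖f t‖ + ε) {t : ℝ} (ht : |t| ≤ T) :
    ‖f t‖ ≤ gronwallBound δ K ε |t| := by
  have main : ∀ {f f' : ℝ → E}, (∀ t, HasDerivAt f (f' t) t) → ‖f 0‖ ≤ δ →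
      (∀ t, |t| ≤ T → ‖f' t‖ ≤ K * ‖f t‖ + ε) → ∀ t, 0 ≤ t → t ≤ T →
      ‖f t‖ ≤ gronwallBound δ K ε t := by
    intro f f' hf h0 hb t ht htT
    have := norm_le_gronwallBound_of_norm_deriv_right_le (f := f) (f' := f') (a := 0) (b := T)
      (δ := δ) (K := K) (ε := ε) (fun x _ => (hf x).continuousAt.continuousWithinAt)
      (fun x _ => (hf x).hasDerivWithinAt) h0
      (fun x hx => hb x (by rw [abs_of_nonneg hx.1]; exact hx.2.le)) t ⟨ht, htT⟩
    simpa using this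
  rcases le_total 0 t with h | h
  · rw [abs_of_nonneg h] at ht ⊢
    exact main hf h0 hb t h ht
  · rw [abs_of_nonpos h] at ht ⊢
    have := main (f := fun t => f (-t)) (f' := fun t => -f' (-t))
      (fun t => by simpa using! (hf (-t)).scomp t (hasDerivAt_neg t)) (by simpa using h0)
      (fun t ht => by simpa using hb (-t) (by simpa using ht)) (-t) (by linarith) ht
    simpa using this

theorem gronwallBound_mul_le {δ K ε x T : ℝ} (hδ : 0 ≤ δ) (hK : 1 ≤ K) (hε : 0 ≤ ε)
    (hx : x ≤ T) : gronwallBound δ K ε x ≤ (δ + ε) * Real.exp (K * T) := by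
  rw [gronwallBound_of_K_ne_0 (by positivity)]
  have h1 : Real.exp (K * x) ≤ Real.exp (K * T) := by gcongr
  have h2 : ε / K ≤ ε := div_le_self hε hK
  have h3 : 0 ≤ ε / K := by positivity
  nlinarith [Real.exp_pos (K * T), Real.exp_pos (K * x)]

end Gronwall

/-- The quadratic vector field `yᵏ (yᵏ⁺¹ - yᵏ⁺²)`. -/
def volterra (y : Fin 3 → ℝ) : Fin 3 → ℝ := fun k => y k * (y (k + 1) - y (k + 2))

/-- The linearization of `volterra` at `y`. -/
def volterraLin (y h : Fin 3 → ℝ) : Fin 3 → ℝ :=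
  fun k => h k * (y (k + 1) - y (k + 2)) + y k * (h (k + 1) - h (k + 2))

/-- The field is homogeneous quadratic, so its Taylor expansion is exact; this makes all the
remainder estimates below explicit. -/
theorem volterra_add (y h : Fin 3 → ℝ) :
    volterra (y + h) = volterra y + volterraLin y h + volterra h := by
  ext k; simp [volterra, volterraLin]; ring

theorem norm_volterra_le (h : Fin 3 → ℝ) : ‖volterra h‖ ≤ 2 * ‖h‖ ^ 2 := by
  refine (pi_norm_le_iff_of_nonneg (by positivity)).2 fun k => ?_
  have a := norm_le_pi_norm h
  rw [volterra, norm_mul]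
  have : ‖h (k + 1) - h (k + 2)‖ ≤ ‖h‖ + ‖h‖ := (norm_sub_le _ _).trans (add_le_add (a _) (a _))
  calc _ ≤ ‖h‖ * (‖h‖ + ‖h‖) := by gcongr; exact a k
    _ = _ := by ring

theorem norm_volterraLin_le {y : Fin 3 → ℝ} (hy : ‖y‖ ≤ 1) (h : Fin 3 → ℝ) :
    ‖volterraLin y h‖ ≤ 4 * ‖h‖ := by
  refine (pi_norm_le_iff_of_nonneg (by positivity)).2 fun k => ?_
  have a := norm_le_pi_norm h
  have b : ∀ k, ‖y k‖ ≤ 1 := fun k => (norm_le_pi_norm y k).trans hy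
  have h1 : ‖h (k + 1) - h (k + 2)‖ ≤ ‖h‖ + ‖h‖ := (norm_sub_le _ _).trans (add_le_add (a _) (a _))
  have h2 : ‖y (k + 1) - y (k + 2)‖ ≤ 1 + 1 := (norm_sub_le _ _).trans (add_le_add (b _) (b _))
  rw [volterraLin]
  refine (norm_add_le _ _).trans ?_
  rw [norm_mul, norm_mul]
  calc _ ≤ ‖h‖ * (1 + 1) + 1 * (‖h‖ + ‖h‖) := by
        gcongr
        exacts [a k, b k]
    _ = _ := by ring

/-- A solution of the quadratic system in the open simplex, on the level `y¹ y² y³ = c`. -/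
structure IsVolterra (c : ℝ) (y : ℝ → Fin 3 → ℝ) : Prop where
  hasDerivAt : ∀ t, HasDerivAt y (volterra (y t)) t
  pos : ∀ t k, 0 < y t k
  sum : ∀ t, y t 0 + y t 1 + y t 2 = 1
  prod : ∀ t, y t 0 * y t 1 * y t 2 = c

namespace IsVolterra

variable {c c' : ℝ} {x y : ℝ → Fin 3 → ℝ}

theorem norm_le_one (h : IsVolterra c y) (t : ℝ) : ‖y t‖ ≤ 1 := by
  refine (pi_norm_le_iff_of_nonneg zero_le_one).2 fun k => ?_
  have h0 := h.pos t 0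
  have h1 := h.pos t 1
  have h2 := h.pos t 2
  have := h.sum t
  rw [Real.norm_of_nonneg (h.pos t k).le]
  fin_cases k <;> simp <;> linarith

theorem norm_sub_le (hx : IsVolterra c x) (hy : IsVolterra c' y) {T t : ℝ} (ht : |t| ≤ T) :
    ‖x t - y t‖ ≤ ‖x 0 - y 0‖ * Real.exp (8 * T) := by
  -- The rate 8 is 4 from the linear part plus 2‖x - y‖ ≤ 4 from the quadratic part, both solutions
  -- lying in the unit ball.
  have := norm_le_gronwallBound_abs (f := fun t => x t - y t) (δ := ‖x 0 - y 0‖) (K := 8) (ε := 0)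
    (T := T) (fun t => (hx.hasDerivAt t).sub (hy.hasDerivAt t)) le_rfl (fun t _ => ?_) ht
  · refine this.trans ?_
    refine (gronwallBound_mul_le (norm_nonneg _) (by norm_num) le_rfl ht).trans ?_
    simp
  · have e : x t = y t + (x t - y t) := by abel
    have e2 : volterra (x t) - volterra (y t) =
        volterraLin (y t) (x t - y t) + volterra (x t - y t) := by
      conv_lhs => rw [e, volterra_add]
      abel
    rw [e2]
    have n1 : ‖x t - y t‖ ≤ 2 := (_root_.norm_sub_le _ _).trans
      (by linarith [hx.norm_le_one t, hy.norm_le_one t])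
    have n2 := norm_volterraLin_le (hy.norm_le_one t) (x t - y t)
    have n3 := norm_volterra_le (x t - y t)
    have n4 := norm_nonneg (x t - y t)
    refine (norm_add_le _ _).trans ?_
    nlinarith

theorem comp_add (h : IsVolterra c y) (a : ℝ) : IsVolterra c fun t => y (t + a) where
  hasDerivAt t := (h.hasDerivAt (t + a)).comp_add_const t a
  pos _ := h.pos _
  sum _ := h.sum _
  prod _ := h.prod _

theorem eq_of_eq (hx : IsVolterra c x) (hy : IsVolterra c' y) {a : ℝ} (h : x a = y a) : x = y := by
  funext t
  have := (hx.comp_add a).norm_sub_le (hy.comp_add a) (t := t - a) le_rfl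
  simpa [h, sub_eq_zero] using this

/-- Cyclic symmetry. -/
theorem rotate (h : IsVolterra c y) : IsVolterra c fun t k => y t (k + 2) where
  hasDerivAt t := by
    rw [hasDerivAt_pi]
    intro k
    convert! (hasDerivAt_pi.1 (h.hasDerivAt t)) (k + 2) using 1
    fin_cases k <;> simp [volterra]
  pos _ _ := h.pos _ _
  sum t := by have := h.sum t; simp at this ⊢; linarith
  prod t := by have := h.prod t; simp at this ⊢; linarith

/-- Time reversal combined with a transposition. -/
theorem reflect (h : IsVolterra c y) (a : ℝ) {i j : Fin 3} (hij : i ≠ j) :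
    IsVolterra c fun t k => y (a - t) (Equiv.swap i j k) where
  hasDerivAt t := by
    rw [hasDerivAt_pi]
    intro k
    have h1 : HasDerivAt (fun t => a - t) (-1) t := by simpa using (hasDerivAt_id t).const_sub a
    have := ((hasDerivAt_pi.1 (h.hasDerivAt (a - t))) (Equiv.swap i j k)).scomp t h1
    convert! this using 1
    fin_cases i <;> fin_cases j <;> fin_cases k <;>
      simp_all [volterra, Equiv.swap_apply_def] <;> ring
  pos _ _ := h.pos _ _
  sum t := by
    have := h.sum (a - t)
    fin_cases i <;> fin_cases j <;> simp_all [Equiv.swap_apply_def] <;> linarith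
  prod t := by
    have := h.prod (a - t)
    fin_cases i <;> fin_cases j <;> simp_all [Equiv.swap_apply_def] <;> linarith

theorem hasDerivAt_apply (h : IsVolterra c y) (t : ℝ) (k : Fin 3) :
    HasDerivAt (fun t => y t k) (y t k * (y t (k + 1) - y t (k + 2))) t :=
  (hasDerivAt_pi.1 (h.hasDerivAt t)) k

theorem continuous (h : IsVolterra c y) : Continuous y :=
  continuous_iff_continuousAt.2 fun t => (h.hasDerivAt t).continuousAt

theorem continuous_apply (h : IsVolterra c y) (k : Fin 3) : Continuous fun t => y t k :=
  (_root_.continuous_apply k).comp h.continuous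

end IsVolterra

namespace IsVolterra

variable {c c' : ℝ} {x y : ℝ → Fin 3 → ℝ}

/-- The error of the first-order approximation satisfies the linearized equation with forcing
`volterra (x - y)`, which is quadratic in the initial displacement. The bound is uniform for |t| ≤
T. -/
theorem norm_sub_sub_le (hx : IsVolterra c x) (hy : IsVolterra c' y) {v : ℝ → Fin 3 → ℝ}
    (hv : ∀ t, HasDerivAt v (volterraLin (y t) (v t)) t) (a : ℝ) {T t : ℝ} (ht : |t| ≤ T) :
    ‖x t - (y t + a • v t)‖ ≤ (‖x 0 - (y 0 + a • v 0)‖ +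
      2 * (‖x 0 - y 0‖ * Real.exp (8 * T)) ^ 2) * Real.exp (4 * T) := by
  refine (norm_le_gronwallBound_abs (f := fun t => x t - (y t + a • v t)) (K := 4) (T := T)
    (δ := ‖x 0 - (y 0 + a • v 0)‖) (ε := 2 * (‖x 0 - y 0‖ * Real.exp (8 * T)) ^ 2)
    (fun t => (hx.hasDerivAt t).sub ((hy.hasDerivAt t).add ((hv t).const_smul a))) le_rfl
    (fun t ht => ?_) ht).trans
    (gronwallBound_mul_le (norm_nonneg _) (by norm_num) (by positivity) ht)
  have e : volterra (x t) - (volterra (y t) + a • volterraLin (y t) (v t)) =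
      volterraLin (y t) (x t - (y t + a • v t)) + volterra (x t - y t) := by
    ext k
    simp [volterra, volterraLin]
    ring
  rw [e]
  refine (norm_add_le _ _).trans ?_
  have n1 := norm_volterraLin_le (hy.norm_le_one t) (x t - (y t + a • v t))
  have n2 := norm_volterra_le (x t - y t)
  have n3 := hx.norm_sub_le hy ht
  have n4 : ‖x t - y t‖ ^ 2 ≤ (‖x 0 - y 0‖ * Real.exp (8 * T)) ^ 2 := by gcongr
  linarith

/-- Differentiability of solutions in the initial value. -/
theorem hasFDerivAt_family {y : ℝ → ℝ → Fin 3 → ℝ} {c₀ : ℝ}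
    (hy : ∀ᶠ c in 𝓝 c₀, IsVolterra c (y c)) {v : ℝ → Fin 3 → ℝ}
    (hv : ∀ t, HasDerivAt v (volterraLin (y c₀ t) (v t)) t)
    (h0 : HasDerivAt (fun c => y c 0) (v 0) c₀) (t₀ : ℝ) :
    HasFDerivAt (fun p : ℝ × ℝ => y p.1 p.2)
      ((ContinuousLinearMap.fst ℝ ℝ ℝ).smulRight (v t₀) +
        (ContinuousLinearMap.snd ℝ ℝ ℝ).smulRight (volterra (y c₀ t₀))) (c₀, t₀) := by
  have hy0 := hy.self_of_nhds
  -- Split y(c, t) = y(c₀, t) + (c - c₀)v(t) + remainder. The first two terms are differentiated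
  -- directly; the remainder has zero derivative jointly in (c, t) because its bound is uniform in t
  -- near t₀.
  have m1 : HasFDerivAt (fun p : ℝ × ℝ => y c₀ p.2)
      ((ContinuousLinearMap.snd ℝ ℝ ℝ).smulRight (volterra (y c₀ t₀))) (c₀, t₀) := by
    have h1 : HasFDerivAt (y c₀) _ ((c₀, t₀) : ℝ × ℝ).2 := (hy0.hasDerivAt t₀).hasFDerivAt
    have := h1.comp (c₀, t₀) hasFDerivAt_snd
    convert! this using 1
  have m2 : HasFDerivAt (fun p : ℝ × ℝ => (p.1 - c₀) • v p.2)
      ((ContinuousLinearMap.fst ℝ ℝ ℝ).smulRight (v t₀)) (c₀, t₀) := by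
    have h0 : HasFDerivAt v _ ((c₀, t₀) : ℝ × ℝ).2 := (hv t₀).hasFDerivAt
    have h1 : HasFDerivAt (fun p : ℝ × ℝ => v p.2) _ (c₀, t₀) := h0.comp (c₀, t₀) hasFDerivAt_snd
    have h2 : HasFDerivAt (fun p : ℝ × ℝ => p.1 - c₀) (ContinuousLinearMap.fst ℝ ℝ ℝ) (c₀, t₀) :=
      hasFDerivAt_fst.sub_const c₀
    convert! h2.smul h1 using 1
    ext <;> simp
  have m3 : HasFDerivAt (fun p : ℝ × ℝ => y p.1 p.2 - (y c₀ p.2 + (p.1 - c₀) • v p.2))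
      (0 : ℝ × ℝ →L[ℝ] Fin 3 → ℝ) (c₀, t₀) := by
    rw [hasFDerivAt_iff_isLittleO]
    set T := |t₀| + 1 with hT
    have b1 : (fun c => y c 0 - (y c₀ 0 + (c - c₀) • v 0)) =o[𝓝 c₀] fun c => c - c₀ := by
      have := hasDerivAt_iff_isLittleO.1 h0
      refine this.congr_left fun c => ?_
      abel
    have b2 : (fun c => ‖y c 0 - y c₀ 0‖ ^ 2) =o[𝓝 c₀] fun c => c - c₀ := by
      have h1 : (fun c => y c 0 - y c₀ 0) =O[𝓝 c₀] fun c => c - c₀ := h0.isBigO_sub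
      have h2 : (fun c => y c 0 - y c₀ 0) =o[𝓝 c₀] fun _ => (1 : ℝ) := by
        rw [Asymptotics.isLittleO_one_iff]
        have : Tendsto (fun c => y c 0 - y c₀ 0) (𝓝 c₀) (𝓝 (y c₀ 0 - y c₀ 0)) :=
          h0.continuousAt.tendsto.sub_const (y c₀ 0)
        simpa using this
      have := h1.norm_left.mul_isLittleO h2.norm_left
      simpa [sq] using this
    have b3 : (fun c => (‖y c 0 - (y c₀ 0 + (c - c₀) • v 0)‖ +
        2 * (‖y c 0 - y c₀ 0‖ * Real.exp (8 * T)) ^ 2) * Real.exp (4 * T)) =o[𝓝 c₀]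
        fun c => c - c₀ := by
      have := (b1.norm_left.add (b2.const_mul_left (2 * Real.exp (8 * T) ^ 2))).const_mul_left
        (Real.exp (4 * T))
      refine this.congr_left fun c => ?_
      ring
    have b4 := (b3.comp_tendsto (continuous_fst.tendsto (c₀, t₀))).trans_isBigO
      (Asymptotics.isBigO_fst_prod (f' := fun p : ℝ × ℝ => p.1 - c₀)
        (g' := fun p : ℝ × ℝ => p.2 - t₀))
    refine Asymptotics.IsLittleO.trans_le (Asymptotics.IsBigO.trans_isLittleO
      (Asymptotics.IsBigO.of_bound 1 ?_) b4) (fun p => le_of_eq ?_)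
    · have e1 : ∀ᶠ p : ℝ × ℝ in 𝓝 (c₀, t₀), IsVolterra p.1 (y p.1) :=
        (continuous_fst.tendsto (c₀, t₀)).eventually hy
      have e2 : ∀ᶠ p : ℝ × ℝ in 𝓝 (c₀, t₀), |p.2| ≤ T := by
        have : Tendsto (fun p : ℝ × ℝ => |p.2|) (𝓝 (c₀, t₀)) (𝓝 |t₀|) :=
          (continuous_abs.comp continuous_snd).tendsto _
        exact (this.eventually_lt_const (by simp [hT])).mono fun _ h => h.le
      filter_upwards [e1, e2] with p h1 h2
      have := h1.norm_sub_sub_le hy0 hv (p.1 - c₀) h2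
      simp only [sub_self, zero_smul, add_zero, zero_apply, sub_zero, one_mul,
        Function.comp_apply]
      exact this.trans (le_abs_self _)
    · rfl
  convert! (m1.add m2).add m3 using 1
  · ext p; simp
  · ext <;> simp

/-- The variation of a solution with the level `c`, in terms of `z = ∫ (y¹ y² - 3c)`. -/
noncomputable def variation (c : ℝ) (y : Fin 3 → ℝ) (z : ℝ) : Fin 3 → ℝ :=
  let v1 := (1 + 3 * y 1 - 18 * y 0 * y 1 - 6 * z * (1 - 3 * y 1)) / (4 * c * (1 - 27 * c))
  let v2 := (1 + 3 * y 0 - 18 * y 0 * y 1 + 6 * z * (1 - 3 * y 0)) / (4 * c * (1 - 27 * c))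
  let m := y 0 * v1 + y 1 * v2
  ![2 * y 0 * (v1 - m), 2 * y 1 * (v2 - m), -2 * y 2 * m]

/-- In `variation` the numbers `v1`, `v2` are the proposed c-derivatives of log|z¹|, log|z²|, and
the factors 2(vᵢ - m) come from differentiating yⁱ = |zⁱ|²/(|z¹|² + |z²|² + 1). Eliminating y³ by
the sum and c by the product leaves a polynomial identity over the common denominator. -/
theorem hasDerivAt_variation (h : IsVolterra c y) {z : ℝ → ℝ}
    (hz : ∀ t, HasDerivAt z (y t 0 * y t 1 - 3 * c) t) (t : ℝ) :
    HasDerivAt (fun t => variation c (y t) (z t))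
      (volterraLin (y t) (variation c (y t) (z t))) t := by
  have h0 := h.hasDerivAt_apply t 0
  have h1 := h.hasDerivAt_apply t 1
  have h2 := h.hasDerivAt_apply t 2
  simp only [Fin.isValue, zero_add, show (1 : Fin 3) + 1 = 2 from rfl, show (1 : Fin 3) + 2 = 0 from rfl,
    show (2 : Fin 3) + 1 = 0 from rfl, show (2 : Fin 3) + 2 = 1 from rfl] at h0 h1 h2
  have dv1 := ((((h1.const_mul 3).const_add 1).sub ((h0.const_mul 18).mul h1)).sub
    (((hz t).const_mul 6).mul ((h1.const_mul 3).const_sub 1))).div_const (4 * c * (1 - 27 * c))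
  have dv2 := ((((h0.const_mul 3).const_add 1).sub ((h0.const_mul 18).mul h1)).add
    (((hz t).const_mul 6).mul ((h0.const_mul 3).const_sub 1))).div_const (4 * c * (1 - 27 * c))
  have dm := (h0.mul dv1).add (h1.mul dv2)
  have e2 : y t 2 = 1 - y t 0 - y t 1 := by linarith [h.sum t]
  have ec : c = y t 0 * y t 1 * (1 - y t 0 - y t 1) := by rw [← e2, h.prod t]
  rw [hasDerivAt_pi]
  intro k
  fin_cases k
  · convert! (h0.const_mul 2).mul (dv1.sub dm) using 1
    simp [volterraLin, variation]
    generalize (4 * c * (1 - 27 * c)) = N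
    rw [e2, ec]
    ring
  · convert! (h1.const_mul 2).mul (dv2.sub dm) using 1
    simp [volterraLin, variation]
    generalize (4 * c * (1 - 27 * c)) = N
    rw [e2, ec]
    ring
  · convert! (h2.const_mul (-2)).mul dm using 1
    simp [volterraLin, variation]
    generalize (4 * c * (1 - 27 * c)) = N
    rw [e2, ec]
    ring

end IsVolterra

/-! ### Symmetries, periods and orbits of the quadratic system -/

/-- A solution that starts at `(q, q, 1 - 2q)` with `q > 1/3`. -/
structure IsVolterraFrom (c q : ℝ) (y : ℝ → Fin 3 → ℝ) : Prop extends IsVolterra c y where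
  init_zero : y 0 0 = q
  init_one : y 0 1 = q
  lt : 1 / 3 < q

/-- `τ` is the first positive time with `y² = y³`. -/
structure IsFirstMeeting (y : ℝ → Fin 3 → ℝ) (τ : ℝ) : Prop where
  pos : 0 < τ
  eq : y τ 1 = y τ 2
  lt : ∀ t, 0 ≤ t → t < τ → y t 2 < y t 1

namespace IsVolterraFrom

variable {c q : ℝ} {y : ℝ → Fin 3 → ℝ} {τ : ℝ}

theorem init_two (h : IsVolterraFrom c q y) : y 0 2 = 1 - 2 * q := by
  linarith [h.sum 0, h.init_zero, h.init_one]

theorem lt_half (h : IsVolterraFrom c q y) : q < 1 / 2 := by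
  linarith [h.pos 0 2, h.init_two]

theorem level (h : IsVolterraFrom c q y) : c = q ^ 2 * (1 - 2 * q) := by
  rw [← h.prod 0, h.init_zero, h.init_one, h.init_two]; ring

/-- Rolle's theorem for y¹ over a period gives a zero of y² - y³, because y¹' = y¹(y² - y³). The
least such time is positive since y² > y³ initially. -/
theorem exists_isFirstMeeting (h : IsVolterraFrom c q y) {P : ℝ} (hP : 0 < P)
    (hper : y P 0 = y 0 0) : ∃ τ, IsFirstMeeting y τ := by
  obtain ⟨t, ht, h0⟩ := exists_hasDerivAt_eq_zero hP
    (h.continuous_apply 0).continuousOn hper.symm (fun t _ => h.hasDerivAt_apply t 0)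
  have h1 : y t 1 - y t 2 = 0 := (mul_eq_zero.1 h0).resolve_left (h.pos t 0).ne'
  set S := {t : ℝ | 0 ≤ t ∧ y t 1 - y t 2 = 0} with hS
  have hg : Continuous fun t => y t 1 - y t 2 := (h.continuous_apply 1).sub (h.continuous_apply 2)
  have hcl : IsClosed S := isClosed_Ici.inter (isClosed_singleton.preimage hg)
  have hmem := hcl.csInf_mem ⟨t, ht.1.le, h1⟩ ⟨0, fun _ hx => hx.1⟩
  have hi : 0 < y 0 1 - y 0 2 := by rw [h.init_one, h.init_two]; linarith [h.lt]
  refine ⟨sInf S, lt_of_le_of_ne hmem.1 fun h0 => ?_, by linarith [hmem.2], fun s hs hsS => ?_⟩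
  · rw [← h0] at hmem; exact hi.ne' hmem.2
  · by_contra hlt
    obtain ⟨r, hr, hr0⟩ := intermediate_value_Icc' hs hg.continuousOn
      ⟨by linarith, hi.le⟩
    exact absurd (csInf_le ⟨0, fun _ hx => hx.1⟩ (show r ∈ S from ⟨hr.1, hr0⟩))
      (by linarith [hr.2])

/-- Reflecting time at τ while exchanging y² and y³ preserves the equations and the value at τ, so
uniqueness forces the symmetry. -/
theorem reflect_meeting (h : IsVolterraFrom c q y) (hτ : y τ 1 = y τ 2) (t : ℝ) (k : Fin 3) :
    y (2 * τ - t) (Equiv.swap 1 2 k) = y t k := by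
  have := (h.toIsVolterra.reflect (2 * τ) (i := 1) (j := 2) (by decide)).eq_of_eq h.toIsVolterra
    (a := τ) (by
      ext k
      rw [show 2 * τ - τ = τ by ring]
      fin_cases k <;> simp [Equiv.swap_apply_def, hτ])
  exact congrFun (congrFun this t) k

theorem reflect_zero (h : IsVolterraFrom c q y) (t : ℝ) (k : Fin 3) :
    y (-t) (Equiv.swap 0 1 k) = y t k := by
  have := (h.toIsVolterra.reflect 0 (i := 0) (j := 1) (by decide)).eq_of_eq h.toIsVolterra
    (a := 0) (by
      ext k
      rw [sub_zero]
      fin_cases k <;> simp [Equiv.swap_apply_def, h.init_zero, h.init_one])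
  simpa using congrFun (congrFun this t) k

/-- The reflections at 0 and at τ, with the transpositions (1 2) and (2 3) of the yᵏ, compose to a
translation by 2τ with a cyclic permutation. Three such translations give the period 6τ. -/
theorem add_two_mul (h : IsVolterraFrom c q y) (hτ : y τ 1 = y τ 2) (t : ℝ) (k : Fin 3) :
    y (t + 2 * τ) k = y t (k + 1) := by
  have e : ∀ k, y (2 * τ) (Equiv.swap 1 2 k) = y 0 k := by
    simpa using h.reflect_meeting hτ 0
  have e0 := e 0
  have e1 := e 1
  have e2 := e 2
  simp [Equiv.swap_apply_def] at e0 e1 e2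
  have := ((h.toIsVolterra.comp_add (2 * τ)).rotate).eq_of_eq h.toIsVolterra (a := 0) (by
      ext k
      fin_cases k <;> simp [e0, e1, e2, h.init_zero, h.init_one])
  have h2 := congrFun (congrFun this t) (k + 1)
  simp only [add_assoc] at h2
  rwa [show (1 + 2 : Fin 3) = 0 from rfl, add_zero] at h2

theorem add_six_mul (h : IsVolterraFrom c q y) (hτ : y τ 1 = y τ 2) (t : ℝ) :
    y (t + 6 * τ) = y t := by
  ext k
  rw [show t + 6 * τ = t + 2 * τ + 2 * τ + 2 * τ by ring, h.add_two_mul hτ, h.add_two_mul hτ,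
    h.add_two_mul hτ, add_assoc, add_assoc, show (1 + (1 + 1) : Fin 3) = 0 from rfl, add_zero]

theorem zero_lt (h : IsVolterraFrom c q y) (hτ : IsFirstMeeting y τ) {t : ℝ} (h0 : 0 < t)
    (ht : t ≤ τ) : q < y t 0 := by
  have hm : StrictMonoOn (fun t => y t 0) (Set.Icc 0 τ) := by
    refine strictMonoOn_of_deriv_pos (convex_Icc _ _) (h.continuous_apply 0).continuousOn ?_
    intro s hs
    rw [interior_Icc] at hs
    rw [(h.hasDerivAt_apply s 0).deriv]
    exact mul_pos (h.pos s 0) (sub_pos.2 (hτ.lt s hs.1.le hs.2))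
  have := hm ⟨le_rfl, hτ.pos.le⟩ ⟨h0.le, ht⟩ h0
  simpa [h.init_zero] using this

theorem two_lt_zero (h : IsVolterraFrom c q y) (hτ : IsFirstMeeting y τ) {t : ℝ} (h0 : 0 ≤ t)
    (ht : t ≤ τ) : y t 2 < y t 0 := by
  have h1 : y t 2 ≤ y t 1 := by
    rcases ht.lt_or_eq with h1 | h1
    · exact (hτ.lt t h0 h1).le
    · rw [h1, hτ.eq]
  have h2 : q ≤ y t 0 := by
    rcases h0.lt_or_eq with h2 | h2
    · exact (h.zero_lt hτ h2 ht).le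
    · rw [← h2, h.init_zero]
  linarith [h.sum t, h.lt]

theorem one_lt_zero (h : IsVolterraFrom c q y) (hτ : IsFirstMeeting y τ) {t : ℝ} (h0 : 0 < t)
    (ht : t ≤ τ) : y t 1 < y t 0 := by
  have hm : StrictAntiOn (fun t => y t 1) (Set.Icc 0 τ) := by
    refine strictAntiOn_of_deriv_neg (convex_Icc _ _) (h.continuous_apply 1).continuousOn ?_
    intro s hs
    rw [interior_Icc] at hs
    rw [(h.hasDerivAt_apply s 1).deriv]
    exact mul_neg_of_pos_of_neg (h.pos s 1) (sub_neg.2 (h.two_lt_zero hτ hs.1.le hs.2.le))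
  have := hm ⟨le_rfl, hτ.pos.le⟩ ⟨h0.le, ht⟩ h0
  simp only [h.init_one] at this
  exact this.trans (h.zero_lt hτ h0 ht)

/-- The intervals [τ, 2τ] and [2τ, 3τ) are carried into [0, τ] by the reflection and the
translation, where the inequality becomes one between other components. This is the sign of the
derivative of y³ on half a period. -/
theorem one_lt_zero' (h : IsVolterraFrom c q y) (hτ : IsFirstMeeting y τ) {t : ℝ} (h0 : 0 < t)
    (ht : t < 3 * τ) : y t 1 < y t 0 := by
  rcases le_total t τ with h1 | h1
  · exact h.one_lt_zero hτ h0 h1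
  rcases le_total t (2 * τ) with h2 | h2
  · have e0 := h.reflect_meeting hτ.eq t 0
    have e1 := h.reflect_meeting hτ.eq t 1
    simp at e0 e1
    rw [← e0, ← e1]
    exact h.two_lt_zero hτ (by linarith) (by linarith)
  · have e0 := h.add_two_mul hτ.eq (t - 2 * τ) 0
    have e1 := h.add_two_mul hτ.eq (t - 2 * τ) 1
    simp at e0 e1
    rw [e0, e1]
    exact hτ.lt _ (by linarith) (by linarith)

theorem strictMonoOn_two (h : IsVolterraFrom c q y) (hτ : IsFirstMeeting y τ) :
    StrictMonoOn (fun t => y t 2) (Set.Icc 0 (3 * τ)) := by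
  refine strictMonoOn_of_deriv_pos (convex_Icc _ _) (h.continuous_apply 2).continuousOn ?_
  intro s hs
  rw [interior_Icc] at hs
  rw [(h.hasDerivAt_apply s 2).deriv]
  exact mul_pos (h.pos s 2) (sub_pos.2 (h.one_lt_zero' hτ hs.1 hs.2))

theorem two_neg (h : IsVolterraFrom c q y) (t : ℝ) : y (-t) 2 = y t 2 := by
  simpa [Equiv.swap_apply_def] using h.reflect_zero t 2

/-- The component y³ is even and 6τ-periodic, and increases strictly on [0, 3τ], so it returns to
its minimum no earlier than at 6τ. -/
theorem two_ne_of_lt (h : IsVolterraFrom c q y) (hτ : IsFirstMeeting y τ) {t : ℝ} (h0 : 0 < t)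
    (ht : t < 6 * τ) : y t 2 ≠ y 0 2 := by
  have hp := hτ.pos
  rcases le_total t (3 * τ) with h1 | h1
  · exact (h.strictMonoOn_two hτ ⟨le_rfl, by linarith⟩ ⟨h0.le, h1⟩ h0).ne'
  · have e : y t 2 = y (6 * τ - t) 2 := by
      rw [← h.two_neg t, ← h.add_six_mul hτ.eq (-t)]; ring_nf
    rw [e]
    exact (h.strictMonoOn_two hτ ⟨le_rfl, by linarith⟩ ⟨by linarith, by linarith⟩
      (by linarith : 0 < 6 * τ - t)).ne'

theorem one_lt_two (h : IsVolterraFrom c q y) (hτ : IsFirstMeeting y τ) {t : ℝ} (h0 : τ < t)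
    (ht : t ≤ 2 * τ) : y t 1 < y t 2 := by
  have e0 := h.reflect_meeting hτ.eq t 1
  have e1 := h.reflect_meeting hτ.eq t 2
  simp at e0 e1
  rw [← e0, ← e1]
  exact hτ.lt _ (by linarith) (by linarith)

/-- The orbit is the whole level set. -/
theorem exists_eq (h : IsVolterraFrom c q y) (hτ : IsFirstMeeting y τ) {a : Fin 3 → ℝ}
    (ha : ∀ k, 0 < a k) (hsum : a 0 + a 1 + a 2 = 1) (hprod : a 0 * a 1 * a 2 = c) :
    ∃ t, y t = a := by
  have hp := hτ.pos
  -- The numbers a¹ and a² are roots of T² - (1 - a³)T + c/a³, whose discriminant must be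
  -- nonnegative: f(a³) ≥ 4c for f(m) = m(1 - m)². This f increases up to 1/3 and decreases from
  -- there to 1. Since y³(0) = 1 - 2q < 1/3 and y³(3τ) > 1/3 both satisfy f = 4c, they bracket a³.
  have hdisc : 4 * c ≤ a 2 * (1 - a 2) ^ 2 := by
    have : (1 - a 2) ^ 2 - 4 * (a 0 * a 1) = (a 0 - a 1) ^ 2 := by
      rw [← hsum]; ring
    have h2 := ha 2
    rw [← hprod]
    nlinarith [sq_nonneg (a 0 - a 1)]
  have hlo : y 0 2 ≤ a 2 := by
    rw [h.init_two]
    by_contra hlt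
    push Not at hlt
    rw [h.level] at hdisc
    have h1 := h.lt
    have h2 := h.lt_half
    have h3 := ha 2
    have h4 : 4 * (q ^ 2 * (1 - 2 * q)) - a 2 * (1 - a 2) ^ 2 =
      ((1 - 2 * q) - a 2) * ((1 - (1 - 2 * q) - a 2) ^ 2 - (1 - 2 * q) * a 2) := by ring
    have h5 : 0 < (1 - (1 - 2 * q) - a 2) ^ 2 - (1 - 2 * q) * a 2 := by nlinarith
    have := mul_pos (sub_pos.2 hlt) h5
    linarith
  have e0 := h.add_two_mul hτ.eq τ 2
  have e1 := h.add_two_mul hτ.eq τ 0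
  have e2 := h.add_two_mul hτ.eq τ 1
  simp only [show τ + 2 * τ = 3 * τ by ring, show (2 + 1 : Fin 3) = 0 from rfl, zero_add,
    show (1 + 1 : Fin 3) = 2 from rfl] at e0 e1 e2
  have hhi : a 2 ≤ y (3 * τ) 2 := by
    by_contra hlt
    push Not at hlt
    have hm := h.zero_lt hτ hp le_rfl
    have hs := h.sum (3 * τ)
    have hpr := h.prod (3 * τ)
    have e3 : y (3 * τ) 0 = y (3 * τ) 1 := by rw [e1, e2, hτ.eq]
    rw [← e0] at hm
    set m := y (3 * τ) 2
    have h1 := h.lt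
    have e4 : y (3 * τ) 0 = (1 - m) / 2 := by linarith
    have e5 : 4 * c = m * (1 - m) ^ 2 := by rw [← hpr, ← e3, e4]; ring
    have h3 := ha 0
    have h4 := ha 1
    have h6 : a 2 < 1 := by linarith
    have h5 : a 2 * (1 - a 2) ^ 2 - m * (1 - m) ^ 2 =
      (a 2 - m) * ((1 - m - a 2) ^ 2 - m * a 2) := by ring
    have h7 : (1 - m - a 2) ^ 2 - m * a 2 < 0 := by nlinarith
    nlinarith [mul_neg_of_pos_of_neg (sub_pos.2 hlt) h7]
  obtain ⟨t, ht, hta⟩ := intermediate_value_Icc (by linarith : 0 ≤ 3 * τ)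
    (h.continuous_apply 2).continuousOn ⟨hlo, hhi⟩
  have hta : y t 2 = a 2 := hta
  have s1 : y t 0 + y t 1 = a 0 + a 1 := by linarith [h.sum t]
  have s2 : y t 0 * y t 1 = a 0 * a 1 := by
    have := h.prod t
    rw [hta, ← hprod] at this
    exact mul_right_cancel₀ (ha 2).ne' this
  -- Sum and product fix {y¹, y²} once y³ is known. The two orderings are reached at t and at -t.
  have s3 : (y t 0 - a 0) * (y t 0 - a 1) = 0 := by linear_combination y t 0 * s1 - s2
  rcases mul_eq_zero.1 s3 with h3 | h3
  · refine ⟨t, ?_⟩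
    ext k
    fin_cases k
    · simp; linarith
    · simp; linarith
    · exact hta
  · refine ⟨-t, ?_⟩
    have r0 := h.reflect_zero t 0
    have r1 := h.reflect_zero t 1
    simp at r0 r1
    ext k
    fin_cases k
    · simp; linarith
    · simp; linarith
    · simp only [Fin.reduceFinMk, h.two_neg]; exact hta

end IsVolterraFrom

/-- The first meeting time is continuous in a continuous family of solutions. -/
theorem continuousAt_firstMeeting {y : ℝ → ℝ → Fin 3 → ℝ} {q τ : ℝ → ℝ} {c₀ : ℝ}
    (hy : ∀ᶠ c in 𝓝 c₀, IsVolterraFrom c (q c) (y c))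
    (hτ : ∀ᶠ c in 𝓝 c₀, IsFirstMeeting (y c) (τ c))
    (h0 : ContinuousAt (fun c => y c 0) c₀) : ContinuousAt τ c₀ := by
  have hy0 := hy.self_of_nhds
  have hτ0 := hτ.self_of_nhds
  have hp := hτ0.pos
  set T := 2 * τ c₀ with hT
  have unif : ∀ δ > 0, ∀ᶠ c in 𝓝 c₀, ∀ t, |t| ≤ T → ∀ k, |y c t k - y c₀ t k| < δ := by
    intro δ hδ
    have : Tendsto (fun c => ‖y c 0 - y c₀ 0‖ * Real.exp (8 * T)) (𝓝 c₀) (𝓝 0) := by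
      have := ((h0.tendsto.sub_const (y c₀ 0)).norm).mul_const (Real.exp (8 * T))
      simpa using this
    filter_upwards [hy, this.eventually_lt_const hδ] with c hc hlt t ht k
    have h1 := hc.toIsVolterra.norm_sub_le hy0.toIsVolterra ht
    have h2 := norm_le_pi_norm (y c t - y c₀ t) k
    simp only [Pi.sub_apply, Real.norm_eq_abs] at h2
    linarith
  rw [ContinuousAt, Metric.tendsto_nhds]
  intro ε hε
  have hg : Continuous fun t => y c₀ t 1 - y c₀ t 2 :=
    (hy0.continuous_apply 1).sub (hy0.continuous_apply 2)
  set e := min ε (τ c₀) / 2 with he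
  have he0 : 0 < e := by positivity
  have he1 : e < ε := by have := min_le_left ε (τ c₀); linarith
  have he2 : e < τ c₀ := by have := min_le_right ε (τ c₀); linarith
  -- At c₀ the function y² - y³ is bounded below by a positive number on [0, τ - e] and is negative
  -- at τ + e. Perturbing each component by less than half of these gaps keeps both signs, which
  -- traps the meeting time.
  obtain ⟨m, hm, hmin⟩ := isCompact_Icc.exists_isMinOn
    (Set.nonempty_Icc.2 (by linarith : (0 : ℝ) ≤ τ c₀ - e)) hg.continuousOn
  have hδ1 : 0 < y c₀ m 1 - y c₀ m 2 := sub_pos.2 (hτ0.lt m hm.1 (by linarith [hm.2]))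
  have hδ2 : 0 < y c₀ (τ c₀ + e) 2 - y c₀ (τ c₀ + e) 1 :=
    sub_pos.2 (hy0.one_lt_two hτ0 (by linarith) (by linarith))
  filter_upwards [hy, hτ, unif _ (half_pos hδ1), unif _ (half_pos hδ2)] with c hc hcτ u1 u2
  have hcp := hcτ.pos
  rw [Real.dist_eq, abs_lt]
  constructor
  · by_contra hlt
    push Not at hlt
    have hmem : τ c ∈ Set.Icc 0 (τ c₀ - e) := ⟨hcp.le, by linarith⟩
    have h1 : y c₀ m 1 - y c₀ m 2 ≤ y c₀ (τ c) 1 - y c₀ (τ c) 2 := hmin hmem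
    have ht : |τ c| ≤ T := by rw [abs_of_pos hcp]; linarith [hmem.2]
    have h2 := abs_lt.1 (u1 _ ht 1)
    have h3 := abs_lt.1 (u1 _ ht 2)
    have := hcτ.eq
    linarith [h2.1, h3.2]
  · by_contra hlt
    push Not at hlt
    have h1 := hcτ.lt (τ c₀ + e) (by linarith) (by linarith)
    have ht : |τ c₀ + e| ≤ T := by rw [abs_of_pos (by linarith)]; linarith
    have h2 := abs_lt.1 (u2 _ ht 1)
    have h3 := abs_lt.1 (u2 _ ht 2)
    linarith [h2.2, h3.1]

/-! ### The elliptic solution of the quadratic system -/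

namespace PeriodPair

/-- By the identity theorem the translation relation extends to a punctured neighbourhood of 0. The
pole at 0 then forces a pole at a. -/
theorem mem_lattice_of_translate (L : PeriodPair) {a z₀ : ℂ} (h0 : z₀ ∉ L.lattice)
    (ha0 : z₀ + a ∉ L.lattice)
    (h : ∃ᶠ z in 𝓝[≠] z₀, L.weierstrassP (z + a) = L.weierstrassP z) : a ∈ L.lattice := by
  have c1 : Countable L.lattice := countable_of_Lindelof_of_discrete
  have c2 : ((fun z => z + a) ⁻¹' (L.lattice : Set ℂ)).Countable :=
    c1.to_set.preimage_of_injOn (add_left_injective a).injOn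
  have hconn : IsPreconnected ((L.lattice : Set ℂ) ∪ (fun z => z + a) ⁻¹' (L.lattice : Set ℂ))ᶜ :=
    (Set.Countable.isConnected_compl_of_one_lt_rank (by simp) (c1.to_set.union c2)).isPreconnected
  have hA : AnalyticOnNhd ℂ L.weierstrassP
      ((L.lattice : Set ℂ) ∪ (fun z => z + a) ⁻¹' (L.lattice : Set ℂ))ᶜ :=
    L.analyticOnNhd_weierstrassP.mono (by simp)
  have hB : AnalyticOnNhd ℂ (fun z => L.weierstrassP (z + a))
      ((L.lattice : Set ℂ) ∪ (fun z => z + a) ⁻¹' (L.lattice : Set ℂ))ᶜ := by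
    intro z hz
    have h1 : z + a ∉ L.lattice := fun hm => hz (Or.inr hm)
    exact (L.analyticOnNhd_weierstrassP (z + a) h1).comp_of_eq (f := fun z => z + a)
      (by fun_prop) rfl
  have heq := hB.eqOn_of_preconnected_of_frequently_eq hA hconn (z₀ := z₀)
    (fun hm => hm.elim h0 ha0) h
  by_contra hna
  have hc : ContinuousAt L.weierstrassP (0 + a) :=
    (L.analyticOnNhd_weierstrassP _ (by simpa using hna)).continuousAt
  have hc' : ContinuousAt (fun z => L.weierstrassP (z + a)) 0 :=
    hc.comp (f := fun z => z + a) (by fun_prop)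
  have t1 : Tendsto (fun z => ‖L.weierstrassP (z + a)‖) (𝓝[≠] 0) (𝓝 ‖L.weierstrassP (0 + a)‖) :=
    hc'.norm.tendsto.mono_left nhdsWithin_le_nhds
  refine not_tendsto_nhds_of_tendsto_atTop
    ((L.tendsto_norm_weierstrassP (zero_mem _)).congr' ?_) _ t1
  have hev : ∀ᶠ z in 𝓝[≠] (0 : ℂ), z + a ∉ L.lattice := by
    have : ∀ᶠ z in 𝓝 (0 : ℂ), z + a ∈ (L.lattice : Set ℂ)ᶜ :=
      (by fun_prop : Continuous fun z : ℂ => z + a).continuousAt.eventually_mem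
        (L.isOpen_compl_lattice.mem_nhds (by simpa using hna))
    exact mem_nhdsWithin_of_mem_nhds this
  filter_upwards [L.eventually_notMem_lattice 0, hev] with z h1 h2
  rw [← heq (fun hm => hm.elim h1 h2)]

end PeriodPair

namespace IsPeriodPairOf

variable {c : ℝ} {L : PeriodPair}

theorem isRectangular (h : IsPeriodPairOf c L) : L.IsRectangular :=
  ⟨h.im_one, h.re_one, h.re_two, h.im_two⟩

theorem ω₁_eq (h : IsPeriodPairOf c L) : L.ω₁ = (L.ω₁.re : ℂ) := by
  apply Complex.ext <;> simp [h.im_one]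

theorem ω₂_eq (h : IsPeriodPairOf c L) : L.ω₂ = L.ω₂.im * Complex.I := by
  apply Complex.ext <;> simp [h.re_two]

theorem im_notMem {L : PeriodPair} (h : IsPeriodPairOf c L) {z : ℂ} (h0 : 0 < z.im)
    (h1 : z.im < L.ω₂.im) : z ∉ L.lattice := by
  rw [h.isRectangular.mem_iff]
  rintro ⟨m, n, -, e⟩
  have hn : (0 : ℝ) < n := by
    by_contra hn
    push Not at hn
    nlinarith
  have : (1 : ℝ) ≤ n := by exact_mod_cast hn
  nlinarith

theorem half_add_notMem (h : IsPeriodPairOf c L) (t : ℝ) : L.ω₂ / 2 + t ∉ L.lattice := by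
  have := h.im_two
  apply h.im_notMem <;> simp <;> linarith

/-- The invariants are chosen for this form: with u = 1/12 - ℘ = y¹y² and y¹ + y² = 1 - c/u, the
right-hand side is u²(y¹ - y²)². -/
theorem derivWeierstrassP_sq (h : IsPeriodPairOf c L) {z : ℂ} (hz : z ∉ L.lattice) :
    L.derivWeierstrassP z ^ 2 =
      (1 / 12 - L.weierstrassP z - c) ^ 2 - 4 * (1 / 12 - L.weierstrassP z) ^ 3 := by
  rw [L.derivWeierstrassP_sq z hz, h.g₂_eq, h.g₃_eq]
  ring

/-- The real function `1/12 - ℘(ω₂/2 + t)`. -/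
noncomputable def _root_.PeriodPair.midline (L : PeriodPair) (t : ℝ) : ℝ :=
  (1 / 12 - L.weierstrassP (L.ω₂ / 2 + t)).re

/-- The derivative of `midline`. -/
noncomputable def _root_.PeriodPair.midlineDeriv (L : PeriodPair) (t : ℝ) : ℝ :=
  (-L.derivWeierstrassP (L.ω₂ / 2 + t)).re

/-- Conjugation preserves the line through ω₂/2 up to the full period ω₂; this is why ℘ is real on
it. -/
theorem conj_half (h : IsPeriodPairOf c L) (t : ℝ) :
    conj (L.ω₂ / 2 + t) = L.ω₂ / 2 + t - (⟨L.ω₂, L.ω₂_mem_lattice⟩ : L.lattice) := by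
  apply Complex.ext
  · simp [h.re_two, Complex.conj_ofNat]
  · simp [Complex.conj_ofNat]; ring

theorem ofReal_midline (h : IsPeriodPairOf c L) (t : ℝ) :
    (L.midline t : ℂ) = 1 / 12 - L.weierstrassP (L.ω₂ / 2 + t) := by
  rw [PeriodPair.midline]
  refine Complex.conj_eq_iff_re.1 ?_
  rw [map_sub, ← h.isRectangular.weierstrassP_conj, h.conj_half, L.weierstrassP_sub_coe]
  simp [Complex.conj_ofNat]

theorem hasDerivAt_midline_complex (h : IsPeriodPairOf c L) (t : ℝ) :
    HasDerivAt (fun t : ℝ => (L.midline t : ℂ)) (-L.derivWeierstrassP (L.ω₂ / 2 + t)) t := by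
  have h1 := L.hasDerivAt_weierstrassP (h.half_add_notMem t)
  have h2 : HasDerivAt (fun t : ℝ => L.ω₂ / 2 + (t : ℂ)) 1 t :=
    (Complex.ofRealCLM.hasDerivAt (x := t)).const_add _
  have h3 := (h1.scomp t h2).const_sub (1 / 12)
  simp only [h.ofReal_midline]
  simpa using! h3

theorem hasDerivAt_midline (h : IsPeriodPairOf c L) (t : ℝ) :
    HasDerivAt L.midline (L.midlineDeriv t) t := by
  simpa using! Complex.reCLM.hasFDerivAt.comp_hasDerivAt t (h.hasDerivAt_midline_complex t)

theorem ofReal_midlineDeriv (h : IsPeriodPairOf c L) (t : ℝ) :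
    (L.midlineDeriv t : ℂ) = -L.derivWeierstrassP (L.ω₂ / 2 + t) :=
  (h.hasDerivAt_midline t).ofReal_comp.unique (h.hasDerivAt_midline_complex t)

theorem midlineDeriv_sq (h : IsPeriodPairOf c L) (t : ℝ) :
    L.midlineDeriv t ^ 2 = (L.midline t - c) ^ 2 - 4 * L.midline t ^ 3 := by
  have := h.derivWeierstrassP_sq (h.half_add_notMem t)
  rw [← h.ofReal_midline, ← neg_sq, ← h.ofReal_midlineDeriv] at this
  exact_mod_cast this

theorem hasDerivAt_midlineDeriv (h : IsPeriodPairOf c L) (t : ℝ) :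
    HasDerivAt L.midlineDeriv (L.midline t - c - 6 * L.midline t ^ 2) t := by
  have h1 := L.hasDerivAt_derivWeierstrassP (h.half_add_notMem t)
  have h2 : HasDerivAt (fun t : ℝ => L.ω₂ / 2 + (t : ℂ)) 1 t :=
    (Complex.ofRealCLM.hasDerivAt (x := t)).const_add _
  have h3 := (h1.scomp t h2).neg
  have h4 := Complex.reCLM.hasFDerivAt.comp_hasDerivAt t h3
  have e : L.weierstrassP (L.ω₂ / 2 + t) = 1 / 12 - L.midline t := by
    rw [h.ofReal_midline]; ring
  convert! h4 using 1
  rw [h.g₂_eq, e]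
  have : (-(1 : ℂ) • (6 * (1 / 12 - (L.midline t : ℂ)) ^ 2 - (1 / 12 - 2 * c) / 2)) =
    ((L.midline t - c - 6 * L.midline t ^ 2 : ℝ) : ℂ) := by
    push_cast
    rw [smul_eq_mul]
    ring
  have h5 := congrArg Complex.re this
  simp only [Complex.ofReal_re] at h5
  rw [← h5]
  simp

theorem midlineDeriv_zero : L.midlineDeriv 0 = 0 := by
  have h1 := L.derivWeierstrassP_sub_coe (L.ω₂ / 2) ⟨L.ω₂, L.ω₂_mem_lattice⟩
  simp only at h1
  rw [show L.ω₂ / 2 - L.ω₂ = -(L.ω₂ / 2) by ring, L.derivWeierstrassP_neg] at h1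
  have : L.derivWeierstrassP (L.ω₂ / 2) = 0 := by linear_combination -h1 / 2
  simp [PeriodPair.midlineDeriv, this]

/-- `℘` is real on the imaginary axis and tends to `-∞` at `0`. -/
theorem one_ninth_lt_midline_zero (h : IsPeriodPairOf c L) (hc : c ∈ Set.Ioo (0 : ℝ) (1 / 27)) :
    1 / 9 < L.midline 0 := by
  set S := L.ω₂.im / 2 with hS
  have hS0 : 0 < S := half_pos h.im_two
  let f : ℝ → ℝ := fun s => (1 / 12 - L.weierstrassP (s * Complex.I)).re
  have hreal : ∀ s : ℝ, (f s : ℂ) = 1 / 12 - L.weierstrassP (s * Complex.I) := by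
    intro s
    refine Complex.conj_eq_iff_re.1 ?_
    rw [map_sub, ← h.isRectangular.weierstrassP_conj]
    simp [Complex.conj_ofNat]
  have hnot : ∀ s : ℝ, 0 < s → s ≤ S → (s * Complex.I : ℂ) ∉ L.lattice := by
    intro s h0 h1
    apply h.im_notMem
    · simpa using h0
    · simp; linarith
  have hder : ∀ s : ℝ, 0 < s → s ≤ S →
      HasDerivAt (fun s : ℝ => (f s : ℂ)) (-(Complex.I * L.derivWeierstrassP (s * Complex.I))) s := by
    intro s h0 h1
    have h2 : HasDerivAt (fun t : ℝ => (t : ℂ) * Complex.I) Complex.I s := by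
      simpa using (Complex.ofRealCLM.hasDerivAt (x := s)).mul_const Complex.I
    have h3 := ((L.hasDerivAt_weierstrassP (hnot s h0 h1)).scomp s h2).const_sub (1 / 12)
    simp only [hreal]
    simpa using! h3
  -- On the imaginary axis f is real with derivative -i℘', so ℘'² = -f'² ≤ 0.
  have hineq : ∀ s : ℝ, 0 < s → s ≤ S → (f s - c) ^ 2 - 4 * f s ^ 3 ≤ 0 := by
    intro s h0 h1
    have h2 := hder s h0 h1
    have h3 : HasDerivAt f (-(Complex.I * L.derivWeierstrassP (s * Complex.I))).re s := by
      simpa using! Complex.reCLM.hasFDerivAt.comp_hasDerivAt s h2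
    have h4 := h3.ofReal_comp.unique h2
    have h5 := h.derivWeierstrassP_sq (hnot s h0 h1)
    rw [← hreal] at h5
    set r := (-(Complex.I * L.derivWeierstrassP (s * Complex.I))).re
    have h6 : (-(r ^ 2) : ℂ) = (f s - c) ^ 2 - 4 * f s ^ 3 := by
      rw [← h5, h4]
      linear_combination (-L.derivWeierstrassP (s * Complex.I) ^ 2) * Complex.I_sq
    have h7 : -(r ^ 2) = (f s - c) ^ 2 - 4 * f s ^ 3 := by exact_mod_cast h6
    rw [← h7]
    linarith [sq_nonneg r]
  have hfS : f S = L.midline 0 := by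
    simp only [f, PeriodPair.midline]
    rw [h.ω₂_eq, hS]
    push_cast
    ring_nf
  have hcont : ContinuousOn f (Set.Ioc 0 S) := fun s hs => by
    have h3 : HasDerivAt f (-(Complex.I * L.derivWeierstrassP (s * Complex.I))).re s := by
      simpa using! Complex.reCLM.hasFDerivAt.comp_hasDerivAt s (hder s hs.1 hs.2)
    exact h3.continuousAt.continuousWithinAt
  have htend : Tendsto f (𝓝[>] 0) atTop := by
    have h1 : Tendsto (fun s : ℝ => (s * Complex.I : ℂ)) (𝓝[>] 0) (𝓝[≠] 0) := by
      refine tendsto_nhdsWithin_iff.2 ⟨?_, ?_⟩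
      · have : Continuous fun s : ℝ => (s * Complex.I : ℂ) := by fun_prop
        simpa using (this.tendsto 0).mono_left (nhdsWithin_le_nhds (s := Set.Ioi 0))
      · filter_upwards [self_mem_nhdsWithin] with s hs
        have hs' : s ≠ 0 := ne_of_gt hs
        simpa using hs'
    have h2 := (Complex.continuous_re.tendsto _).comp (L.tendsto_sq_mul_weierstrassP.comp h1)
    have h3 : Tendsto (fun s : ℝ => (s ^ 2)⁻¹) (𝓝[>] 0) atTop := by
      have : Tendsto (fun s : ℝ => s ^ 2) (𝓝[>] 0) (𝓝[>] 0) := by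
        refine tendsto_nhdsWithin_iff.2 ⟨?_, ?_⟩
        · have : Continuous fun s : ℝ => s ^ 2 := by fun_prop
          simpa using (this.tendsto 0).mono_left (nhdsWithin_le_nhds (s := Set.Ioi 0))
        · filter_upwards [self_mem_nhdsWithin] with s hs
          exact pow_pos (Set.mem_Ioi.1 hs) 2
      exact this.inv_tendsto_nhdsGT_zero
    have h4 := tendsto_atTop_add_const_left _ (1 / 12) (h3.atTop_mul_pos one_pos (by simpa using h2))
    refine h4.congr' ?_
    filter_upwards [self_mem_nhdsWithin] with s hs
    have hs' : s ≠ 0 := ne_of_gt hs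
    have e : (((s * Complex.I) ^ 2 * L.weierstrassP (s * Complex.I) : ℂ)).re =
        -(s ^ 2 * (L.weierstrassP (s * Complex.I)).re) := by
      rw [mul_pow, Complex.I_sq, show ((s : ℂ) ^ 2 * -1 * L.weierstrassP (s * Complex.I)) =
        ((-s ^ 2 : ℝ) : ℂ) * L.weierstrassP (s * Complex.I) by push_cast; ring, Complex.re_ofReal_mul]
      ring
    simp only [Function.comp_apply, e, f]
    rw [mul_neg, inv_mul_cancel_left₀ (pow_ne_zero 2 hs')]
    simp [sub_eq_add_neg]
  -- At u = 1/9 the cubic expression exceeds (1/9 - 1/27)² - 4/729 = 0 when c < 1/27, contradicting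
  -- `hineq`. So f, which tends to +∞ at 0, cannot come down to 1/9.
  by_contra hle
  push Not at hle
  rw [← hfS] at hle
  obtain ⟨s, hs1, hs2⟩ := ((htend.eventually_ge_atTop (1 / 9)).and
    (Ioc_mem_nhdsGT hS0)).exists
  obtain ⟨r, hr, hr9⟩ := intermediate_value_Icc' hs2.2
    (hcont.mono fun x hx => ⟨hs2.1.trans_le hx.1, hx.2⟩) ⟨hle, hs1⟩
  have := hineq r (hs2.1.trans_le hr.1) hr.2
  rw [hr9] at this
  nlinarith [hc.1, hc.2]

/-- The parameter `q` of the initial point `(q, q, 1 - 2q)`. -/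
noncomputable def _root_.PeriodPair.initParam (L : PeriodPair) : ℝ := √(L.midline 0)

/-- At a half period ℘' = 0, so (q² - c)² = 4q⁶ for q² = u. The bound q > 1/3 from
`one_ninth_lt_midline_zero` excludes the root q² - c = -2q³. -/
theorem initParam_spec (h : IsPeriodPairOf c L) (hc : c ∈ Set.Ioo (0 : ℝ) (1 / 27)) :
    1 / 3 < L.initParam ∧ L.midline 0 = L.initParam ^ 2 ∧
      c = L.initParam ^ 2 * (1 - 2 * L.initParam) := by
  have h1 := h.one_ninth_lt_midline_zero hc
  have h2 : L.midline 0 = L.initParam ^ 2 := (Real.sq_sqrt (by linarith)).symm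
  have h0 : 0 ≤ L.initParam := Real.sqrt_nonneg _
  have h3 : 1 / 3 < L.initParam := by
    rw [PeriodPair.initParam, Real.lt_sqrt (by norm_num)]; linarith
  refine ⟨h3, h2, ?_⟩
  have h4 := h.midlineDeriv_sq 0
  rw [midlineDeriv_zero, h2] at h4
  set q := L.initParam
  have h5 : (q ^ 2 - c - 2 * q ^ 3) * (q ^ 2 - c + 2 * q ^ 3) = 0 := by linear_combination -h4
  have h6 : 0 < q ^ 2 - c + 2 * q ^ 3 := by
    have := hc.2
    have : 0 < q ^ 3 := by positivity
    nlinarith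
  have h7 := (mul_eq_zero.1 h5).resolve_right h6.ne'
  linear_combination -h7

/-- The value u = c is impossible, since it would give u'² = -4c³ < 0; continuity then keeps u on
the side of u(0). -/
theorem lt_midline (h : IsPeriodPairOf c L) (hc : c ∈ Set.Ioo (0 : ℝ) (1 / 27)) (t : ℝ) :
    c < L.midline t := by
  by_contra hle
  push Not at hle
  have hcont : Continuous L.midline :=
    continuous_iff_continuousAt.2 fun t => (h.hasDerivAt_midline t).continuousAt
  have h0 : c ≤ L.midline 0 := by linarith [h.one_ninth_lt_midline_zero hc, hc.2]
  obtain ⟨s, hs⟩ := mem_range_of_exists_le_of_exists_ge hcont ⟨t, hle⟩ ⟨0, h0⟩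
  have := h.midlineDeriv_sq s
  rw [hs] at this
  have h1 := pow_pos hc.1 3
  nlinarith [sq_nonneg (L.midlineDeriv s)]

/-- The solution `(y¹, y², y³)` with `y³ = c / (1/12 - ℘(ω₂/2 + t))`. -/
noncomputable def _root_.PeriodPair.solution (c : ℝ) (L : PeriodPair) (t : ℝ) : Fin 3 → ℝ :=
  ![(L.midline t - c - L.midlineDeriv t) / (2 * L.midline t),
    (L.midline t - c + L.midlineDeriv t) / (2 * L.midline t), c / L.midline t]

/-- Here y¹ and y² are the roots of T² - (1 - c/u)T + u, separated by u' = u(y² - y¹). Positivity is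
|u'| < u - c, read off from the cubic relation. -/
theorem isVolterra_solution (h : IsPeriodPairOf c L) (hc : c ∈ Set.Ioo (0 : ℝ) (1 / 27)) :
    IsVolterra c (L.solution c) where
  hasDerivAt t := by
    have h1 := h.hasDerivAt_midline t
    have h2 := h.hasDerivAt_midlineDeriv t
    have h3 := h.midlineDeriv_sq t
    have h0 : L.midline t ≠ 0 := (hc.1.trans (h.lt_midline hc t)).ne'
    rw [hasDerivAt_pi]
    intro k
    fin_cases k
    · convert! ((h1.sub_const c).sub h2).div (h1.const_mul 2) (by simpa using h0) using 1
      simp [volterra, PeriodPair.solution]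
      field_simp
      linear_combination (-3 : ℝ) * h3
    · convert! ((h1.sub_const c).add h2).div (h1.const_mul 2) (by simpa using h0) using 1
      simp [volterra, PeriodPair.solution]
      field_simp
      linear_combination (3 : ℝ) * h3
    · convert! (hasDerivAt_const t c).div h1 h0 using 1
      simp [volterra, PeriodPair.solution]
      field_simp
      ring
  pos t := by
    have h0 := h.lt_midline hc t
    have hc0 := hc.1
    have h3 := h.midlineDeriv_sq t
    have h4 : |L.midlineDeriv t| < L.midline t - c := by
      refine abs_lt_of_sq_lt_sq ?_ (by linarith)
      have : 0 < L.midline t ^ 3 := pow_pos (hc0.trans h0) 3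
      linarith
    obtain ⟨h5, h6⟩ := abs_lt.1 h4
    intro k
    fin_cases k <;> simp [PeriodPair.solution] <;> apply div_pos <;> linarith
  sum t := by
    have h0 : L.midline t ≠ 0 := (hc.1.trans (h.lt_midline hc t)).ne'
    simp [PeriodPair.solution]
    field_simp
    ring
  prod t := by
    have h0 : L.midline t ≠ 0 := (hc.1.trans (h.lt_midline hc t)).ne'
    have h3 := h.midlineDeriv_sq t
    simp [PeriodPair.solution]
    field_simp
    linear_combination (-c) * h3

theorem isVolterraFrom_solution (h : IsPeriodPairOf c L) (hc : c ∈ Set.Ioo (0 : ℝ) (1 / 27)) :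
    IsVolterraFrom c L.initParam (L.solution c) where
  toIsVolterra := h.isVolterra_solution hc
  init_zero := by
    obtain ⟨h1, h2, h3⟩ := h.initParam_spec hc
    have h0 : L.initParam ≠ 0 := by linarith
    simp only [PeriodPair.solution, midlineDeriv_zero, h2, Matrix.cons_val_zero]
    field_simp
    linear_combination -h3
  init_one := by
    obtain ⟨h1, h2, h3⟩ := h.initParam_spec hc
    have h0 : L.initParam ≠ 0 := by linarith
    simp only [PeriodPair.solution, midlineDeriv_zero, h2, Matrix.cons_val_one, Matrix.cons_val_zero]
    field_simp
    linear_combination -h3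
  lt := (h.initParam_spec hc).1

theorem half_add_period (h : IsPeriodPairOf c L) (t : ℝ) :
    L.ω₂ / 2 + ((t + L.ω₁.re : ℝ) : ℂ) = L.ω₂ / 2 + t + L.ω₁ := by
  rw [Complex.ofReal_add, ← h.ω₁_eq, add_assoc]

theorem midline_add (h : IsPeriodPairOf c L) (t : ℝ) : L.midline (t + L.ω₁.re) = L.midline t := by
  have := L.weierstrassP_add_coe (L.ω₂ / 2 + t) ⟨L.ω₁, L.ω₁_mem_lattice⟩
  rw [PeriodPair.midline, PeriodPair.midline, h.half_add_period, this]

theorem midlineDeriv_add (h : IsPeriodPairOf c L) (t : ℝ) :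
    L.midlineDeriv (t + L.ω₁.re) = L.midlineDeriv t := by
  have := L.derivWeierstrassP_add_coe (L.ω₂ / 2 + t) ⟨L.ω₁, L.ω₁_mem_lattice⟩
  rw [PeriodPair.midlineDeriv, PeriodPair.midlineDeriv, h.half_add_period, this]

theorem solution_add (h : IsPeriodPairOf c L) (t : ℝ) :
    L.solution c (t + L.ω₁.re) = L.solution c t := by
  simp [PeriodPair.solution, h.midline_add, h.midlineDeriv_add]

/-- The full period ω₁ is at least 6τ, the first return time of y³. Conversely 6τ is a period of ℘
along the line, hence a lattice vector, and a positive real lattice vector is at least ω₁. -/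
theorem isFirstMeeting (h : IsPeriodPairOf c L) (hc : c ∈ Set.Ioo (0 : ℝ) (1 / 27)) :
    IsFirstMeeting (L.solution c) (L.ω₁.re / 6) := by
  have hV := h.isVolterraFrom_solution hc
  have hp := h.solution_add 0
  rw [zero_add] at hp
  obtain ⟨τ, hτ⟩ := hV.exists_isFirstMeeting h.re_one (by rw [hp])
  have h1 : 6 * τ ≤ L.ω₁.re := by
    by_contra hlt
    push Not at hlt
    exact hV.two_ne_of_lt hτ h.re_one hlt (by rw [hp])
  have hper : ∀ t : ℝ, L.midline (t + 6 * τ) = L.midline t := by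
    intro t
    have h2 := congrFun (hV.add_six_mul hτ.eq t) 2
    simp only [PeriodPair.solution, Matrix.cons_val] at h2
    have := (hc.1.trans (h.lt_midline hc t)).ne'
    have := (hc.1.trans (h.lt_midline hc (t + 6 * τ))).ne'
    have := hc.1.ne'
    field_simp at h2
    exact h2.symm
  have h2 : ((6 * τ : ℝ) : ℂ) ∈ L.lattice := by
    refine L.mem_lattice_of_translate (z₀ := L.ω₂ / 2 + (0 : ℝ)) (h.half_add_notMem 0) ?_ ?_
    · rw [add_assoc, ← Complex.ofReal_add]; exact h.half_add_notMem _
    · have ht : Tendsto (fun t : ℝ => L.ω₂ / 2 + (t : ℂ)) (𝓝[≠] 0) (𝓝[≠] (L.ω₂ / 2 + (0 : ℝ))) := by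
        refine tendsto_nhdsWithin_iff.2 ⟨?_, ?_⟩
        · have : Continuous fun t : ℝ => L.ω₂ / 2 + (t : ℂ) := by fun_prop
          exact (this.tendsto 0).mono_left nhdsWithin_le_nhds
        · filter_upwards [self_mem_nhdsWithin] with s hs
          simpa using hs
      refine ht.frequently (Eventually.frequently (Eventually.of_forall fun t => ?_))
      have e1 := h.ofReal_midline t
      have e2 := h.ofReal_midline (t + 6 * τ)
      rw [hper, e1] at e2
      rw [add_assoc, ← Complex.ofReal_add]
      linear_combination e2
  obtain ⟨m, n, h3, -⟩ := (h.isRectangular.mem_iff _).1 h2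
  have h4 := PeriodPair.exists_nat_mul_of_int_mul (by simpa using hτ.pos) h.re_one h3
  simp only [Complex.ofReal_re] at h4
  have : τ = L.ω₁.re / 6 := by linarith
  rwa [← this]

end IsPeriodPairOf

/-! ### Dependence of the solution and of the periods on the level -/

/-- The solution attached to the level `c`, in the time variable of the flow. -/
noncomputable def levelSolution (c t : ℝ) : Fin 3 → ℝ := (periodsOf c).solution c t

/-- The primitive `ζ(ω₂ + t) - η₂ + t (1/12 - 3c)` of `y¹ y² - 3c`. -/
noncomputable def levelZeta (c t : ℝ) : ℝ :=
  (weierstrassZeta (periodsOf c) (omega2 c + t) - eta2 c + t * (1 / 12 - 3 * c)).re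

/-- The initial parameter of the solution on the level `c`. -/
noncomputable def levelParam (c : ℝ) : ℝ := (periodsOf c).initParam

section Level

variable {c : ℝ}

theorem omega1_eq (hc : c ∈ Set.Ioo (0 : ℝ) (1 / 27)) : (omega1 c : ℂ) = (periodsOf c).ω₁ / 2 := by
  rw [omega1, (isPeriodPairOf_periodsOf hc).ω₁_eq]; simp

theorem omega1_pos (hc : c ∈ Set.Ioo (0 : ℝ) (1 / 27)) : 0 < omega1 c :=
  half_pos (isPeriodPairOf_periodsOf hc).re_one

theorem isVolterraFrom_levelSolution (hc : c ∈ Set.Ioo (0 : ℝ) (1 / 27)) :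
    IsVolterraFrom c (levelParam c) (levelSolution c) :=
  (isPeriodPairOf_periodsOf hc).isVolterraFrom_solution hc

theorem isFirstMeeting_levelSolution (hc : c ∈ Set.Ioo (0 : ℝ) (1 / 27)) :
    IsFirstMeeting (levelSolution c) (omega1 c / 3) := by
  have := (isPeriodPairOf_periodsOf hc).isFirstMeeting hc
  rwa [show (periodsOf c).ω₁.re / 6 = omega1 c / 3 by rw [omega1]; ring] at this

theorem levelSolution_add (hc : c ∈ Set.Ioo (0 : ℝ) (1 / 27)) (t : ℝ) :
    levelSolution c (t + 2 * omega1 c) = levelSolution c t := by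
  rw [omega1, mul_div_cancel₀ _ two_ne_zero]
  exact (isPeriodPairOf_periodsOf hc).solution_add t

/-- A shift of s by 2π/3 is a time shift by 2ω₁/3, twice the first meeting time, and so advances the
index cyclically. All three formulas thus reduce to the one for y³. -/
theorem yCurve_eq (hc : c ∈ Set.Ioo (0 : ℝ) (1 / 27)) (k : Fin 3) (s : ℝ) :
    yCurve k c s = (levelSolution c (omega1 c * s / Real.pi) k : ℂ) := by
  have hP := isPeriodPairOf_periodsOf hc
  have hV := isVolterraFrom_levelSolution hc
  have hτ := (isFirstMeeting_levelSolution hc).eq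
  have e : ∀ t : ℝ, levelSolution c t 2 = c / (periodsOf c).midline t := fun t => rfl
  have e2 : ((omega1 c / Real.pi * (s + 2 * Real.pi * ((k : ℕ) + 1) / 3) : ℝ) : ℂ) =
      omega1 c / Real.pi * (s + 2 * Real.pi * ((k : ℕ) + 1) / 3) := by push_cast; rfl
  have e3 : omega1 c / Real.pi * (s + 2 * Real.pi * ((k : ℕ) + 1) / 3) =
      omega1 c * s / Real.pi + ((k : ℕ) + 1) * (2 * (omega1 c / 3)) := by
    field_simp
  rw [yCurve, ← e2, omega2, ← hP.ofReal_midline, ← Complex.ofReal_div, ← e, e3]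
  congr 1
  set t := omega1 c * s / Real.pi
  have h1 := fun t => hV.add_two_mul hτ t
  fin_cases k
  · simp [h1]
  · simp
    rw [show t + (1 + 1) * (2 * (omega1 c / 3)) = t + 2 * (omega1 c / 3) + 2 * (omega1 c / 3) by ring,
      h1, h1]
    rfl
  · simp
    rw [show t + (2 + 1) * (2 * (omega1 c / 3)) = t + 6 * (omega1 c / 3) by ring,
      hV.add_six_mul hτ]

theorem zeta_omega1_im (hc : c ∈ Set.Ioo (0 : ℝ) (1 / 27)) :
    (weierstrassZeta (periodsOf c) (omega1 c)).im = 0 := by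
  have hP := isPeriodPairOf_periodsOf hc
  rw [← Complex.conj_eq_iff_im, ← hP.isRectangular.weierstrassZeta_conj, Complex.conj_ofReal]

theorem ofReal_eta1 (hc : c ∈ Set.Ioo (0 : ℝ) (1 / 27)) :
    (eta1 c : ℂ) = weierstrassZeta (periodsOf c) (omega1 c) := by
  apply Complex.ext <;> simp [eta1, zeta_omega1_im hc]

/-- Conjugation changes the argument by the full period ω₂ and ζ by 2η₂, while η₂ is imaginary; the
two effects cancel after subtracting η₂. -/
theorem ofReal_levelZeta (hc : c ∈ Set.Ioo (0 : ℝ) (1 / 27)) (t : ℝ) :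
    (levelZeta c t : ℂ) =
      weierstrassZeta (periodsOf c) (omega2 c + t) - eta2 c + t * (1 / 12 - 3 * c) := by
  have hP := isPeriodPairOf_periodsOf hc
  set L := periodsOf c with hL
  refine Complex.conj_eq_iff_re.1 ?_
  have hl : (⟨L.ω₂, L.ω₂_mem_lattice⟩ : L.lattice) = L.ω₂ := rfl
  have h1 := L.weierstrassZeta_add ⟨L.ω₂, L.ω₂_mem_lattice⟩ L.ω₂_div_two_notMem_lattice
    (z := conj (L.ω₂ / 2 + t)) (fun hm => hP.half_add_notMem t (by
      simpa using hP.isRectangular.conj_mem hm))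
  rw [hP.conj_half, sub_add_cancel, ← hP.conj_half] at h1
  have h2 : conj (eta2 c) = - eta2 c := by
    rw [eta2, ← hP.isRectangular.weierstrassZeta_conj, ← L.weierstrassZeta_neg]
    congr 1
    rw [omega2]
    apply Complex.ext
    · simp [hP.re_two, ← hL, Complex.conj_ofNat]
    · simp [← hL, Complex.conj_ofNat]
      ring
  rw [map_add, map_sub, h2, ← hP.isRectangular.weierstrassZeta_conj]
  rw [hl] at h1
  simp only [omega2, eta2, ← hL] at h1 ⊢
  rw [h1]
  simp [Complex.conj_ofNat]
  ring

theorem levelZeta_zero : levelZeta c 0 = 0 := by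
  simp [levelZeta, eta2]

theorem levelZeta_period (hc : c ∈ Set.Ioo (0 : ℝ) (1 / 27)) :
    levelZeta c (2 * omega1 c) = 2 * etaTilde1 c := by
  have hP := isPeriodPairOf_periodsOf hc
  have h1 := (periodsOf c).weierstrassZeta_add ⟨_, (periodsOf c).ω₁_mem_lattice⟩
    (periodsOf c).ω₁_div_two_notMem_lattice (hP.half_add_notMem 0)
  simp only [← omega1_eq hc, ← ofReal_eta1 hc, Complex.ofReal_zero, add_zero] at h1
  have h2 := ofReal_levelZeta hc (2 * omega1 c)
  have h3 : omega2 c + ((2 * omega1 c : ℝ) : ℂ) = (periodsOf c).ω₂ / 2 + (periodsOf c).ω₁ := by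
    push_cast
    rw [omega1_eq hc, omega2]; ring
  rw [h3, h1] at h2
  have h4 : (levelZeta c (2 * omega1 c) : ℂ) = (2 * etaTilde1 c : ℝ) := by
    rw [h2, etaTilde1, eta2, omega2]; push_cast; ring
  exact_mod_cast h4

theorem varsigma_eq (hc : c ∈ Set.Ioo (0 : ℝ) (1 / 27)) (s : ℝ) :
    varsigma c s = ((levelZeta c (omega1 c * s / Real.pi) - s / Real.pi * etaTilde1 c : ℝ) : ℂ) := by
  have h := ofReal_levelZeta hc (omega1 c * s / Real.pi)
  push_cast
  rw [h, varsigma, etaTilde1]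
  push_cast
  rw [show (s : ℂ) * omega1 c / Real.pi = omega1 c * s / Real.pi by ring]
  ring

theorem hasDerivAt_levelZeta (hc : c ∈ Set.Ioo (0 : ℝ) (1 / 27)) (t : ℝ) :
    HasDerivAt (levelZeta c) (levelSolution c t 0 * levelSolution c t 1 - 3 * c) t := by
  have hP := isPeriodPairOf_periodsOf hc
  have h1 := (periodsOf c).hasDerivAt_weierstrassZeta (hP.half_add_notMem t)
  have h2 : HasDerivAt (fun t : ℝ => (periodsOf c).ω₂ / 2 + (t : ℂ)) 1 t :=
    (Complex.ofRealCLM.hasDerivAt (x := t)).const_add _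
  have h3 : HasDerivAt (fun t : ℝ => (t : ℂ) * (1 / 12 - 3 * c)) (1 * (1 / 12 - 3 * c)) t :=
    (Complex.ofRealCLM.hasDerivAt (x := t)).mul_const _
  have h4 := ((h1.scomp t h2).sub_const (eta2 c)).add h3
  have h5 := Complex.reCLM.hasFDerivAt.comp_hasDerivAt t h4
  convert! h5 using 1
  have hV := hP.isVolterra_solution hc
  have h0 := hP.lt_midline hc t
  have e1 : levelSolution c t 0 * levelSolution c t 1 = (periodsOf c).midline t := by
    have p := hV.prod t
    have e2 : (periodsOf c).solution c t 2 = c / (periodsOf c).midline t := rfl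
    rw [e2] at p
    have h0' : (periodsOf c).midline t ≠ 0 := (hc.1.trans h0).ne'
    have := hc.1.ne'
    field_simp at p
    rw [levelSolution]
    exact p
  have e3 : (periodsOf c).weierstrassP ((periodsOf c).ω₂ / 2 + t) =
      1 / 12 - (periodsOf c).midline t := by rw [hP.ofReal_midline]; ring
  rw [e1, e3]
  have : ((1 : ℂ) • -(1 / 12 - ((periodsOf c).midline t : ℂ)) + 1 * (1 / 12 - 3 * c)) =
      (((periodsOf c).midline t - 3 * c : ℝ) : ℂ) := by push_cast; rw [smul_eq_mul]; ring
  have h6 := congrArg Complex.re this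
  rw [Complex.ofReal_re] at h6
  rw [← h6]
  simp

theorem Ioo_mem (hc : c ∈ Set.Ioo (0 : ℝ) (1 / 27)) : Set.Ioo (0 : ℝ) (1 / 27) ∈ 𝓝 c :=
  isOpen_Ioo.mem_nhds hc

/-- The parameter is a root of q²(1 - 2q) = c above 1/3, where this cubic is strictly monotone. It
therefore agrees near c with the local inverse of the cubic. -/
theorem hasDerivAt_levelParam (hc : c ∈ Set.Ioo (0 : ℝ) (1 / 27)) :
    HasDerivAt levelParam (2 * levelParam c * (1 - 3 * levelParam c))⁻¹ c := by
  set q := levelParam c with hq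
  have h3 := (isVolterraFrom_levelSolution hc).lt
  have hne : 2 * q * (1 - 3 * q) ≠ 0 := mul_ne_zero (by linarith) (by linarith)
  have hf : HasStrictDerivAt (fun x : ℝ => x ^ 2 * (1 - 2 * x)) (2 * q * (1 - 3 * q)) q := by
    have h1 : HasStrictDerivAt (fun x : ℝ => 1 - 2 * x) (-(2 * 1)) q :=
      ((hasStrictDerivAt_id q).const_mul 2).const_sub 1
    have := ((hasStrictDerivAt_id q).pow 2).mul h1
    convert! this using 1
    simp
    ring
  have hfc : q ^ 2 * (1 - 2 * q) = c :=
    (isVolterraFrom_levelSolution hc).level.symm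
  have hg := hf.to_localInverse hne
  rw [hfc] at hg
  refine hg.hasDerivAt.congr_of_eventuallyEq ?_
  have hright := hf.eventually_right_inverse hne
  have hcont := hg.hasDerivAt.continuousAt
  rw [hfc] at hright
  have hval : HasStrictDerivAt.localInverse _ _ q hf hne c = q := by
    exact (congrArg _ hfc.symm).trans (hf.eventually_left_inverse hne).self_of_nhds
  have hgt : ∀ᶠ x in 𝓝 c, 1 / 3 < HasStrictDerivAt.localInverse _ _ q hf hne x := by
    refine hcont.eventually_const_lt ?_
    rw [hval]; exact h3
  filter_upwards [hright, hgt, Ioo_mem hc] with x h4 h5 hx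
  have h6 := (isVolterraFrom_levelSolution hx).level
  have h7 := (isVolterraFrom_levelSolution hx).lt
  set g := HasStrictDerivAt.localInverse _ _ q hf hne x
  set p := levelParam x
  have h8 : (p - g) * ((p + g) - 2 * (p ^ 2 + p * g + g ^ 2)) = 0 := by
    linear_combination -h6 - h4
  have h9 : (p + g) - 2 * (p ^ 2 + p * g + g ^ 2) < 0 := by nlinarith
  linarith [(mul_eq_zero.1 h8).resolve_right h9.ne]

theorem levelSolution_zero (hc : c ∈ Set.Ioo (0 : ℝ) (1 / 27)) :
    levelSolution c 0 = ![levelParam c, levelParam c, 1 - 2 * levelParam c] := by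
  have h := isVolterraFrom_levelSolution hc
  ext k
  fin_cases k
  · exact h.init_zero
  · exact h.init_one
  · exact h.init_two

theorem hasDerivAt_levelSolution_zero (hc : c ∈ Set.Ioo (0 : ℝ) (1 / 27)) :
    HasDerivAt (fun c => levelSolution c 0)
      (IsVolterra.variation c (levelSolution c 0) (levelZeta c 0)) c := by
  have h := isVolterraFrom_levelSolution hc
  have hd := hasDerivAt_levelParam hc
  have h3 := h.lt
  have h4 := h.lt_half
  have e : (fun c => levelSolution c 0) =ᶠ[𝓝 c]
      fun c => ![levelParam c, levelParam c, 1 - 2 * levelParam c] := by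
    filter_upwards [Ioo_mem hc] with x hx using levelSolution_zero hx
  refine HasDerivAt.congr_of_eventuallyEq ?_ e
  rw [levelZeta_zero, levelSolution_zero hc]
  have hl := h.level
  set q := levelParam c
  have n1 : q ≠ 0 := by linarith
  have n2 : 1 - 2 * q ≠ 0 := by linarith
  have n3 : 1 - 3 * q ≠ 0 := by linarith
  have n4 : 1 + 6 * q ≠ 0 := by linarith
  -- The square of 1 - 3q reflects that q = 1/3 is a critical point of q²(1 - 2q), with critical
  -- value 1/27.
  have hD : 4 * c * (1 - 27 * c) = 4 * (q ^ 2 * (1 - 2 * q)) * ((1 - 3 * q) ^ 2 * (1 + 6 * q)) := by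
    rw [hl]; ring
  rw [hasDerivAt_pi]
  intro k
  fin_cases k
  · convert! hd using 1
    simp only [IsVolterra.variation]
    rw [hD]
    simp
    grind
  · convert! hd using 1
    simp only [IsVolterra.variation]
    rw [hD]
    simp
    grind
  · convert! (hd.const_mul 2).const_sub 1 using 1
    simp only [IsVolterra.variation]
    rw [hD]
    simp
    grind

theorem hasFDerivAt_levelSolution (hc : c ∈ Set.Ioo (0 : ℝ) (1 / 27)) (t : ℝ) :
    HasFDerivAt (fun p : ℝ × ℝ => levelSolution p.1 p.2)
      ((ContinuousLinearMap.fst ℝ ℝ ℝ).smulRight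
          (IsVolterra.variation c (levelSolution c t) (levelZeta c t)) +
        (ContinuousLinearMap.snd ℝ ℝ ℝ).smulRight (volterra (levelSolution c t))) (c, t) :=
  IsVolterra.hasFDerivAt_family (v := fun t => IsVolterra.variation c (levelSolution c t) (levelZeta c t))
    (by filter_upwards [Ioo_mem hc] with x hx using (isVolterraFrom_levelSolution hx).toIsVolterra)
    ((isVolterraFrom_levelSolution hc).toIsVolterra.hasDerivAt_variation (hasDerivAt_levelZeta hc))
    (hasDerivAt_levelSolution_zero hc) t

/-- Continuity comes from the characterization as three times the first meeting time; the implicit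
differentiation of ω₁ relies on it. -/
theorem continuousAt_omega1 (hc : c ∈ Set.Ioo (0 : ℝ) (1 / 27)) : ContinuousAt omega1 c := by
  have := continuousAt_firstMeeting (y := levelSolution) (q := levelParam)
    (τ := fun c => omega1 c / 3)
    (by filter_upwards [Ioo_mem hc] with x hx using isVolterraFrom_levelSolution hx)
    (by filter_upwards [Ioo_mem hc] with x hx using isFirstMeeting_levelSolution hx)
    (hasDerivAt_levelSolution_zero hc).continuousAt
  have h2 := this.const_mul (3 : ℝ)
  refine h2.congr (Eventually.of_forall fun x => ?_)
  ring

end Level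

/-- Derivative of a continuous function defined implicitly by `G (x, w x) = const`. -/
theorem hasDerivAt_of_implicit {G : ℝ × ℝ → ℝ} {w : ℝ → ℝ} {a b c : ℝ}
    (hG : HasFDerivAt G ((ContinuousLinearMap.fst ℝ ℝ ℝ).smulRight a +
      (ContinuousLinearMap.snd ℝ ℝ ℝ).smulRight b) (c, w c)) (hb : b ≠ 0)
    (hw : ContinuousAt w c) (h : ∀ᶠ x in 𝓝 c, G (x, w x) = G (c, w c)) :
    HasDerivAt w (-a / b) c := by
  rw [hasDerivAt_iff_isLittleO, Asymptotics.isLittleO_iff]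
  intro ε hε
  have hlim : Tendsto (fun x => (x, w x)) (𝓝 c) (𝓝 (c, w c)) :=
    (continuousAt_id.prodMk hw).tendsto
  set k := |a / b| with hk
  have hk0 : 0 ≤ k := abs_nonneg _
  -- The bound δ ≤ 1/2 lets the error |e| be absorbed on the left; the other bound makes what
  -- remains at most ε|x - c|.
  set δ := min (1 / 2) (ε / (2 * (1 + k))) with hδ
  have hδ0 : 0 < δ := by positivity
  have hδ1 : δ ≤ 1 / 2 := min_le_left _ _
  have hδ2 : δ * (2 * (1 + k)) ≤ ε := by
    rw [← le_div_iff₀ (by positivity)]; exact min_le_right _ _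
  have h1 := (hasFDerivAt_iff_isLittleO.1 hG).def (c := δ * |b|) (by positivity)
  filter_upwards [hlim.eventually h1, h] with x hx h2
  rw [h2] at hx
  simp only [sub_self, zero_sub, norm_neg, Prod.mk_sub_mk] at hx
  simp only [smul_eq_mul, Real.norm_eq_abs] at hx ⊢
  have e1 : ((ContinuousLinearMap.fst ℝ ℝ ℝ).smulRight a +
      (ContinuousLinearMap.snd ℝ ℝ ℝ).smulRight b) (x - c, w x - w c) =
      b * (w x - w c - (x - c) * (-a / b)) := by
    simp
    field_simp
    ring
  rw [e1, abs_mul, mul_comm δ, mul_assoc] at hx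
  have hx' := le_of_mul_le_mul_left hx (abs_pos.2 hb)
  set e := w x - w c - (x - c) * (-a / b)
  have e2 : |w x - w c| ≤ |e| + |x - c| * k := by
    have : w x - w c = e + (x - c) * (-a / b) := by ring
    rw [this]
    refine (abs_add_le _ _).trans ?_
    rw [abs_mul, neg_div, abs_neg]
  have e3 : ‖(x - c, w x - w c)‖ ≤ |e| + |x - c| * (1 + k) := by
    rw [Prod.norm_def]
    refine max_le ?_ ?_ <;> simp only [Real.norm_eq_abs]
    · nlinarith [abs_nonneg e, abs_nonneg (x - c), mul_nonneg (abs_nonneg (x - c)) hk0]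
    · linarith [abs_nonneg (x - c)]
  have e4 : |e| ≤ δ * (|e| + |x - c| * (1 + k)) := hx'.trans (by gcongr)
  have e5 : δ * |e| ≤ 1 / 2 * |e| := by gcongr
  have e6 : δ * (2 * (1 + k)) * |x - c| ≤ ε * |x - c| := by gcongr
  nlinarith

section Level

variable {c : ℝ}

/-- Differentiate y¹(c, 2ω₁) = y¹(c, 0). The variations at the two ends differ only through the
increment 2η̃₁ of the ζ-primitive, and this difference is 6η̃₁/(c(1 - 27c)) times the velocity,
which cancels. -/
theorem hasDerivAt_omega1 (hc : c ∈ Set.Ioo (0 : ℝ) (1 / 27)) :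
    HasDerivAt omega1 (-(3 * etaTilde1 c) / (c * (1 - 27 * c))) c := by
  have hV := isVolterraFrom_levelSolution hc
  have h1 := hasFDerivAt_pi'.1 (hasFDerivAt_levelSolution hc (2 * omega1 c)) 0
  have h2 := HasDerivAt.comp_hasFDerivAt (h₂ := fun x => levelSolution x 0 0) (c, 2 * omega1 c)
    ((hasDerivAt_pi.1 (hasDerivAt_levelSolution_zero hc)) 0)
    (hasFDerivAt_fst (𝕜 := ℝ) (E := ℝ) (F := ℝ))
  have e : levelSolution c (2 * omega1 c) = levelSolution c 0 := by
    simpa using levelSolution_add hc 0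
  have hG := h1.sub h2
  rw [e, levelZeta_period hc, levelZeta_zero] at hG
  set y := levelSolution c 0
  set v := IsVolterra.variation c y (2 * etaTilde1 c) 0 - IsVolterra.variation c y 0 0 with hv
  -- The component y¹ is used because its initial velocity q(3q - 1) is nonzero, whereas that of y³
  -- vanishes.
  have hb : volterra y 0 ≠ 0 := by
    simp only [volterra, zero_add]
    have h3 := hV.lt
    simp only [y, hV.init_zero, hV.init_one, hV.init_two]
    refine mul_ne_zero (by linarith) (by linarith)
  have hG' : HasFDerivAt (fun p : ℝ × ℝ => levelSolution p.1 p.2 0 - levelSolution p.1 0 0)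
      ((ContinuousLinearMap.fst ℝ ℝ ℝ).smulRight v +
        (ContinuousLinearMap.snd ℝ ℝ ℝ).smulRight (volterra y 0)) (c, 2 * omega1 c) := by
    convert! hG using 1
    ext <;> simp [hv]
  have h5 := hasDerivAt_of_implicit (w := fun c => 2 * omega1 c) hG' hb
    ((continuousAt_omega1 hc).const_mul 2) (by
      filter_upwards [Ioo_mem hc] with x hx
      have e : ∀ x ∈ Set.Ioo (0 : ℝ) (1 / 27), levelSolution x (2 * omega1 x) =
        levelSolution x 0 := fun x hx => by simpa using levelSolution_add hx 0
      simp [e x hx, e c hc])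
  have h6 := h5.const_mul (1 / 2 : ℝ)
  convert! h6 using 1
  · ext x; ring
  · have hs := hV.sum 0
    have hv2 : v = 6 * etaTilde1 c / (c * (1 - 27 * c)) * volterra y 0 := by
      have hc0 : c ≠ 0 := hc.1.ne'
      have hD : 1 - 27 * c ≠ 0 := by have := hc.2; linarith
      have e3 : y 2 = 1 - y 0 - y 1 := by linear_combination hs
      simp only [hv, IsVolterra.variation, volterra, zero_add, Matrix.cons_val_zero, e3]
      field_simp
      ring
    rw [hv2]
    field_simp
    ring

/-- The integrands y¹y² - 3c at nearby levels are uniformly close on bounded times by Gronwall, and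
all primitives vanish at t = 0. This feeds the continuity of `Jangle`. -/
theorem continuousAt_levelZeta (hc : c ∈ Set.Ioo (0 : ℝ) (1 / 27)) (t₀ : ℝ) :
    ContinuousAt (fun p : ℝ × ℝ => levelZeta p.1 p.2) (c, t₀) := by
  set T := |t₀| + 1 with hT
  let C : ℝ → ℝ := fun x =>
    2 * (‖levelSolution x 0 - levelSolution c 0‖ * Real.exp (8 * T)) + 3 * |x - c|
  have hC : Tendsto C (𝓝 c) (𝓝 0) := by
    have h1 := (hasDerivAt_levelSolution_zero hc).continuousAt
    have : ContinuousAt C c :=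
      (((h1.sub continuousAt_const).norm.mul continuousAt_const).const_mul 2).add
        ((continuousAt_id.sub continuousAt_const).abs.const_mul 3)
    simpa [C, ContinuousAt] using this
  have key : ∀ x ∈ Set.Ioo (0 : ℝ) (1 / 27), ∀ t ∈ Set.Icc (-T) T,
      ‖levelZeta x t - levelZeta c t‖ ≤ C x * T := by
    intro x hx t ht
    have hbound : ∀ u ∈ Set.Icc (-T) T, ‖(levelSolution x u 0 * levelSolution x u 1 - 3 * x) -
        (levelSolution c u 0 * levelSolution c u 1 - 3 * c)‖ ≤ C x := by
      intro u hu
      have hX := (isVolterraFrom_levelSolution hx).toIsVolterra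
      have hY := (isVolterraFrom_levelSolution hc).toIsVolterra
      have hd := hX.norm_sub_le hY (abs_le.2 hu)
      have hk := fun k => (norm_le_pi_norm (levelSolution x u - levelSolution c u) k).trans hd
      have h0 := hk 0
      have h1 := hk 1
      have b0 : ‖levelSolution x u 0‖ ≤ 1 := (norm_le_pi_norm _ 0).trans (hX.norm_le_one u)
      have b1 : ‖levelSolution c u 1‖ ≤ 1 := (norm_le_pi_norm _ 1).trans (hY.norm_le_one u)
      have e : (levelSolution x u 0 * levelSolution x u 1 - 3 * x) -
        (levelSolution c u 0 * levelSolution c u 1 - 3 * c) =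
        levelSolution x u 0 * (levelSolution x u - levelSolution c u) 1 +
        (levelSolution x u - levelSolution c u) 0 * levelSolution c u 1 - 3 * (x - c) := by
        simp; ring
      rw [e]
      refine (_root_.norm_sub_le _ _).trans (add_le_add ((norm_add_le _ _).trans ?_) ?_)
      · rw [norm_mul, norm_mul]
        set M := ‖levelSolution x 0 - levelSolution c 0‖ * Real.exp (8 * T)
        calc _ ≤ 1 * M + M * 1 := by gcongr
          _ = _ := by ring
      · simp
    have := (convex_Icc (-T) T).norm_image_sub_le_of_norm_hasDerivWithin_le
      (f := fun u => levelZeta x u - levelZeta c u) (x := 0) (y := t)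
      (fun u _ => ((hasDerivAt_levelZeta hx u).sub (hasDerivAt_levelZeta hc u)).hasDerivWithinAt)
      hbound ⟨by linarith [abs_nonneg t₀], by linarith [abs_nonneg t₀]⟩ ht
    simp only [levelZeta_zero, sub_zero] at this
    refine this.trans ?_
    have : 0 ≤ C x := (norm_nonneg _).trans (hbound t ht)
    gcongr
    exact abs_le.2 ht
  rw [ContinuousAt, tendsto_iff_norm_sub_tendsto_zero]
  have h2 : Tendsto (fun p : ℝ × ℝ => C p.1 * T + ‖levelZeta c p.2 - levelZeta c t₀‖)
      (𝓝 (c, t₀)) (𝓝 0) := by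
    have a1 : Tendsto (fun p : ℝ × ℝ => C p.1 * T) (𝓝 (c, t₀)) (𝓝 (0 * T)) :=
      (hC.comp (continuous_fst.tendsto (c, t₀))).mul_const T
    have a2 : Tendsto (fun p : ℝ × ℝ => levelZeta c p.2 - levelZeta c t₀) (𝓝 (c, t₀))
        (𝓝 (levelZeta c t₀ - levelZeta c t₀)) :=
      (((hasDerivAt_levelZeta hc t₀).continuousAt.tendsto).comp
        (continuous_snd.tendsto (c, t₀))).sub_const _
    simpa using a1.add a2.norm
  refine squeeze_zero' (Eventually.of_forall fun _ => norm_nonneg _) ?_ h2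
  have hI : Set.Icc (-T) T ∈ 𝓝 t₀ := by
    refine Icc_mem_nhds ?_ ?_
    · linarith [neg_abs_le t₀]
    · linarith [le_abs_self t₀]
  filter_upwards [prod_mem_nhds (Ioo_mem hc) hI] with p hp
  calc ‖levelZeta p.1 p.2 - levelZeta c t₀‖ =
      ‖(levelZeta p.1 p.2 - levelZeta c p.2) + (levelZeta c p.2 - levelZeta c t₀)‖ := by
        rw [sub_add_sub_cancel]
    _ ≤ _ := (norm_add_le _ _).trans (by gcongr; exact key p.1 hp.1 p.2 hp.2)

theorem continuousAt_etaTilde1 (hc : c ∈ Set.Ioo (0 : ℝ) (1 / 27)) : ContinuousAt etaTilde1 c := by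
  have h1 : ContinuousAt (fun x => (x, 2 * omega1 x)) c :=
    continuousAt_id.prodMk ((continuousAt_omega1 hc).const_mul 2)
  have h2 := (ContinuousAt.comp (f := fun x => (x, 2 * omega1 x))
    (continuousAt_levelZeta hc (2 * omega1 c)) h1).const_mul (1 / 2 : ℝ)
  refine h2.congr ?_
  filter_upwards [Ioo_mem hc] with x hx
  simp [levelZeta_period hx]

theorem hasDerivAt_shift (hc : c ∈ Set.Ioo (0 : ℝ) (1 / 27)) (s a : ℝ) :
    HasDerivAt (fun c' : ℝ => s + Real.pi * a / omega1 c')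
      (3 * etaTilde1 c * Real.pi * a / (omega1 c ^ 2 * c * (1 - 27 * c))) c := by
  have hw := (omega1_pos hc).ne'
  have hc0 : c ≠ 0 := hc.1.ne'
  have hD : 1 - 27 * c ≠ 0 := by have := hc.2; linarith
  convert! (((hasDerivAt_omega1 hc).inv hw).const_mul (Real.pi * a)).const_add s using 1
  field_simp

end Level

/-! ### The affine chart and the field V in it -/

namespace CP2

theorem rep_ofAffine_two_ne_zero (w : ℂ × ℂ) : (ofAffine 2 w).rep 2 ≠ 0 :=
  (rep_mk_ne_zero 2 _).2 (by simp)

theorem chartAt_ofAffine (w : ℂ × ℂ) : chartAt (ℂ × ℂ) (ofAffine 2 w) = affineChart 2 := by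
  change affineChart (chartIndex _) = _
  rw [chartIndex, if_pos (rep_ofAffine_two_ne_zero w)]

theorem chartAt_apply (w w' : ℂ × ℂ) : chartAt (ℂ × ℂ) (ofAffine 2 w) (ofAffine 2 w') = w' := by
  rw [chartAt_ofAffine]; exact toAffine_ofAffine 2 w'

theorem chartAt_symm_apply (w w' : ℂ × ℂ) :
    (chartAt (ℂ × ℂ) (ofAffine 2 w)).symm w' = ofAffine 2 w' := by
  rw [chartAt_ofAffine]; rfl

theorem hasMFDerivAt_ofAffine_comp {F : Type*} [NormedAddCommGroup F] [NormedSpace ℝ F]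
    {f : F → ℂ × ℂ} {f' : F →L[ℝ] ℂ × ℂ} {x : F} (hf : HasFDerivAt f f' x) :
    HasMFDerivAt 𝓘(ℝ, F) 𝓘(ℝ, ℂ × ℂ) (fun x => ofAffine 2 (f x)) x f' := by
  refine ⟨((continuous_ofAffine 2).continuousAt).comp hf.continuousAt, ?_⟩
  simp only [mfld_simps]
  have h : HasFDerivAt (fun y => chartAt (ℂ × ℂ) (ofAffine 2 (f x)) (ofAffine 2 (f y))) f' x := by
    simpa only [chartAt_apply] using hf
  exact h.hasFDerivWithinAt

theorem hasMFDerivAt_of_ofAffine {F : Type*} [NormedAddCommGroup F] [NormedSpace ℝ F]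
    {f : CP2 → F} {f' : ℂ × ℂ →L[ℝ] F} {w : ℂ × ℂ}
    (hf : HasFDerivAt (fun w => f (ofAffine 2 w)) f' w) :
    HasMFDerivAt 𝓘(ℝ, ℂ × ℂ) 𝓘(ℝ, F) f (ofAffine 2 w) f' := by
  constructor
  · rw [((affineChart 2).symm.continuousAt_iff_continuousAt_comp_right (x := ofAffine 2 w)
      (rep_ofAffine_two_ne_zero w))]
    change ContinuousAt (fun w => f (ofAffine 2 w)) (toAffine 2 (ofAffine 2 w))
    rw [toAffine_ofAffine]
    exact hf.continuousAt
  · simp only [mfld_simps]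
    have h : HasFDerivAt (fun y => f ((chartAt (ℂ × ℂ) (ofAffine 2 w)).symm y)) f'
        (chartAt (ℂ × ℂ) (ofAffine 2 w) (ofAffine 2 w)) := by
      simpa only [chartAt_apply, chartAt_symm_apply] using hf
    exact h.hasFDerivWithinAt

theorem hasMFDerivAt_of_eventually_ofAffine {φ : CP2 → CP2} {g : ℂ × ℂ → ℂ × ℂ}
    {g' : ℂ × ℂ →L[ℝ] ℂ × ℂ} {w : ℂ × ℂ} (hg : HasFDerivAt g g' w)
    (h : ∀ᶠ w' in 𝓝 w, φ (ofAffine 2 w') = ofAffine 2 (g w')) :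
    HasMFDerivAt 𝓘(ℝ, ℂ × ℂ) 𝓘(ℝ, ℂ × ℂ) φ (ofAffine 2 w) g' := by
  constructor
  · rw [((affineChart 2).symm.continuousAt_iff_continuousAt_comp_right (x := ofAffine 2 w)
      (rep_ofAffine_two_ne_zero w))]
    change ContinuousAt (fun w => φ (ofAffine 2 w)) (toAffine 2 (ofAffine 2 w))
    rw [toAffine_ofAffine]
    exact ((continuous_ofAffine 2).continuousAt.comp hg.continuousAt).congr
      (h.mono fun _ h => h.symm)
  · simp only [mfld_simps]
    have h : HasFDerivAt (fun y => chartAt (ℂ × ℂ) (φ (ofAffine 2 w))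
        (φ ((chartAt (ℂ × ℂ) (ofAffine 2 w)).symm y))) g'
        (chartAt (ℂ × ℂ) (ofAffine 2 w) (ofAffine 2 w)) := by
      rw [chartAt_apply]
      refine hg.congr_of_eventuallyEq ?_
      filter_upwards [h] with w' hw'
      rw [chartAt_symm_apply, hw', h.self_of_nhds, chartAt_apply]
    exact h.hasFDerivWithinAt

end CP2

open CP2

theorem exists_ofAffine_of_notMem {p : CP2} (hp : p ∉ sigmaDivisor) :
    ∃ w : ℂ × ℂ, w.1 ≠ 0 ∧ w.2 ≠ 0 ∧ p = ofAffine 2 w := by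
  have h : ∀ k, p.rep k ≠ 0 := fun k hk => hp ⟨k, hk⟩
  exact ⟨toAffine 2 p, div_ne_zero (h _) (h _), div_ne_zero (h _) (h _),
    (ofAffine_toAffine 2 p (h 2)).symm⟩

theorem ofAffine_notMem {w : ℂ × ℂ} (h1 : w.1 ≠ 0) (h2 : w.2 ≠ 0) :
    ofAffine 2 w ∉ sigmaDivisor := by
  rintro ⟨k, hk⟩
  refine (rep_mk_ne_zero k _).2 ?_ hk
  fin_cases k
  exacts [by simpa using h1, by simpa using h2, by simp]

theorem moment_ofAffine (k : Fin 3) (w : ℂ × ℂ) :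
    moment k (ofAffine 2 w) =
      ![‖w.1‖ ^ 2, ‖w.2‖ ^ 2, 1] k / (‖w.1‖ ^ 2 + ‖w.2‖ ^ 2 + 1) := by
  obtain ⟨a, ha, h⟩ := exists_rep_mk ⟨fun j : Fin 3 => if j = 2 then 1 else if j = 2 + 1 then w.1 else w.2,
    fun h => by simpa using congrFun h 2⟩
  have ha' : ‖a‖ ^ 2 ≠ 0 := by positivity
  have e : ∀ j, ‖(ofAffine 2 w).rep j‖ ^ 2 = ‖a‖ ^ 2 * ![‖w.1‖ ^ 2, ‖w.2‖ ^ 2, 1] j := by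
    intro j
    rw [ofAffine, h]
    fin_cases j <;> simp [mul_pow]
  rw [moment]
  simp only [e]
  rw [← Finset.mul_sum, mul_div_mul_left _ _ ha']
  simp [Fin.sum_univ_three]

theorem moment_pos {w : ℂ × ℂ} (h1 : w.1 ≠ 0) (h2 : w.2 ≠ 0) (k : Fin 3) :
    0 < moment k (ofAffine 2 w) := by
  rw [moment_ofAffine]
  have : 0 < ‖w.1‖ := norm_pos_iff.2 h1
  have : 0 < ‖w.2‖ := norm_pos_iff.2 h2
  fin_cases k <;> simp <;> positivity

theorem hitchinH_ofAffine {w : ℂ × ℂ} (h1 : w.1 ≠ 0) (h2 : w.2 ≠ 0) :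
    hitchinH (ofAffine 2 w) = -(1 / 4) * (Real.log (‖w.1‖ ^ 2) + Real.log (‖w.2‖ ^ 2) -
      3 * Real.log (‖w.1‖ ^ 2 + ‖w.2‖ ^ 2 + 1)) := by
  have a1 : 0 < ‖w.1‖ := norm_pos_iff.2 h1
  have a2 : 0 < ‖w.2‖ := norm_pos_iff.2 h2
  rw [hitchinH, Fin.prod_univ_three]
  simp only [moment_ofAffine]
  simp only [Matrix.cons_val_zero, Matrix.cons_val_one, Matrix.cons_val]
  rw [Real.log_mul (by positivity) (by positivity), Real.log_mul (by positivity) (by positivity),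
    Real.log_div (by positivity) (by positivity), Real.log_div (by positivity) (by positivity),
    Real.log_div (by positivity) (by positivity), Real.log_one]
  ring

theorem hitchinSharp_ofAffine (w : ℂ × ℂ) (β : ℂ × ℂ →L[ℝ] ℝ) :
    hitchinSharp (ofAffine 2 w) β =
      ((w.1 * (w.2.re * β (0, 1) + w.2.im * β (0, Complex.I) : ℝ) +
          w.1 * (w.2.im * β (0, 1) - w.2.re * β (0, Complex.I) : ℝ) * Complex.I,
        -(w.2 * (w.1.re * β (1, 0) + w.1.im * β (Complex.I, 0) : ℝ) +
          w.2 * (w.1.im * β (1, 0) - w.1.re * β (Complex.I, 0) : ℝ) * Complex.I)) : ℂ × ℂ) := by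
  unfold hitchinSharp hitchinQ sigmaCP2 evalHol
  rw [chartAt_apply]
  refine Prod.ext (Complex.ext ?_ ?_) (Complex.ext ?_ ?_) <;>
  · simp [mulI, reFst, imFst, reSnd, imSnd]
    ring

/-- The field `V` in the affine coordinates. -/
noncomputable def affineV (w : ℂ × ℂ) : ℂ × ℂ :=
  (((3 * moment 1 (ofAffine 2 w) - 1) / 2 : ℝ) • w.1,
    ((1 - 3 * moment 0 (ofAffine 2 w)) / 2 : ℝ) • w.2)

/-- The Hamiltonian depends only on |z¹| and |z²|, so the imaginary parts of the multipliers of z¹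
and z² vanish: V is radial in each coordinate and the flow keeps the angles. -/
theorem hitchinV_ofAffine {w : ℂ × ℂ} (h1 : w.1 ≠ 0) (h2 : w.2 ≠ 0) :
    hitchinV (ofAffine 2 w) = affineV w := by
  have a1 : ‖w.1‖ ^ 2 ≠ 0 := pow_ne_zero _ (norm_ne_zero_iff.2 h1)
  have a2 : ‖w.2‖ ^ 2 ≠ 0 := pow_ne_zero _ (norm_ne_zero_iff.2 h2)
  have a3 : ‖w.1‖ ^ 2 + ‖w.2‖ ^ 2 + 1 ≠ 0 := by positivity
  have d1 := (hasFDerivAt_fst (𝕜 := ℝ) (E := ℂ) (F := ℂ) (p := w)).norm_sq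
  have d2 := (hasFDerivAt_snd (𝕜 := ℝ) (E := ℂ) (F := ℂ) (p := w)).norm_sq
  have d := (((d1.log a1).add (d2.log a2)).sub
    ((((d1.add d2).add_const 1).log a3).const_mul 3)).const_mul (-(1 / 4) : ℝ)
  have ev : (fun w => hitchinH (ofAffine 2 w)) =ᶠ[𝓝 w] fun w => -(1 / 4) * (Real.log (‖w.1‖ ^ 2) +
      Real.log (‖w.2‖ ^ 2) - 3 * Real.log (‖w.1‖ ^ 2 + ‖w.2‖ ^ 2 + 1)) := by
    filter_upwards [continuous_fst.continuousAt.eventually_ne h1,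
      continuous_snd.continuousAt.eventually_ne h2] with w' b1 b2 using hitchinH_ofAffine b1 b2
  have hm := (hasMFDerivAt_of_ofAffine (d.congr_of_eventuallyEq ev)).mfderiv
  rw [hitchinV, hm]
  refine (hitchinSharp_ofAffine w _).trans ?_
  rw [affineV, moment_ofAffine, moment_ofAffine]
  have n1 : ‖w.1‖ ^ 2 = w.1.re ^ 2 + w.1.im ^ 2 := by
    rw [← Complex.normSq_eq_norm_sq, Complex.normSq_apply]; ring
  have n2 : ‖w.2‖ ^ 2 = w.2.re ^ 2 + w.2.im ^ 2 := by
    rw [← Complex.normSq_eq_norm_sq, Complex.normSq_apply]; ring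
  rw [n1] at a1
  rw [n2] at a2
  rw [n1, n2] at a3
  have aux : ∀ (z : ℂ) {a b e : ℝ}, a = e → b = 0 →
      z * (a : ℂ) + z * (b : ℂ) * Complex.I = e • z := by
    rintro z a b e rfl rfl
    rw [Complex.real_smul]; push_cast; ring
  refine Prod.ext (aux _ ?_ ?_) ?_
  · simp [n1, n2, Complex.inner]
    field_simp
    ring
  · simp [n1, n2, Complex.inner]
    field_simp
    ring
  · refine (congrArg Neg.neg (aux _ (e := -((1 - 3 * (‖w.1‖ ^ 2 /
      (‖w.1‖ ^ 2 + ‖w.2‖ ^ 2 + 1))) / 2)) ?_ ?_)).trans ?_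
    · simp [n1, n2, Complex.inner]
      field_simp
      ring
    · simp [n1, n2, Complex.inner]
      field_simp
      ring
    · simp

/-! ### The parametrization and its Jacobian -/

/-- The functions `y¹, y², y³` of the coordinates `(c, s)`. -/
noncomputable def levelCurve (c s : ℝ) : Fin 3 → ℝ := levelSolution c (omega1 c * s / Real.pi)

/-- The logarithm of `|zⁱ|` in the coordinates `(c, s)`. -/
noncomputable def logRadius (i : Fin 2) (c s : ℝ) : ℝ :=
  1 / 2 * (Real.log (levelCurve c s i.castSucc) - Real.log (levelCurve c s 2))

/-- The affine coordinates of the point `coordPoint x`. -/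
noncomputable def affinePoint (x : Coord → ℝ) : ℂ × ℂ :=
  let y := fun k => (yCurve k (x (.inl 0)) (x (.inl 1))).re
  (Real.sqrt (y 0 / y 2) * Complex.exp (Complex.I * x (.inr 0)),
      Real.sqrt (y 1 / y 2) * Complex.exp (Complex.I * x (.inr 1)))

theorem coordPoint_eq (x : Coord → ℝ) : coordPoint x = ofAffine 2 (affinePoint x) := rfl

/-- The linear map with matrix `M` on the first two coordinates and `i` times the identity on the
angles. -/
noncomputable def logFrame (M : Matrix (Fin 2) (Fin 2) ℝ) (i : Fin 2) : (Coord → ℝ) →L[ℝ] ℂ :=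
  (M i 0 • ContinuousLinearMap.proj (R := ℝ) (φ := fun _ : Coord => ℝ) (.inl 0) +
      M i 1 • ContinuousLinearMap.proj (R := ℝ) (φ := fun _ : Coord => ℝ) (.inl 1)).smulRight 1 +
    (ContinuousLinearMap.proj (R := ℝ) (φ := fun _ : Coord => ℝ) (.inr i)).smulRight Complex.I

/-- The differential of the affine coordinates whose logarithms have the differentials
`logFrame M`. -/
noncomputable def affineFrame (M : Matrix (Fin 2) (Fin 2) ℝ) (z : ℂ × ℂ) :
    (Coord → ℝ) →L[ℝ] ℂ × ℂ :=
  (z.1 • logFrame M 0).prod (z.2 • logFrame M 1)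

theorem logFrame_apply (M : Matrix (Fin 2) (Fin 2) ℝ) (i : Fin 2) (v : Coord → ℝ) :
    logFrame M i v = ((M i 0 * v (.inl 0) + M i 1 * v (.inl 1) : ℝ) : ℂ) +
      v (.inr i) * Complex.I := by
  simp [logFrame]

theorem affineFrame_apply (M : Matrix (Fin 2) (Fin 2) ℝ) (z : ℂ × ℂ) (v : Coord → ℝ) :
    affineFrame M z v = (z.1 * logFrame M 0 v, z.2 * logFrame M 1 v) := rfl

theorem isInvertible_of_injective {E F : Type*} [NormedAddCommGroup E] [NormedSpace ℝ E]
    [NormedAddCommGroup F] [NormedSpace ℝ F] [FiniteDimensional ℝ E] [FiniteDimensional ℝ F]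
    {f : E →L[ℝ] F} (hf : Function.Injective f)
    (h : Module.finrank ℝ E = Module.finrank ℝ F) : f.IsInvertible :=
  ⟨(LinearMap.linearEquivOfInjective (f : E →ₗ[ℝ] F) hf h).toContinuousLinearEquiv, by ext; rfl⟩

theorem affineFrame_isInvertible {M : Matrix (Fin 2) (Fin 2) ℝ} (hM : M.det ≠ 0) {z : ℂ × ℂ}
    (h1 : z.1 ≠ 0) (h2 : z.2 ≠ 0) : (affineFrame M z).IsInvertible := by
  refine isInvertible_of_injective ?_ (by simp)
  rw [injective_iff_map_eq_zero]
  intro v hv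
  rw [affineFrame_apply, Prod.mk_eq_zero] at hv
  have e1 := (mul_eq_zero.1 hv.1).resolve_left h1
  have e2 := (mul_eq_zero.1 hv.2).resolve_left h2
  rw [logFrame_apply, Complex.ext_iff] at e1 e2
  simp at e1 e2
  have d := Matrix.det_fin_two M
  have r0 : M.det * v (.inl 0) = 0 := by rw [d]; linear_combination M 1 1 * e1.1 - M 0 1 * e2.1
  have r1 : M.det * v (.inl 1) = 0 := by rw [d]; linear_combination M 0 0 * e2.1 - M 1 0 * e1.1
  ext j
  rcases j with j | j <;> fin_cases j
  exacts [(mul_eq_zero.1 r0).resolve_left hM, (mul_eq_zero.1 r1).resolve_left hM, e1.2, e2.2]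

section Coordinates

variable {c : ℝ}

theorem levelCurve_pos (hc : c ∈ Set.Ioo (0 : ℝ) (1 / 27)) (s : ℝ) (k : Fin 3) :
    0 < levelCurve c s k := (isVolterraFrom_levelSolution hc).pos _ k

theorem levelCurve_sum (hc : c ∈ Set.Ioo (0 : ℝ) (1 / 27)) (s : ℝ) :
    levelCurve c s 0 + levelCurve c s 1 + levelCurve c s 2 = 1 :=
  (isVolterraFrom_levelSolution hc).sum _

theorem levelCurve_prod (hc : c ∈ Set.Ioo (0 : ℝ) (1 / 27)) (s : ℝ) :
    levelCurve c s 0 * levelCurve c s 1 * levelCurve c s 2 = c :=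
  (isVolterraFrom_levelSolution hc).prod _

theorem yCurve_re (hc : c ∈ Set.Ioo (0 : ℝ) (1 / 27)) (k : Fin 3) (s : ℝ) :
    (yCurve k c s).re = levelCurve c s k := by
  rw [yCurve_eq hc, Complex.ofReal_re]; rfl

theorem varsigma_re (hc : c ∈ Set.Ioo (0 : ℝ) (1 / 27)) (s : ℝ) :
    (varsigma c s).re = levelZeta c (omega1 c * s / Real.pi) - s / Real.pi * etaTilde1 c := by
  rw [varsigma_eq hc, Complex.ofReal_re]

theorem norm_affinePoint {x : Coord → ℝ} (hc : x (.inl 0) ∈ Set.Ioo (0 : ℝ) (1 / 27)) :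
    ‖(affinePoint x).1‖ ^ 2 = levelCurve (x (.inl 0)) (x (.inl 1)) 0 /
        levelCurve (x (.inl 0)) (x (.inl 1)) 2 ∧
    ‖(affinePoint x).2‖ ^ 2 = levelCurve (x (.inl 0)) (x (.inl 1)) 1 /
        levelCurve (x (.inl 0)) (x (.inl 1)) 2 := by
  have h := fun k => (levelCurve_pos hc (x (.inl 1)) k).le
  simp only [affinePoint, yCurve_re hc, norm_mul, Complex.norm_real, Real.norm_eq_abs,
    sq_abs, mul_comm Complex.I, Complex.norm_exp_ofReal_mul_I, mul_one]
  exact ⟨Real.sq_sqrt (div_nonneg (h _) (h _)), Real.sq_sqrt (div_nonneg (h _) (h _))⟩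

theorem affinePoint_eq {x : Coord → ℝ} (hc : x (.inl 0) ∈ Set.Ioo (0 : ℝ) (1 / 27)) :
    affinePoint x =
      (Complex.exp (logRadius 0 (x (.inl 0)) (x (.inl 1)) + x (.inr 0) * Complex.I),
        Complex.exp (logRadius 1 (x (.inl 0)) (x (.inl 1)) + x (.inr 1) * Complex.I)) := by
  have h := levelCurve_pos hc (x (.inl 1))
  have key : ∀ a b : ℝ, 0 < a → 0 < b →
      (Real.sqrt (a / b) : ℂ) = Complex.exp ((1 / 2 * (Real.log a - Real.log b) : ℝ)) := by
    intro a b ha hb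
    rw [← Complex.ofReal_exp, ← Real.log_div ha.ne' hb.ne', Real.sqrt_eq_rpow,
      Real.rpow_def_of_pos (div_pos ha hb), mul_comm]
  simp only [affinePoint, yCurve_re hc, key _ _ (h _) (h _), Complex.exp_add, logRadius,
    mul_comm Complex.I]
  rfl

theorem affinePoint_ne_zero {x : Coord → ℝ} (hc : x (.inl 0) ∈ Set.Ioo (0 : ℝ) (1 / 27)) :
    (affinePoint x).1 ≠ 0 ∧ (affinePoint x).2 ≠ 0 := by
  rw [affinePoint_eq hc]
  exact ⟨Complex.exp_ne_zero _, Complex.exp_ne_zero _⟩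

theorem moment_coordPoint {x : Coord → ℝ} (hc : x (.inl 0) ∈ Set.Ioo (0 : ℝ) (1 / 27)) (k : Fin 3) :
    moment k (coordPoint x) = levelCurve (x (.inl 0)) (x (.inl 1)) k := by
  rw [coordPoint_eq, moment_ofAffine, (norm_affinePoint hc).1, (norm_affinePoint hc).2]
  have h := (levelCurve_pos hc (x (.inl 1)) 2).ne'
  have hs := levelCurve_sum hc (x (.inl 1))
  set y := levelCurve (x (.inl 0)) (x (.inl 1))
  have e : y 0 / y 2 + y 1 / y 2 + 1 = 1 / y 2 := by
    field_simp; exact hs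
  rw [e]
  fin_cases k <;> simp <;> field_simp

theorem Jangle_eq (hc : c ∈ Set.Ioo (0 : ℝ) (1 / 27)) (s : ℝ) :
    Jangle c s =
      let y := levelCurve c s
      let v := levelZeta c (omega1 c * s / Real.pi) - s / Real.pi * etaTilde1 c
      !![(1 + 3 * y 1 - 18 * y 0 * y 1 - 6 * v * (1 - 3 * y 1)) / (4 * c * (1 - 27 * c)),
          omega1 c / (2 * Real.pi) * (3 * y 1 - 1);
        (1 + 3 * y 0 - 18 * y 0 * y 1 + 6 * v * (1 - 3 * y 0)) / (4 * c * (1 - 27 * c)),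
          omega1 c / (2 * Real.pi) * (1 - 3 * y 0)] := by
  simp only [Jangle, yCurve_re hc, varsigma_re hc]

/-- The ς-part of the first column is proportional to the second column and drops out; the rest
simplifies by y¹y²y³ = c. -/
theorem det_Jangle (hc : c ∈ Set.Ioo (0 : ℝ) (1 / 27)) (s : ℝ) :
    (Jangle c s).det = omega1 c / (4 * Real.pi * c) := by
  have h0 : c ≠ 0 := hc.1.ne'
  have hD : 1 - 27 * c ≠ 0 := by have := hc.2; linarith
  have hs := levelCurve_sum hc s
  have hp := levelCurve_prod hc s
  rw [Jangle_eq hc, Matrix.det_fin_two]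
  simp only [Matrix.of_apply, Matrix.cons_val_zero, Matrix.cons_val_one]
  have e : levelCurve c s 2 = 1 - levelCurve c s 0 - levelCurve c s 1 := by linear_combination hs
  rw [e] at hp
  obtain ⟨D, hD'⟩ : ∃ D, 1 - 27 * c = D := ⟨_, rfl⟩
  rw [hD'] at hD ⊢
  field_simp
  rw [← hD']
  linear_combination (-54 * omega1 c * Real.pi) * hp

theorem hasFDerivAt_levelCurve (hc : c ∈ Set.Ioo (0 : ℝ) (1 / 27)) (s : ℝ) (k : Fin 3) :
    HasFDerivAt (fun p : ℝ × ℝ => levelCurve p.1 p.2 k)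
      ((ContinuousLinearMap.fst ℝ ℝ ℝ).smulRight
          (IsVolterra.variation c (levelCurve c s) (levelZeta c (omega1 c * s / Real.pi)) k +
            volterra (levelCurve c s) k * (-(3 * etaTilde1 c) / (c * (1 - 27 * c)) * s / Real.pi)) +
        (ContinuousLinearMap.snd ℝ ℝ ℝ).smulRight
          (volterra (levelCurve c s) k * (omega1 c / Real.pi))) (c, s) := by
  have h1 := hasFDerivAt_pi'.1 (hasFDerivAt_levelSolution hc (omega1 c * s / Real.pi)) k
  have h0 := HasDerivAt.comp_hasFDerivAt (h₂ := omega1) (c, s) (hasDerivAt_omega1 hc)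
    (hasFDerivAt_fst (𝕜 := ℝ) (E := ℝ) (F := ℝ))
  have h2 := (h0.mul (hasFDerivAt_snd (𝕜 := ℝ) (E := ℝ) (F := ℝ))).mul_const (Real.pi)⁻¹
  simp only [Pi.mul_apply, Function.comp_apply] at h2
  simp only [← div_eq_mul_inv] at h2
  have h3 := (hasFDerivAt_fst (𝕜 := ℝ) (E := ℝ) (F := ℝ) (p := (c, s))).prodMk h2
  have h4 := HasFDerivAt.comp (g := fun p : ℝ × ℝ => levelSolution p.1 p.2 k)
    (f := fun p : ℝ × ℝ => (p.1, omega1 p.1 * p.2 / Real.pi)) (c, s) h1 h3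
  refine h4.congr_fderiv ?_
  ext <;> simp [levelCurve] <;> ring

/-- This identifies `Jangle` as a Jacobian. At fixed s the time ω₁s/π also varies with c, and its
contribution along the velocity replaces the primitive z by z - sη̃₁/π = ς. -/
theorem hasFDerivAt_logRadius (hc : c ∈ Set.Ioo (0 : ℝ) (1 / 27)) (s : ℝ) (i : Fin 2) :
    HasFDerivAt (fun p : ℝ × ℝ => logRadius i p.1 p.2)
      ((ContinuousLinearMap.fst ℝ ℝ ℝ).smulRight (Jangle c s i 0) +
        (ContinuousLinearMap.snd ℝ ℝ ℝ).smulRight (Jangle c s i 1)) (c, s) := by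
  have hp := levelCurve_pos hc s
  have hs := levelCurve_sum hc s
  have h := (((hasFDerivAt_levelCurve hc s i.castSucc).log (hp _).ne').sub
    ((hasFDerivAt_levelCurve hc s 2).log (hp _).ne')).const_mul (1 / 2)
  refine h.congr_fderiv ?_
  have h0 : c ≠ 0 := hc.1.ne'
  have hD : 1 - 27 * c ≠ 0 := by have := hc.2; linarith
  rw [Jangle_eq hc]
  obtain ⟨D, hD'⟩ : ∃ D, 1 - 27 * c = D := ⟨_, rfl⟩
  simp only [IsVolterra.variation, hD']
  rw [hD'] at hD
  have n0 := (hp 0).ne'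
  have n1 := (hp 1).ne'
  have n2 := (hp 2).ne'
  have e : levelCurve c s 2 = 1 - levelCurve c s 0 - levelCurve c s 1 := by linear_combination hs
  fin_cases i <;> ext <;> simp [volterra] <;> field_simp <;> rw [e] <;> ring

theorem hasFDerivAt_affinePoint {x : Coord → ℝ} (hc : x (.inl 0) ∈ Set.Ioo (0 : ℝ) (1 / 27)) :
    HasFDerivAt affinePoint
      (affineFrame (Jangle (x (.inl 0)) (x (.inl 1))) (affinePoint x)) x := by
  have hpr : ∀ j : Coord, HasFDerivAt (fun x : Coord → ℝ => x j)
      (ContinuousLinearMap.proj (R := ℝ) (φ := fun _ : Coord => ℝ) j) x := fun j =>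
    (ContinuousLinearMap.proj (R := ℝ) (φ := fun _ : Coord => ℝ) j).hasFDerivAt
  have hlog : ∀ i : Fin 2, HasFDerivAt (fun x : Coord → ℝ =>
      Complex.exp (logRadius i (x (.inl 0)) (x (.inl 1)) + x (.inr i) * Complex.I))
      (Complex.exp (logRadius i (x (.inl 0)) (x (.inl 1)) + x (.inr i) * Complex.I) •
        logFrame (Jangle (x (.inl 0)) (x (.inl 1))) i) x := by
    intro i
    have h1 := HasFDerivAt.comp (g := fun p : ℝ × ℝ => logRadius i p.1 p.2)
      (f := fun x : Coord → ℝ => (x (.inl 0), x (.inl 1))) x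
      (hasFDerivAt_logRadius hc (x (.inl 1)) i) ((hpr _).prodMk (hpr _))
    have h2 := (Complex.ofRealCLM.hasFDerivAt.comp x h1).add
      ((Complex.ofRealCLM.hasFDerivAt.comp x (hpr (.inr i))).mul_const Complex.I)
    have h3 := h2.cexp
    refine h3.congr_fderiv ?_
    congr 1
    ext v
    rw [logFrame_apply]
    simp
    ring
  have h := (hlog 0).prodMk (hlog 1)
  have e : affinePoint =ᶠ[𝓝 x] fun x =>
      (Complex.exp (logRadius 0 (x (.inl 0)) (x (.inl 1)) + x (.inr 0) * Complex.I),
        Complex.exp (logRadius 1 (x (.inl 0)) (x (.inl 1)) + x (.inr 1) * Complex.I)) := by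
    filter_upwards [(continuous_apply (Sum.inl 0 : Coord)).continuousAt.preimage_mem_nhds
      (Ioo_mem hc)] with y hy using affinePoint_eq hy
  refine (h.congr_of_eventuallyEq e).congr_fderiv ?_
  rw [affineFrame, affinePoint_eq hc]

end Coordinates

section Parametrization

variable {c : ℝ}

theorem hasMFDerivAt_coordPoint {x : Coord → ℝ} (hc : x (.inl 0) ∈ Set.Ioo (0 : ℝ) (1 / 27)) :
    HasMFDerivAt 𝓘(ℝ, Coord → ℝ) 𝓘(ℝ, ℂ × ℂ) coordPoint x
      (affineFrame (Jangle (x (.inl 0)) (x (.inl 1))) (affinePoint x)) :=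
  hasMFDerivAt_ofAffine_comp (hasFDerivAt_affinePoint hc)

theorem coordFrame_eq {x : Coord → ℝ} (hc : x (.inl 0) ∈ Set.Ioo (0 : ℝ) (1 / 27)) :
    coordFrame x = affineFrame (Jangle (x (.inl 0)) (x (.inl 1))) (affinePoint x) :=
  (hasMFDerivAt_coordPoint hc).mfderiv

theorem det_Jangle_ne_zero (hc : c ∈ Set.Ioo (0 : ℝ) (1 / 27)) (s : ℝ) : (Jangle c s).det ≠ 0 := by
  rw [det_Jangle hc]
  have h1 := hc.1
  have h2 := omega1_pos hc
  positivity

theorem affineFrame_Jangle_isInvertible {x : Coord → ℝ}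
    (hc : x (.inl 0) ∈ Set.Ioo (0 : ℝ) (1 / 27)) :
    (affineFrame (Jangle (x (.inl 0)) (x (.inl 1))) (affinePoint x)).IsInvertible :=
  affineFrame_isInvertible (det_Jangle_ne_zero hc _) (affinePoint_ne_zero hc).1
    (affinePoint_ne_zero hc).2

theorem continuousAt_Jangle (hc : c ∈ Set.Ioo (0 : ℝ) (1 / 27)) (s : ℝ) (i j : Fin 2) :
    ContinuousAt (fun p : ℝ × ℝ => Jangle p.1 p.2 i j) (c, s) := by
  have hy := fun k => (hasFDerivAt_levelCurve hc s k).continuousAt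
  have hw : ContinuousAt (fun p : ℝ × ℝ => omega1 p.1) (c, s) :=
    ContinuousAt.comp (f := Prod.fst) (g := omega1) (continuousAt_omega1 hc) continuousAt_fst
  have he : ContinuousAt (fun p : ℝ × ℝ => etaTilde1 p.1) (c, s) :=
    ContinuousAt.comp (f := Prod.fst) (g := etaTilde1) (continuousAt_etaTilde1 hc) continuousAt_fst
  have hZ : ContinuousAt (fun p : ℝ × ℝ => levelZeta p.1 (omega1 p.1 * p.2 / Real.pi)) (c, s) :=
    ContinuousAt.comp (f := fun p : ℝ × ℝ => (p.1, omega1 p.1 * p.2 / Real.pi))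
      (g := fun p : ℝ × ℝ => levelZeta p.1 p.2) (continuousAt_levelZeta hc _)
      (continuousAt_fst.prodMk ((hw.mul continuousAt_snd).div_const _))
  have hv : ContinuousAt (fun p : ℝ × ℝ =>
      levelZeta p.1 (omega1 p.1 * p.2 / Real.pi) - p.2 / Real.pi * etaTilde1 p.1) (c, s) :=
    hZ.sub ((continuousAt_snd.div_const _).mul he)
  have h0 : 4 * c * (1 - 27 * c) ≠ 0 := by
    have h1 := hc.1
    have h2 := hc.2
    exact mul_ne_zero (by positivity) (by linarith)
  have hden : ContinuousAt (fun p : ℝ × ℝ => 4 * p.1 * (1 - 27 * p.1)) (c, s) := by fun_prop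
  have e : (fun p : ℝ × ℝ => Jangle p.1 p.2 i j) =ᶠ[𝓝 (c, s)] fun p =>
      (let y := levelCurve p.1 p.2
      let v := levelZeta p.1 (omega1 p.1 * p.2 / Real.pi) - p.2 / Real.pi * etaTilde1 p.1
      !![(1 + 3 * y 1 - 18 * y 0 * y 1 - 6 * v * (1 - 3 * y 1)) / (4 * p.1 * (1 - 27 * p.1)),
          omega1 p.1 / (2 * Real.pi) * (3 * y 1 - 1);
        (1 + 3 * y 0 - 18 * y 0 * y 1 + 6 * v * (1 - 3 * y 0)) / (4 * p.1 * (1 - 27 * p.1)),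
          omega1 p.1 / (2 * Real.pi) * (1 - 3 * y 0)] : Matrix (Fin 2) (Fin 2) ℝ) i j := by
    filter_upwards [(continuous_fst (X := ℝ) (Y := ℝ)).continuousAt.preimage_mem_nhds
      (Ioo_mem hc)] with p hp
    rw [Jangle_eq hp]
  refine ContinuousAt.congr ?_ e.symm
  have y0 := hy 0
  have y1 := hy 1
  fin_cases i <;> fin_cases j
  · exact ((((y1.const_mul 3).const_add 1).sub ((y0.const_mul 18).mul y1)).sub
      ((hv.const_mul 6).mul ((y1.const_mul 3).const_sub 1))).div hden h0
  · exact (hw.div_const _).mul ((y1.const_mul 3).sub_const 1)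
  · exact ((((y0.const_mul 3).const_add 1).sub ((y0.const_mul 18).mul y1)).add
      ((hv.const_mul 6).mul ((y0.const_mul 3).const_sub 1))).div hden h0
  · exact (hw.div_const _).mul ((y0.const_mul 3).const_sub 1)

theorem isOpen_coordDomain : IsOpen {x : Coord → ℝ | x (.inl 0) ∈ Set.Ioo (0 : ℝ) (1 / 27)} :=
  isOpen_Ioo.preimage (continuous_apply _)

theorem continuousOn_affineFrame :
    ContinuousOn (fun x : Coord → ℝ =>
      affineFrame (Jangle (x (.inl 0)) (x (.inl 1))) (affinePoint x))
      {x | x (.inl 0) ∈ Set.Ioo (0 : ℝ) (1 / 27)} := by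
  rw [continuousOn_clm_apply]
  intro v x hx
  refine ContinuousAt.continuousWithinAt ?_
  simp only [affineFrame_apply, logFrame_apply]
  have hJ : ∀ i j, ContinuousAt (fun x : Coord → ℝ => Jangle (x (.inl 0)) (x (.inl 1)) i j) x :=
    fun i j => ContinuousAt.comp (f := fun x : Coord → ℝ => (x (.inl 0), x (.inl 1)))
      (g := fun p : ℝ × ℝ => Jangle p.1 p.2 i j) (continuousAt_Jangle hx _ i j)
      (by fun_prop)
  have hz := (hasFDerivAt_affinePoint hx).continuousAt
  have hl : ∀ i, ContinuousAt (fun x : Coord → ℝ =>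
      ((Jangle (x (.inl 0)) (x (.inl 1)) i 0 * v (.inl 0) +
        Jangle (x (.inl 0)) (x (.inl 1)) i 1 * v (.inl 1) : ℝ) : ℂ) +
        v (.inr i) * Complex.I) x := fun i =>
    (Complex.continuous_ofReal.continuousAt.comp
      (((hJ i 0).mul_const _).add ((hJ i 1).mul_const _))).add_const _
  exact (hz.fst.mul (hl 0)).prodMk (hz.snd.mul (hl 1))

/-- Strictness, from continuity of the Jacobian, is what permits a local inverse when the flow is
differentiated on the manifold. -/
theorem hasStrictFDerivAt_affinePoint {x : Coord → ℝ}
    (hc : x (.inl 0) ∈ Set.Ioo (0 : ℝ) (1 / 27)) :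
    HasStrictFDerivAt affinePoint
      (affineFrame (Jangle (x (.inl 0)) (x (.inl 1))) (affinePoint x)) x :=
  hasStrictFDerivAt_of_hasFDerivAt_of_continuousAt
    (Filter.eventually_of_mem (isOpen_coordDomain.mem_nhds hc) fun _ h => hasFDerivAt_affinePoint h)
    (continuousOn_affineFrame.continuousAt (isOpen_coordDomain.mem_nhds hc))

theorem coordPoint_notMem {x : Coord → ℝ} (hc : x (.inl 0) ∈ Set.Ioo (0 : ℝ) (1 / 27)) :
    coordPoint x ∉ sigmaDivisor :=
  ofAffine_notMem (affinePoint_ne_zero hc).1 (affinePoint_ne_zero hc).2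

theorem prod_moment_coordPoint {x : Coord → ℝ} (hc : x (.inl 0) ∈ Set.Ioo (0 : ℝ) (1 / 27)) :
    ∏ k, moment k (coordPoint x) = x (.inl 0) := by
  simp only [Fin.prod_univ_three, moment_coordPoint hc]
  exact levelCurve_prod hc _

theorem moment_ofAffine_sum (w : ℂ × ℂ) :
    moment 0 (ofAffine 2 w) + moment 1 (ofAffine 2 w) + moment 2 (ofAffine 2 w) = 1 := by
  have : ‖w.1‖ ^ 2 + ‖w.2‖ ^ 2 + 1 ≠ 0 := by positivity
  simp only [moment_ofAffine, ← add_div]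
  exact div_self this

/-- Surjectivity is `IsVolterraFrom.exists_eq`: the moments of a point lie on the orbit of their
level, which provides s; the angles are the arguments of the affine coordinates. -/
theorem image_coordPoint :
    coordPoint '' {x | x (.inl 0) ∈ Set.Ioo (0 : ℝ) (1 / 27)} =
      {p | p ∉ sigmaDivisor ∧ ∏ k, moment k p < 1 / 27} := by
  ext p
  constructor
  · rintro ⟨x, hx, rfl⟩
    exact ⟨coordPoint_notMem hx, (prod_moment_coordPoint hx).trans_lt hx.2⟩
  · rintro ⟨hp, hlt⟩
    obtain ⟨w, h1, h2, rfl⟩ := exists_ofAffine_of_notMem hp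
    set y := fun k => moment k (ofAffine 2 w) with hy
    have hpos : ∀ k, 0 < y k := moment_pos h1 h2
    have hc : y 0 * y 1 * y 2 ∈ Set.Ioo (0 : ℝ) (1 / 27) :=
      ⟨mul_pos (mul_pos (hpos 0) (hpos 1)) (hpos 2), by rwa [Fin.prod_univ_three] at hlt⟩
    obtain ⟨t, ht⟩ := (isVolterraFrom_levelSolution hc).exists_eq
      (isFirstMeeting_levelSolution hc) hpos (moment_ofAffine_sum w) rfl
    have hw := (omega1_pos hc).ne'
    refine ⟨coords (y 0 * y 1 * y 2) (Real.pi * t / omega1 (y 0 * y 1 * y 2))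
      ![w.1.arg, w.2.arg], hc, ?_⟩
    have e : omega1 (y 0 * y 1 * y 2) * (Real.pi * t / omega1 (y 0 * y 1 * y 2)) / Real.pi = t := by
      field_simp
    have hl : levelCurve (y 0 * y 1 * y 2) (Real.pi * t / omega1 (y 0 * y 1 * y 2)) = y := by
      rw [levelCurve, e, ht]
    have n : ‖w.1‖ ^ 2 + ‖w.2‖ ^ 2 + 1 ≠ 0 := by positivity
    have s1 : Real.sqrt (y 0 / y 2) = ‖w.1‖ := by
      rw [← Real.sqrt_sq (norm_nonneg w.1)]
      congr 1
      simp only [hy, moment_ofAffine]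
      simp
      field_simp
    have s2 : Real.sqrt (y 1 / y 2) = ‖w.2‖ := by
      rw [← Real.sqrt_sq (norm_nonneg w.2)]
      congr 1
      simp only [hy, moment_ofAffine]
      simp
      field_simp
    rw [coordPoint_eq]
    congr 1
    simp only [affinePoint, coords, Sum.elim_inl, Sum.elim_inr, Matrix.cons_val_zero,
      Matrix.cons_val_one, yCurve_re hc, hl, s1, s2, mul_comm Complex.I,
      Complex.norm_mul_exp_arg_mul_I]

end Parametrization

/-! ### Existence, uniqueness and linearity in s of the flow -/

section Flow

variable {c : ℝ}

/-- The flow in the coordinates `(c, s, θ)`. -/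
noncomputable def coordFlow (t : ℝ) (x : Coord → ℝ) : Coord → ℝ :=
  Function.update x (.inl 1) (x (.inl 1) + Real.pi * t / omega1 (x (.inl 0)))

@[simp] theorem coordFlow_inl_zero (t : ℝ) (x : Coord → ℝ) : coordFlow t x (.inl 0) = x (.inl 0) := by
  simp [coordFlow]

@[simp] theorem coordFlow_inl_one (t : ℝ) (x : Coord → ℝ) :
    coordFlow t x (.inl 1) = x (.inl 1) + Real.pi * t / omega1 (x (.inl 0)) := by
  simp [coordFlow]

@[simp] theorem coordFlow_inr (t : ℝ) (x : Coord → ℝ) (i : Fin 2) :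
    coordFlow t x (.inr i) = x (.inr i) := by
  simp [coordFlow]

theorem coordFlow_zero (x : Coord → ℝ) : coordFlow 0 x = x := by
  simp [coordFlow]

theorem hasDerivAt_coordFlow (x : Coord → ℝ) (t : ℝ) :
    HasDerivAt (fun t => coordFlow t x) (Pi.single (.inl 1) (Real.pi / omega1 (x (.inl 0)))) t := by
  rw [hasDerivAt_pi]
  intro j
  have h1 : HasDerivAt (fun t : ℝ => Real.pi * t / omega1 (x (.inl 0)))
      (Real.pi * 1 / omega1 (x (.inl 0))) t :=
    ((hasDerivAt_id t).const_mul Real.pi).div_const _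
  rcases j with j | j
  · fin_cases j
    · simpa using hasDerivAt_const t (x (.inl 0))
    · simpa using h1.const_add (x (.inl 1))
  · simpa using hasDerivAt_const t (x (.inr j))

theorem hasMFDerivAt_ofAffine_curve {f : ℝ → ℂ × ℂ} {f' : ℂ × ℂ} {t : ℝ} (hf : HasDerivAt f f' t)
    {v : TCP2 (ofAffine 2 (f t))} (hv : v = f') :
    HasMFDerivAt 𝓘(ℝ, ℝ) 𝓘(ℝ, ℂ × ℂ) (fun t => ofAffine 2 (f t)) t
      ((1 : ℝ →L[ℝ] ℝ).smulRight v) := by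
  subst hv
  have h : HasFDerivAt f ((1 : ℝ →L[ℝ] ℝ).smulRight (v : ℂ × ℂ)) t :=
    hf.hasFDerivAt.congr_fderiv (ContinuousLinearMap.ext fun _ => rfl)
  exact hasMFDerivAt_ofAffine_comp h

/-- Moving s at rate π/ω₁ turns the second column of `Jangle` into ((3y² - 1)/2, (1 - 3y¹)/2), the
multipliers of V. -/
theorem isMIntegralCurve_coordPoint {x : Coord → ℝ}
    (hc : x (.inl 0) ∈ Set.Ioo (0 : ℝ) (1 / 27)) :
    IsMIntegralCurve (I := 𝓘(ℝ, ℂ × ℂ)) (fun t => coordPoint (coordFlow t x)) hitchinV := by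
  intro t
  have hc' : coordFlow t x (.inl 0) ∈ Set.Ioo (0 : ℝ) (1 / 27) := by simpa using hc
  have h1 := (hasFDerivAt_affinePoint hc').comp_hasDerivAt t (hasDerivAt_coordFlow x t)
  have hz := affinePoint_ne_zero hc'
  refine hasMFDerivAt_ofAffine_curve h1 ?_
  refine (hitchinV_ofAffine hz.1 hz.2).trans ?_
  rw [affineV, ← coordPoint_eq, moment_coordPoint hc', moment_coordPoint hc', affineFrame_apply,
    logFrame_apply, logFrame_apply, Jangle_eq hc']
  have hw := (omega1_pos hc).ne'
  have hw' : (omega1 (x (.inl 0)) : ℂ) ≠ 0 := by exact_mod_cast hw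
  have hpi : (Real.pi : ℂ) ≠ 0 := by exact_mod_cast Real.pi_ne_zero
  refine Prod.ext ?_ ?_ <;> simp <;> field_simp

end Flow

theorem IsMIntegralCurve.hasDerivAt_toAffine {γ : ℝ → CP2}
    (hγ : IsMIntegralCurve (I := 𝓘(ℝ, ℂ × ℂ)) γ hitchinV) {t : ℝ} (ht : γ t ∉ sigmaDivisor) :
    HasDerivAt (fun t => toAffine 2 (γ t)) (affineV (toAffine 2 (γ t))) t := by
  have h := (hγ t).2
  simp only [mfld_simps] at h
  obtain ⟨w, h1, h2, hw⟩ := exists_ofAffine_of_notMem ht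
  have hv : hitchinV (γ t) = affineV (toAffine 2 (γ t)) := by
    rw [hw, toAffine_ofAffine]; exact hitchinV_ofAffine h1 h2
  have hch : chartAt (ℂ × ℂ) (γ t) = affineChart 2 := by rw [hw, chartAt_ofAffine]
  have h' : HasFDerivWithinAt (fun u => chartAt (ℂ × ℂ) (γ t) (γ u))
    ((1 : ℝ →L[ℝ] ℝ).smulRight (hitchinV (γ t) : ℂ × ℂ)) Set.univ t := h
  rw [hch, hasFDerivWithinAt_univ, hv] at h'
  exact hasDerivAt_iff_hasFDerivAt.2 (h'.congr_fderiv (ContinuousLinearMap.ext fun _ => rfl))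

theorem isVolterra_moment {w : ℝ → ℂ × ℂ} (hw : ∀ t, HasDerivAt w (affineV (w t)) t)
    (h1 : ∀ t, (w t).1 ≠ 0) (h2 : ∀ t, (w t).2 ≠ 0) :
    ∃ c, IsVolterra c fun t k => moment k (ofAffine 2 (w t)) := by
  set y : ℝ → Fin 3 → ℝ := fun t k => moment k (ofAffine 2 (w t)) with hy
  have hd : ∀ t, HasDerivAt y (volterra (y t)) t := by
    intro t
    have a1 : HasDerivAt (fun t => ‖(w t).1‖ ^ 2) ((3 * y t 1 - 1) * ‖(w t).1‖ ^ 2) t := by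
      have := (hasFDerivAt_fst.comp_hasDerivAt t (hw t)).norm_sq
      convert! this using 1
      simp only [affineV, Function.comp, ContinuousLinearMap.coe_fst',
        real_inner_smul_right, real_inner_self_eq_norm_sq, hy]
      ring
    have a2 : HasDerivAt (fun t => ‖(w t).2‖ ^ 2) ((1 - 3 * y t 0) * ‖(w t).2‖ ^ 2) t := by
      have := (hasFDerivAt_snd.comp_hasDerivAt t (hw t)).norm_sq
      convert! this using 1
      simp only [affineV, Function.comp, ContinuousLinearMap.coe_snd',
        real_inner_smul_right, real_inner_self_eq_norm_sq, hy]
      ring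
    have hn : ‖(w t).1‖ ^ 2 + ‖(w t).2‖ ^ 2 + 1 ≠ 0 := by positivity
    have a3 := (a1.add a2).add_const 1
    simp only [Pi.add_apply] at a3
    rw [hasDerivAt_pi]
    intro k
    have e0 : y t 0 = ‖(w t).1‖ ^ 2 / (‖(w t).1‖ ^ 2 + ‖(w t).2‖ ^ 2 + 1) := moment_ofAffine 0 _
    have e1 : y t 1 = ‖(w t).2‖ ^ 2 / (‖(w t).1‖ ^ 2 + ‖(w t).2‖ ^ 2 + 1) := moment_ofAffine 1 _
    have e2 : y t 2 = 1 / (‖(w t).1‖ ^ 2 + ‖(w t).2‖ ^ 2 + 1) := moment_ofAffine 2 _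
    simp only [hy, moment_ofAffine] at a1 a2 a3 ⊢
    fin_cases k
    · refine (a1.div a3 hn).congr_deriv ?_
      simp [volterra]
      field_simp
      ring
    · refine (a2.div a3 hn).congr_deriv ?_
      simp [volterra]
      field_simp
      ring
    · refine ((hasDerivAt_const t (1 : ℝ)).div a3 hn).congr_deriv ?_
      simp [volterra]
      field_simp
      ring
  refine ⟨y 0 0 * y 0 1 * y 0 2, hd, fun t k => moment_pos (h1 t) (h2 t) k,
    fun t => moment_ofAffine_sum _, fun t => ?_⟩
  have hk := fun k t => hasDerivAt_pi.1 (hd t) k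
  have hp : ∀ t, HasDerivAt (fun t => y t 0 * y t 1 * y t 2) 0 t := fun t =>
    (((hk 0 t).mul (hk 1 t)).mul (hk 2 t)).congr_deriv (by
      simp [volterra]
      ring)
  exact is_const_of_deriv_eq_zero (fun t => (hp t).differentiableAt) (fun t => (hp t).deriv) t 0

theorem eq_of_hasDerivAt_smul {a : ℝ → ℝ} {f g : ℝ → ℂ} (hf : ∀ t, HasDerivAt f (a t • f t) t)
    (hg : ∀ t, HasDerivAt g (a t • g t) t) (h0 : ∀ t, g t ≠ 0) (h : f 0 = g 0) (t : ℝ) :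
    f t = g t := by
  have hd : ∀ t, HasDerivAt (fun t => f t / g t) 0 t := fun t =>
    ((hf t).div (hg t) (h0 t)).congr_deriv (by simp; ring_nf; simp)
  have := is_const_of_deriv_eq_zero (fun t => (hd t).differentiableAt) (fun t => (hd t).deriv) t 0
  simp only [h, div_self (h0 0)] at this
  exact (div_eq_one_iff_eq (h0 t)).1 this

/-- The moments of both curves solve the quadratic system with equal initial values, hence agree.
The multipliers are then the same functions of time, and each coordinate solves a scalar linear
equation. -/
theorem affineV_solution_unique {w w' : ℝ → ℂ × ℂ} (hw : ∀ t, HasDerivAt w (affineV (w t)) t)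
    (hw' : ∀ t, HasDerivAt w' (affineV (w' t)) t) (h1 : ∀ t, (w t).1 ≠ 0) (h2 : ∀ t, (w t).2 ≠ 0)
    (h1' : ∀ t, (w' t).1 ≠ 0) (h2' : ∀ t, (w' t).2 ≠ 0) (h : w 0 = w' 0) : w = w' := by
  obtain ⟨c, hc⟩ := isVolterra_moment hw h1 h2
  obtain ⟨c', hc'⟩ := isVolterra_moment hw' h1' h2'
  have hm := hc.eq_of_eq hc' (a := 0) (by simp only [h])
  have hm' : ∀ t k, moment k (ofAffine 2 (w' t)) = moment k (ofAffine 2 (w t)) := fun t k =>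
    congrFun (congrFun hm.symm t) k
  funext t
  refine Prod.ext ?_ ?_
  · refine eq_of_hasDerivAt_smul (f := fun t => (w t).1) (g := fun t => (w' t).1)
      (a := fun t => (3 * moment 1 (ofAffine 2 (w t)) - 1) / 2)
      (fun t => by have := (hasFDerivAt_fst (𝕜 := ℝ)).comp_hasDerivAt t (hw t); exact this)
      (fun t => ?_) h1'
      (by simp only [h]) t
    have := (hasFDerivAt_fst (𝕜 := ℝ)).comp_hasDerivAt t (hw' t)
    rw [affineV, hm'] at this
    exact this
  · refine eq_of_hasDerivAt_smul (f := fun t => (w t).2) (g := fun t => (w' t).2)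
      (a := fun t => (1 - 3 * moment 0 (ofAffine 2 (w t))) / 2)
      (fun t => by have := (hasFDerivAt_snd (𝕜 := ℝ)).comp_hasDerivAt t (hw t); exact this)
      (fun t => ?_) h2'
      (by simp only [h]) t
    have := (hasFDerivAt_snd (𝕜 := ℝ)).comp_hasDerivAt t (hw' t)
    rw [affineV, hm', hm'] at this
    exact this

theorem toAffine_ne_zero {p : CP2} (hp : p ∉ sigmaDivisor) :
    (toAffine 2 p).1 ≠ 0 ∧ (toAffine 2 p).2 ≠ 0 := by
  obtain ⟨w, h1, h2, rfl⟩ := exists_ofAffine_of_notMem hp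
  rw [toAffine_ofAffine]
  exact ⟨h1, h2⟩

/-- Integral curves of `V` off the divisor are determined by their initial points. -/
theorem IsMIntegralCurve.eq_of_zero_eq {γ γ' : ℝ → CP2}
    (hγ : IsMIntegralCurve (I := 𝓘(ℝ, ℂ × ℂ)) γ hitchinV)
    (hγ' : IsMIntegralCurve (I := 𝓘(ℝ, ℂ × ℂ)) γ' hitchinV) (h : ∀ t, γ t ∉ sigmaDivisor)
    (h' : ∀ t, γ' t ∉ sigmaDivisor) (h0 : γ 0 = γ' 0) : γ = γ' := by
  have := affineV_solution_unique (fun t => hγ.hasDerivAt_toAffine (h t))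
    (fun t => hγ'.hasDerivAt_toAffine (h' t)) (fun t => (toAffine_ne_zero (h t)).1)
    (fun t => (toAffine_ne_zero (h t)).2) (fun t => (toAffine_ne_zero (h' t)).1)
    (fun t => (toAffine_ne_zero (h' t)).2) (by simp only [h0])
  funext t
  rw [← ofAffine_toAffine 2 (γ t) (fun hk => h t ⟨2, hk⟩),
    ← ofAffine_toAffine 2 (γ' t) (fun hk => h' t ⟨2, hk⟩)]
  exact congrArg _ (congrFun this t)

theorem IsHitchinFlow.apply_coordPoint {φ : ℝ → CP2 → CP2} (hφ : IsHitchinFlow φ) {x : Coord → ℝ}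
    (hc : x (.inl 0) ∈ Set.Ioo (0 : ℝ) (1 / 27)) (t : ℝ) :
    φ t (coordPoint x) = coordPoint (coordFlow t x) := by
  have hx := coordPoint_notMem hc
  refine congrFun ((hφ.integralCurve _ hx).eq_of_zero_eq (isMIntegralCurve_coordPoint hc)
    (fun t => hφ.mapsTo t _ hx) (fun t => coordPoint_notMem (by simpa using hc)) ?_) t
  rw [hφ.zero _ hx, coordFlow_zero]

/-- The equality case of the inequality between the arithmetic and the geometric mean. -/
theorem eq_one_third_of_prod_ge {a b c : ℝ} (ha : 0 < a) (hb : 0 < b) (hc : 0 < c)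
    (hsum : a + b + c = 1) (hprod : 1 / 27 ≤ a * b * c) : a = 1 / 3 ∧ b = 1 / 3 := by
  have e : 1 - 27 * (a * b * c) = 1 / 2 * ((a - b) ^ 2 + (b - c) ^ 2 + (c - a) ^ 2) +
      3 * (a * (b - c) ^ 2 + b * (c - a) ^ 2 + c * (a - b) ^ 2) := by
    have hc' : c = 1 - a - b := by linarith
    rw [hc']; ring
  have p1 : 0 ≤ a * (b - c) ^ 2 := by positivity
  have p2 : 0 ≤ b * (c - a) ^ 2 := by positivity
  have p3 : 0 ≤ c * (a - b) ^ 2 := by positivity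
  have q1 : (a - b) ^ 2 = 0 := by nlinarith [sq_nonneg (a - b), sq_nonneg (b - c), sq_nonneg (c - a)]
  have q2 : (b - c) ^ 2 = 0 := by nlinarith [sq_nonneg (a - b), sq_nonneg (b - c), sq_nonneg (c - a)]
  have r1 := pow_eq_zero_iff (two_ne_zero) |>.1 q1
  have r2 := pow_eq_zero_iff (two_ne_zero) |>.1 q2
  constructor <;> linarith

/-- Only the central torus y¹ = y² = y³ = 1/3 satisfies the bound, and there both multipliers of V
vanish. -/
theorem isMIntegralCurve_const_of_prod_ge {p : CP2} (hp : p ∉ sigmaDivisor)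
    (h : 1 / 27 ≤ ∏ k, moment k p) :
    IsMIntegralCurve (I := 𝓘(ℝ, ℂ × ℂ)) (fun _ => p) hitchinV := by
  obtain ⟨w, h1, h2, rfl⟩ := exists_ofAffine_of_notMem hp
  rw [Fin.prod_univ_three] at h
  obtain ⟨m0, m1⟩ := eq_one_third_of_prod_ge (moment_pos h1 h2 0) (moment_pos h1 h2 1)
    (moment_pos h1 h2 2) (moment_ofAffine_sum w) h
  intro t
  refine hasMFDerivAt_ofAffine_curve (hasDerivAt_const t w) ((hitchinV_ofAffine h1 h2).trans ?_)
  rw [affineV, m0, m1]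
  norm_num
  rfl

/-- Off the divisor, the coordinate translation serves below the level 1/27 and rest on the central
torus. On the divisor nothing is required, so a constant is used. -/
theorem exists_isHitchinFlow : ∃ φ : ℝ → CP2 → CP2, IsHitchinFlow φ := by
  have key : ∀ p : CP2, ∃ γ : ℝ → CP2, p ∉ sigmaDivisor → (γ 0 = p ∧ (∀ t, γ t ∉ sigmaDivisor) ∧
      IsMIntegralCurve (I := 𝓘(ℝ, ℂ × ℂ)) γ hitchinV) := by
    intro p
    by_cases h : ∏ k, moment k p < 1 / 27
    · by_cases hp : p ∈ sigmaDivisor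
      · exact ⟨fun _ => p, fun h => absurd hp h⟩
      obtain ⟨x, hx, rfl⟩ := (image_coordPoint.symm ▸ (⟨hp, h⟩ : p ∉ sigmaDivisor ∧ _) :
        p ∈ coordPoint '' {x | x (.inl 0) ∈ Set.Ioo (0 : ℝ) (1 / 27)})
      exact ⟨fun t => coordPoint (coordFlow t x), fun _ => ⟨congrArg coordPoint (coordFlow_zero x),
        fun t => coordPoint_notMem (by simpa using hx), isMIntegralCurve_coordPoint hx⟩⟩
    · exact ⟨fun _ => p, fun hp => ⟨rfl, fun _ => hp,
        isMIntegralCurve_const_of_prod_ge hp (not_lt.1 h)⟩⟩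
  choose γ hγ using key
  exact ⟨fun t p => γ p t, fun p hp => (hγ p hp).1, fun t p hp => (hγ p hp).2.1 t,
    fun p hp => (hγ p hp).2.2⟩

/-! ### The two complex structures in the coordinates -/

open Matrix

section ComplexStructures

variable {c : ℝ}

/-- The prefactor 4πc/ω₁ is the inverse of the determinant and the matrix is minus the adjugate. -/
theorem Jangle_mul_Jradial (hc : c ∈ Set.Ioo (0 : ℝ) (1 / 27)) (s : ℝ) :
    Jangle c s * Jradial c s = -1 := by
  have hw := (omega1_pos hc).ne'
  have h0 : c ≠ 0 := hc.1.ne'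
  have hpi := Real.pi_ne_zero
  have hd := det_Jangle hc s
  rw [Matrix.det_fin_two, eq_div_iff (by positivity)] at hd
  have hr : ∀ i j, Jradial c s i j = (4 * c * Real.pi / omega1 c) *
      !![-Jangle c s 1 1, Jangle c s 0 1; Jangle c s 1 0, -Jangle c s 0 0] i j := fun i j => rfl
  ext i j
  simp only [Matrix.mul_apply, Fin.sum_univ_two, hr]
  fin_cases i <;> fin_cases j <;> simp <;> field_simp
  · linear_combination -hd
  · ring
  · ring
  · linear_combination -hd

/-- Multiplication by i commutes with the factors zⁱ, so it acts on dr + i dθ alone: M·(radial part)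
becomes the angular part, and the angular part becomes minus M·(radial part). -/
theorem mulI_affineFrame (hc : c ∈ Set.Ioo (0 : ℝ) (1 / 27)) (s : ℝ) (z : ℂ × ℂ) (v : Coord → ℝ) :
    mulI (affineFrame (Jangle c s) z v) = affineFrame (Jangle c s) z (Jmatrix c s *ᵥ v) := by
  have hv : v = Sum.elim (v ∘ Sum.inl) (v ∘ Sum.inr) := (Sum.elim_comp_inl_inr v).symm
  have key : ∀ i, Complex.I * logFrame (Jangle c s) i v =
      logFrame (Jangle c s) i (Jmatrix c s *ᵥ v) := by
    intro i
    have e : Jmatrix c s *ᵥ v = Sum.elim (Jradial c s *ᵥ (v ∘ Sum.inr))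
        (Jangle c s *ᵥ (v ∘ Sum.inl)) := by
      rw [Jmatrix, Matrix.fromBlocks_mulVec]
      simp
    have e2 : Jangle c s *ᵥ (Jradial c s *ᵥ (v ∘ Sum.inr)) = -(v ∘ Sum.inr) := by
      rw [Matrix.mulVec_mulVec, Jangle_mul_Jradial hc, Matrix.neg_mulVec, Matrix.one_mulVec]
    have e3 := congrFun e2 i
    rw [Matrix.mulVec, dotProduct, Fin.sum_univ_two] at e3
    rw [logFrame_apply, logFrame_apply, e]
    simp only [Sum.elim_inl, Sum.elim_inr, e3]
    rw [Matrix.mulVec, dotProduct, Fin.sum_univ_two]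
    apply Complex.ext <;> simp
  rw [affineFrame_apply, affineFrame_apply, ← key, ← key]
  refine Prod.ext ?_ ?_ <;> simp [mulI] <;> ring

/-- The differential of the flow in the coordinates. -/
noncomputable def shear (κ : ℝ) : (Coord → ℝ) →L[ℝ] (Coord → ℝ) :=
  ContinuousLinearMap.id ℝ _ +
    (κ • ContinuousLinearMap.proj (R := ℝ) (φ := fun _ : Coord => ℝ) (.inl 0)).smulRight
      (Pi.single (.inl 1) 1)

theorem shear_apply (κ : ℝ) (v : Coord → ℝ) :
    shear κ v = v + (κ * v (.inl 0)) • Pi.single (.inl 1) 1 := by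
  simp [shear]

theorem shear_shear (κ : ℝ) (v : Coord → ℝ) : shear (-κ) (shear κ v) = v := by
  simp [shear_apply]

/-- `shear κ` as an equivalence. -/
noncomputable def shearEquiv (κ : ℝ) : (Coord → ℝ) ≃L[ℝ] (Coord → ℝ) :=
  ContinuousLinearEquiv.equivOfInverse (shear κ) (shear (-κ)) (shear_shear κ)
    (fun v => by simpa using shear_shear (-κ) v)

theorem hasFDerivAt_coordFlow {x : Coord → ℝ} (hc : x (.inl 0) ∈ Set.Ioo (0 : ℝ) (1 / 27)) (t : ℝ) :
    HasFDerivAt (coordFlow t) (shear (3 * etaTilde1 (x (.inl 0)) * Real.pi * t /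
      (omega1 (x (.inl 0)) ^ 2 * x (.inl 0) * (1 - 27 * x (.inl 0))))) x := by
  have hpr : ∀ j : Coord, HasFDerivAt (fun x : Coord → ℝ => x j)
      (ContinuousLinearMap.proj (R := ℝ) (φ := fun _ : Coord => ℝ) j) x := fun j =>
    (ContinuousLinearMap.proj (R := ℝ) (φ := fun _ : Coord => ℝ) j).hasFDerivAt
  rw [hasFDerivAt_pi']
  intro j
  rcases j with j | j
  · fin_cases j
    · simp only [Fin.zero_eta, coordFlow_inl_zero]
      refine (hpr _).congr_fderiv ?_
      ext v
      simp [shear_apply]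
    · simp only [Fin.mk_one, coordFlow_inl_one]
      have h := HasDerivAt.comp_hasFDerivAt
        (h₂ := fun c' : ℝ => 0 + Real.pi * t / omega1 c') x
        (hasDerivAt_shift hc 0 t) (hpr (.inl 0))
      simp only [zero_add] at h
      refine ((hpr (.inl 1)).add h).congr_fderiv ?_
      ext v
      simp [shear_apply]
  · simp only [coordFlow_inr]
    refine (hpr _).congr_fderiv ?_
    ext v
    simp [shear_apply]

theorem component_eq {A : ∀ p : CP2, TCP2 p →L[ℝ] TCP2 p} {x : Coord → ℝ}
    {e : (Coord → ℝ) ≃L[ℝ] ℂ × ℂ} (he : coordFrame x = (e : (Coord → ℝ) →L[ℝ] ℂ × ℂ))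
    (a b : Coord) :
    component A x a b = e.symm (A (coordPoint x) (e (Pi.single b 1))) a := by
  have h := congrArg (fun f : (Coord → ℝ) →L[ℝ] ℂ × ℂ =>
    f.inverse (A (coordPoint x) (f (Pi.single b 1))) a) he
  refine h.trans ?_
  simp only [ContinuousLinearMap.inverse_equiv]
  rfl

theorem symm_mulI_apply (hc : c ∈ Set.Ioo (0 : ℝ) (1 / 27)) {s : ℝ} {z : ℂ × ℂ}
    {e : (Coord → ℝ) ≃L[ℝ] ℂ × ℂ}
    (he : (e : (Coord → ℝ) →L[ℝ] ℂ × ℂ) = affineFrame (Jangle c s) z) (v : Coord → ℝ) :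
    e.symm (mulI (e v)) = Jmatrix c s *ᵥ v := by
  have h : ∀ v, e v = affineFrame (Jangle c s) z v := fun v => by rw [← he]; rfl
  rw [ContinuousLinearEquiv.symm_apply_eq, h, h, mulI_affineFrame hc]

theorem component_Iminus {x : Coord → ℝ} (hc : x (.inl 0) ∈ Set.Ioo (0 : ℝ) (1 / 27))
    (a b : Coord) : component Iminus x a b = Jmatrix (x (.inl 0)) (x (.inl 1)) a b := by
  obtain ⟨e, he⟩ := affineFrame_Jangle_isInvertible hc
  rw [component_eq ((coordFrame_eq hc).trans he.symm)]
  have := symm_mulI_apply hc he (Pi.single b 1)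
  rw [Matrix.mulVec_single_one] at this
  exact congrFun this a

/-- The parametrization is periodic in the angles, so only a local inverse g exists. Near the point
the flow is `affinePoint ∘ coordFlow t ∘ g`, and the chain rule applies. -/
theorem IsHitchinFlow.hasMFDerivAt_coordPoint {φ : ℝ → CP2 → CP2} (hφ : IsHitchinFlow φ)
    {x : Coord → ℝ} (hc : x (.inl 0) ∈ Set.Ioo (0 : ℝ) (1 / 27)) (t : ℝ)
    {e : (Coord → ℝ) ≃L[ℝ] ℂ × ℂ} (he : (e : (Coord → ℝ) →L[ℝ] ℂ × ℂ) =
      affineFrame (Jangle (x (.inl 0)) (x (.inl 1))) (affinePoint x)) :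
    HasMFDerivAt 𝓘(ℝ, ℂ × ℂ) 𝓘(ℝ, ℂ × ℂ) (φ t) (coordPoint x)
      (affineFrame (Jangle (x (.inl 0)) (coordFlow t x (.inl 1))) (affinePoint (coordFlow t x)) ∘L
        shear (3 * etaTilde1 (x (.inl 0)) * Real.pi * t /
          (omega1 (x (.inl 0)) ^ 2 * x (.inl 0) * (1 - 27 * x (.inl 0)))) ∘L
        (e.symm : ℂ × ℂ →L[ℝ] (Coord → ℝ))) := by
  have hs := hasStrictFDerivAt_affinePoint hc
  rw [← he] at hs
  have hg := hs.to_localInverse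
  set g := hs.localInverse affinePoint e x with hgdef
  have hgx : g (affinePoint x) = x := hs.localInverse_apply_image
  have hx : ∀ᶠ w in 𝓝 (affinePoint x), g w (.inl 0) ∈ Set.Ioo (0 : ℝ) (1 / 27) := by
    have hcont := hg.hasFDerivAt.continuousAt
    rw [ContinuousAt, hgx] at hcont
    exact hcont.eventually (isOpen_coordDomain.mem_nhds hc)
  have hc' : coordFlow t x (.inl 0) ∈ Set.Ioo (0 : ℝ) (1 / 27) := by simpa using hc
  have h1 := (hasFDerivAt_affinePoint hc').comp x (hasFDerivAt_coordFlow hc t)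
  rw [coordFlow_inl_zero] at h1
  have h2 : HasFDerivAt ((affinePoint ∘ coordFlow t) ∘ g) _ (affinePoint x) :=
    HasFDerivAt.comp (affinePoint x) (by rw [hgx]; exact h1) hg.hasFDerivAt
  refine hasMFDerivAt_of_eventually_ofAffine h2 ?_
  filter_upwards [hx, hs.eventually_right_inverse] with w hw hw'
  have := hφ.apply_coordPoint hw t
  rw [coordPoint_eq, coordPoint_eq, hw'] at this
  exact this

/-- In the coordinates, `I₊` is the conjugate by `shear` of the standard complex structure at the
shifted point. -/
theorem IsHitchinFlow.mfderiv_and_component {φ : ℝ → CP2 → CP2} (hφ : IsHitchinFlow φ)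
    {x : Coord → ℝ} (hc : x (.inl 0) ∈ Set.Ioo (0 : ℝ) (1 / 27)) (t : ℝ) {κ : ℝ}
    (hκ : κ = 3 * etaTilde1 (x (.inl 0)) * Real.pi * t /
          (omega1 (x (.inl 0)) ^ 2 * x (.inl 0) * (1 - 27 * x (.inl 0)))) :
    MDifferentiableAt 𝓘(ℝ, ℂ × ℂ) 𝓘(ℝ, ℂ × ℂ) (φ t) (coordPoint x) ∧
    (mfderiv 𝓘(ℝ, ℂ × ℂ) 𝓘(ℝ, ℂ × ℂ) (φ t) (coordPoint x)).IsInvertible ∧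
    ∀ a b, component (Iplus (φ t)) x a b =
      shear (-κ) (Jmatrix (x (.inl 0)) (coordFlow t x (.inl 1)) *ᵥ shear κ (Pi.single b 1)) a := by
  obtain ⟨e, he⟩ := affineFrame_Jangle_isInvertible hc
  have hc' : coordFlow t x (.inl 0) ∈ Set.Ioo (0 : ℝ) (1 / 27) := by simpa using hc
  obtain ⟨e', he'⟩ := affineFrame_Jangle_isInvertible hc'
  rw [coordFlow_inl_zero] at he'
  have hd := hφ.hasMFDerivAt_coordPoint hc t he
  rw [← hκ, ← he'] at hd
  -- In the frames e and e' at the two ends the differential of the flow is the shear, so e⁻¹E⁻¹ i E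
  -- e is the shear conjugate of e'⁻¹ i e' = J(c, s').
  set E : (ℂ × ℂ) ≃L[ℝ] (ℂ × ℂ) := (e.symm.trans (shearEquiv κ)).trans e' with hE
  have hm : mfderiv 𝓘(ℝ, ℂ × ℂ) 𝓘(ℝ, ℂ × ℂ) (φ t) (coordPoint x) =
      (E : (ℂ × ℂ) →L[ℝ] (ℂ × ℂ)) := hd.mfderiv
  refine ⟨hd.mdifferentiableAt, ⟨E, hm.symm⟩, fun a b => ?_⟩
  rw [component_eq ((coordFrame_eq hc).trans he.symm)]
  have hI : ∀ v : ℂ × ℂ, Iplus (φ t) (coordPoint x) v = E.symm (mulI (E v)) := by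
    intro v
    have h := congrArg (fun f : ℂ × ℂ →L[ℝ] ℂ × ℂ => f.inverse (mulI (f v))) hm
    refine Eq.trans ?_ (h.trans ?_)
    · rfl
    · simp only [ContinuousLinearMap.inverse_equiv]
      rfl
  have h1 : E (e (Pi.single b 1)) = e' (shear κ (Pi.single b 1)) := by
    simp only [hE, ContinuousLinearEquiv.trans_apply, ContinuousLinearEquiv.symm_apply_apply]
    rfl
  have h2 : ∀ w, e.symm (E.symm w) = shear (-κ) (e'.symm w) := by
    intro w
    rw [ContinuousLinearEquiv.symm_apply_eq, ContinuousLinearEquiv.symm_apply_eq]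
    simp only [hE, ContinuousLinearEquiv.trans_apply, ContinuousLinearEquiv.symm_apply_apply]
    rw [← ContinuousLinearEquiv.symm_apply_eq, eq_comm]
    change shear κ (shear (-κ) _) = _
    simpa using shear_shear (-κ) (e'.symm w)
  refine (congrFun (congrArg e.symm (hI (e (Pi.single b 1)))) a).trans ?_
  rw [h1, h2, symm_mulI_apply hc he']

end ComplexStructures

theorem mainTheorem5 :
    -- the half periods are well defined, and the elliptic expressions are real
    (∀ c ∈ Set.Ioo (0 : ℝ) (1 / 27),
      (∃! L : PeriodPair, IsPeriodPairOf c L) ∧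
      (weierstrassZeta (periodsOf c) (omega1 c)).im = 0 ∧
      ∀ s : ℝ, (varsigma c s).im = 0) ∧
    -- `(c₃, s, θ₁, θ₂)` are local coordinates on the complement of the divisor and of the central
    -- torus, in which the functions `yᵏ` are given by the elliptic expressions
    (∀ c ∈ Set.Ioo (0 : ℝ) (1 / 27), ∀ (s : ℝ) (θ : Fin 2 → ℝ),
      MDifferentiableAt 𝓘(ℝ, Coord → ℝ) 𝓘(ℝ, ℂ × ℂ) coordPoint (coords c s θ) ∧
      (coordFrame (coords c s θ)).IsInvertible ∧
      ∀ k : Fin 3, (moment k (coordPoint (coords c s θ)) : ℂ) = yCurve k c s) ∧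
    coordPoint '' {x | x (.inl 0) ∈ Set.Ioo (0 : ℝ) (1 / 27)} =
      {p | p ∉ sigmaDivisor ∧ ∏ k, moment k p < 1 / 27} ∧
    -- the flow exists for all times
    (∃ φ : ℝ → CP2 → CP2, IsHitchinFlow φ) ∧
    -- the two complex structures
    ∀ φ : ℝ → CP2 → CP2, IsHitchinFlow φ →
      ∀ Δt : ℝ, ∀ c ∈ Set.Ioo (0 : ℝ) (1 / 27), ∀ (s : ℝ) (θ : Fin 2 → ℝ),
        let x := coords c s θ
        let s' := s + Real.pi * Δt / omega1 c
        let κ := 3 * etaTilde1 c * Real.pi * Δt / (omega1 c ^ 2 * c * (1 - 27 * c))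
        -- `I₋ = J(c₃, s)`
        (∀ a b : Coord, component Iminus x a b = Jmatrix c s a b) ∧
        -- `I₊`
        MDifferentiableAt 𝓘(ℝ, ℂ × ℂ) 𝓘(ℝ, ℂ × ℂ) (φ Δt) (coordPoint x) ∧
        (mfderiv 𝓘(ℝ, ℂ × ℂ) 𝓘(ℝ, ℂ × ℂ) (φ Δt) (coordPoint x)).IsInvertible ∧
        (∀ i : Fin 2,
          component (Iplus (φ Δt)) x (.inr i) (.inl 1) = Jmatrix c s' (.inr i) (.inl 1) ∧
          component (Iplus (φ Δt)) x (.inr i) (.inl 0) =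
            Jmatrix c s' (.inr i) (.inl 0) + Jmatrix c s' (.inr i) (.inl 1) * κ ∧
          component (Iplus (φ Δt)) x (.inl 1) (.inr i) =
            Jmatrix c s' (.inl 1) (.inr i) - Jmatrix c s' (.inl 0) (.inr i) * κ ∧
          component (Iplus (φ Δt)) x (.inl 0) (.inr i) = Jmatrix c s' (.inl 0) (.inr i)) ∧
        (∀ i j : Fin 2,
          component (Iplus (φ Δt)) x (.inl i) (.inl j) = 0 ∧
          component (Iplus (φ Δt)) x (.inr i) (.inr j) = 0) ∧
        -- the extra terms come from the `c₃`-derivative of the shifted argument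
        HasDerivAt (fun c' : ℝ => s + Real.pi * Δt / omega1 c') κ c := by
  have hx : ∀ c ∈ Set.Ioo (0 : ℝ) (1 / 27), ∀ (s : ℝ) (θ : Fin 2 → ℝ),
      coords c s θ (.inl 0) ∈ Set.Ioo (0 : ℝ) (1 / 27) := fun c hc s θ => hc
  refine ⟨fun c hc => ⟨existsUnique_isPeriodPairOf hc, zeta_omega1_im hc, fun s => ?_⟩,
    fun c hc s θ => ⟨(hasMFDerivAt_coordPoint (hx c hc s θ)).mdifferentiableAt, ?_, fun k => ?_⟩,
    image_coordPoint, exists_isHitchinFlow, ?_⟩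
  · rw [varsigma_eq hc, Complex.ofReal_im]
  · rw [coordFrame_eq (hx c hc s θ)]
    exact affineFrame_Jangle_isInvertible (hx c hc s θ)
  · rw [moment_coordPoint (hx c hc s θ), yCurve_eq hc]
    rfl
  · intro φ hφ Δt c hc s θ x s' κ
    have hxc : x (.inl 0) ∈ Set.Ioo (0 : ℝ) (1 / 27) := hc
    obtain ⟨h1, h2, h3⟩ := hφ.mfderiv_and_component hxc Δt (κ := κ) rfl
    have e : Jmatrix (x (.inl 0)) (coordFlow Δt x (.inl 1)) = Jmatrix c s' := by
      rw [coordFlow_inl_one]; rfl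
    rw [e] at h3
    have hJ : ∀ i j, Jmatrix c s' (.inl i) (.inl j) = 0 := fun _ _ => rfl
    have hJ' : ∀ i j, Jmatrix c s' (.inr i) (.inr j) = 0 := fun _ _ => rfl
    -- Conjugation by the shear adds κ times the s-column to the c₃-column and subtracts κ times the
    -- c₃-row from the s-row. The κ² term multiplies the entry J^{c₃}_s = 0.
    have h4 : ∀ a b, component (Iplus (φ Δt)) x a b =
        (Jmatrix c s' a b + κ * (Pi.single b 1 : Coord → ℝ) (.inl 0) * Jmatrix c s' a (.inl 1)) -
          κ * (Jmatrix c s' (.inl 0) b +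
            κ * (Pi.single b 1 : Coord → ℝ) (.inl 0) * Jmatrix c s' (.inl 0) (.inl 1)) *
            (Pi.single (.inl 1) 1 : Coord → ℝ) a := by
      intro a b
      rw [h3, shear_apply, shear_apply, Matrix.mulVec_add, Matrix.mulVec_smul,
        Matrix.mulVec_single_one, Matrix.mulVec_single_one]
      simp
      ring
    refine ⟨component_Iminus hxc, h1, h2, fun i => ⟨?_, ?_, ?_, ?_⟩, fun i j => ⟨?_, ?_⟩,
      hasDerivAt_shift hc s Δt⟩
    · simp [h4]
    · simp [h4, mul_comm]
    · simp [h4, mul_comm]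
    · simp [h4]
    · fin_cases i <;> fin_cases j <;> simp [h4, hJ]
    · simp [h4, hJ']
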